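/- Let $p$ be an odd prime, let $A$ be a finite abelian $p$-group, let $P$ be a $p$-group acting on $A$ by automorphisms, and let $\lambda\colon A\times A\to A$ be a biadditive alternating map with $g\cdot\lambda(a,b)=\lambda(g\cdot a,g\cdot b)$ for $g\in P$, and with $\lambda(\lambda(a,b),c)=0$ for all $a,b,c\in A$. Let $A_\lambda$ be the group with underlying set $A$ and operation $a+_\lambda b=a+b+\tfrac12\lambda(a,b)$, on which $P$ acts as on $A$. Assume that: (a) the action of $P$ on $A$ has an integral lifting: for some isomorphism $A\cong C_{p^{i_1}}\times\dots\times C_{p^{i_d}}$ with all $i_l\ge 1$ it is induced by a homomorphism from $P$ to the multiplicative monoid of integral $d\times d$ matrices whose $(n,m)$ entry is divisible by $\max(p^{i_n-i_m},1)$; (b) $A_\lambda$ is powerful ($[A_\lambda,A_\lambda]\subseteq A_\lambda^{\,p}$) and $p$-central ($\Omega_1(A_\lambda)\subseteq Z(A_\lambda)$, where $\Omega_1(G)=\langle g\in G\mid g^p=1\rangle$), and has the $\Omega$-extension property ($A_\lambda\cong H/\Omega_1(H)$ for some finite $p$-central group $H$). Let $C^*(G;\mathbb F_p)$ denote the standard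 (homogeneous) cochain complex of a group $G$ with its cup product. The realizability conjecture for $(A,P,\lambda)$ asserts that, under (a) and (b), there is a finite zig-zag of quasi-isomorphisms of cochain complexes $$C^*(A;\mathbb F_p)\leftarrow U_1\to U_2\leftarrow\dots\leftarrow U_r\to C^*(A_\lambda;\mathbb F_p),$$ where each $U_i$ is a cochain complex in degrees $\ge 0$ with a $P$-action and an associative unital product satisfying the Leibniz rule, and each morphism is $P$-invariant and induces a ring isomorphism in cohomology (the morphisms need not commute with the products on cochains). If the realizability conjecture holds for $(A,P,\lambda)$, then there are filtrations of the graded algebras $H^*(A_\lambda\rtimes P;\mathbb F_p)$ and $H^*(A\rtimes P;\mathbb F_p)$ (decreasing filtrations $H^*=F^0\supseteq F^1\supseteq\cdots$ by graded subspaces with $F^s\cdot F^t\subseteq F^{s+t}$ and $F^{n+1}H^n=0$) such that the associated bigraded algebras are isomorphic. Moreover, these filtrations can be taken to be the Lyndon–Hochschild–Serre filtrations of the extensions $A_\lambda\to A_\lambda\rtimes P\to P$ and $A\to A\rtimes P\to P$: $F^sH^n$ consists of the classes of homogeneous cocycles $f$ such that $f(g_0,\dots,g_n)=0$ whenever the images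 $\bar g_0,\dots,\bar g_n$ in $P$ satisfy $\#\{i\mid \bar g_i\neq\bar g_{i+1}\}<s$. -/

import Mathlib

open scoped Matrix

universe u v w

namespace TwistedCohomology

/-! ## Graded algebras and differential graded algebras -/

/-- An associative unital `k`-algebra graded by an additive monoid `ι`, given by its homogeneous
components.  The product `mul h : X i × X j → X l` is available for every proof `h : i + j = l`. -/
structure GradedAlg (k : Type) [CommRing k] (ι : Type) [AddMonoid ι] where
  X : ι → Type w
  [instAddCommGroup : ∀ i, AddCommGroup (X i)]
  [instModule : ∀ i, Module k (X i)]
  mul : ∀ {i j l : ι}, i + j = l → X i →ₗ[k] X j →ₗ[k] X l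
  one : X 0
  one_mul : ∀ {i : ι} (h : 0 + i = i) (x : X i), mul h one x = x
  mul_one : ∀ {i : ι} (h : i + 0 = i) (x : X i), mul h x one = x
  mul_assoc : ∀ {i j l a b n : ι} (hij : i + j = a) (hal : a + l = n) (hjl : j + l = b)
    (hib : i + b = n) (x : X i) (y : X j) (z : X l),
    mul hal (mul hij x y) z = mul hib x (mul hjl y z)

attribute [instance] GradedAlg.instAddCommGroup GradedAlg.instModule

/-- An isomorphism of graded algebras: degreewise linear bijections respecting product and unit. -/
structure GradedAlg.Iso {k : Type} [CommRing k] {ι : Type} [AddMonoid ι]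
    (S T : GradedAlg.{w} k ι) where
  e : ∀ i, S.X i ≃ₗ[k] T.X i
  map_one : e 0 S.one = T.one
  map_mul : ∀ {i j l : ι} (h : i + j = l) (x : S.X i) (y : S.X j),
    e l (S.mul h x y) = T.mul h (e i x) (e j y)

/-- A differential graded algebra: a cochain complex in degrees `0, 1, 2, …` with an associative
unital product satisfying the Leibniz rule. -/
structure DGAlg (k : Type) [CommRing k] extends GradedAlg.{w} k ℕ where
  d : ∀ n, X n →ₗ[k] X (n + 1)
  d_d : ∀ n (x : X n), d (n + 1) (d n x) = 0
  leibniz : ∀ {i j l : ℕ} (h : i + j = l) (h₁ : i + 1 + j = l + 1) (h₂ : i + (j + 1) = l + 1)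
    (x : X i) (y : X j),
    d l (mul h x y) = mul h₁ (d i x) y + (-1 : k) ^ i • mul h₂ x (d j y)

namespace DGAlg

variable {k : Type} [CommRing k] (D : DGAlg.{w} k)

/-- Cocycles in degree `n`. -/
def Z (n : ℕ) : Submodule k (D.X n) := LinearMap.ker (D.d n)

/-- Coboundaries in degree `n`. -/
def B : ∀ n : ℕ, Submodule k (D.X n)
  | 0 => ⊥
  | n + 1 => LinearMap.range (D.d n)

/-- The cohomology `Hⁿ = Zⁿ / Bⁿ`. -/
abbrev H (n : ℕ) : Type w := D.Z n ⧸ (D.B n).comap (D.Z n).subtype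

variable {D}

theorem d_of_mem_B : ∀ {n : ℕ} {x : D.X n}, x ∈ D.B n → D.d n x = 0
  | 0, x, hx => by
      have : x = 0 := by simpa [B] using hx
      simp [this]
  | n + 1, x, hx => by
      obtain ⟨y, rfl⟩ := hx
      exact D.d_d n y

theorem mul_mem_Z {i j l : ℕ} (h : i + j = l) {x : D.X i} {y : D.X j} (hx : x ∈ D.Z i)
    (hy : y ∈ D.Z j) : D.mul h x y ∈ D.Z l := by
  have hx' : D.d i x = 0 := hx
  have hy' : D.d j y = 0 := hy
  change D.d l _ = 0
  rw [D.leibniz h (by omega) (by omega), hx', hy']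
  simp

theorem mul_mem_B_left {i j l : ℕ} (h : i + j = l) {x : D.X i} {y : D.X j} (hx : x ∈ D.B i)
    (hy : y ∈ D.Z j) : D.mul h x y ∈ D.B l := by
  have hy' : D.d j y = 0 := hy
  cases i with
  | zero =>
    have : x = 0 := by simpa [B] using hx
    simp [this]
  | succ i =>
    obtain ⟨x', rfl⟩ := hx
    obtain rfl : l = i + j + 1 := by omega
    refine ⟨D.mul rfl x' y, ?_⟩
    rw [D.leibniz rfl h (by omega), hy']
    simp

theorem mul_mem_B_right {i j l : ℕ} (h : i + j = l) {x : D.X i} {y : D.X j} (hx : x ∈ D.Z i)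
    (hy : y ∈ D.B j) : D.mul h x y ∈ D.B l := by
  have hx' : D.d i x = 0 := hx
  cases j with
  | zero =>
    have : y = 0 := by simpa [B] using hy
    simp [this]
  | succ j =>
    obtain ⟨y', rfl⟩ := hy
    obtain rfl : l = i + j + 1 := by omega
    refine ⟨(-1 : k) ^ i • D.mul rfl x y', ?_⟩
    rw [map_smul, D.leibniz rfl (by omega) h, hx', map_zero, LinearMap.zero_apply, zero_add,
      smul_smul, ← mul_pow]
    simp

theorem one_mem_Z : D.one ∈ D.Z 0 := by
  have h := D.leibniz (i := 0) (j := 0) (l := 0) rfl rfl rfl D.one D.one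
  rw [D.one_mul rfl D.one] at h
  have h1 : D.mul (rfl : 0 + 1 + 0 = 0 + 1) (D.d 0 D.one) D.one = D.d 0 D.one :=
    D.mul_one rfl _
  have h2 : D.mul (rfl : 0 + (0 + 1) = 0 + 1) D.one (D.d 0 D.one) = D.d 0 D.one :=
    D.one_mul rfl _
  rw [h1, h2] at h
  change D.d 0 D.one = 0
  simpa using h

variable (D)

/-- The product of cocycles. -/
def mulZ {i j l : ℕ} (h : i + j = l) : D.Z i →ₗ[k] D.Z j →ₗ[k] D.Z l :=
  LinearMap.mk₂ k (fun x y => ⟨D.mul h x.1 y.1, mul_mem_Z h x.2 y.2⟩)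
    (fun _ _ _ => Subtype.ext (by simp)) (fun _ _ _ => Subtype.ext (by simp))
    (fun _ _ _ => Subtype.ext (by simp)) (fun _ _ _ => Subtype.ext (by simp))

/-- The product on cohomology, `[x] ∪ [y] = [x ∪ y]`. -/
def mulH {i j l : ℕ} (h : i + j = l) : D.H i →ₗ[k] D.H j →ₗ[k] D.H l :=
  LinearMap.liftQ₂ _ _ ((D.mulZ h).compr₂ ((D.B l).comap (D.Z l).subtype).mkQ)
    (fun x hx => by
      ext y
      exact (Submodule.Quotient.mk_eq_zero _).2 (mul_mem_B_left h hx y.2))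
    (fun y hy => by
      ext x
      exact (Submodule.Quotient.mk_eq_zero _).2 (mul_mem_B_right h x.2 hy))

/-- The cohomology algebra of a differential graded algebra. -/
def cohomology : GradedAlg.{w} k ℕ where
  X := D.H
  mul h := D.mulH h
  one := Submodule.Quotient.mk ⟨D.one, one_mem_Z⟩
  one_mul h x := by
    induction x using Submodule.Quotient.induction_on with | _ x => ?_
    exact congrArg Submodule.Quotient.mk (Subtype.ext (D.one_mul h x.1))
  mul_one h x := by
    induction x using Submodule.Quotient.induction_on with | _ x => ?_
    exact congrArg Submodule.Quotient.mk (Subtype.ext (D.mul_one h x.1))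
  mul_assoc hij hal hjl hib x y z := by
    induction x using Submodule.Quotient.induction_on with | _ x => ?_
    induction y using Submodule.Quotient.induction_on with | _ y => ?_
    induction z using Submodule.Quotient.induction_on with | _ z => ?_
    exact congrArg Submodule.Quotient.mk
      (Subtype.ext (D.mul_assoc hij hal hjl hib x.1 y.1 z.1))

end DGAlg

/-! ## Filtrations and associated bigraded algebras -/

/-- A (decreasing, finite in each degree) filtration `F 0 ⊇ F 1 ⊇ …` of a graded algebra by graded
subspaces: `F 0` is everything, `F (n + 1)` vanishes in degree `n`, and `F s · F t ⊆ F (s + t)`. -/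
structure Filtration {k : Type} [CommRing k] (S : GradedAlg.{w} k ℕ) where
  F : ℕ → ∀ n, Submodule k (S.X n)
  anti : ∀ s n, F (s + 1) n ≤ F s n
  zero_eq_top : ∀ n, F 0 n = ⊤
  succ_eq_bot : ∀ n, F (n + 1) n = ⊥
  mul_mem : ∀ {s t i j l : ℕ} (h : i + j = l) {x : S.X i} {y : S.X j},
    x ∈ F s i → y ∈ F t j → S.mul h x y ∈ F (s + t) l

namespace Filtration

variable {k : Type} [CommRing k] {S : GradedAlg.{w} k ℕ} (F : Filtration S)

/-- The component of filtration degree `a.1` and total degree `a.2` of the associated bigraded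
algebra: the quotient of `F a.1` by `F (a.1 + 1)` in degree `a.2`. -/
abbrev Gr (a : ℕ × ℕ) : Type w :=
  F.F a.1 a.2 ⧸ (F.F (a.1 + 1) a.2).comap (F.F a.1 a.2).subtype

theorem mul_mem' {a b c : ℕ × ℕ} (h : a + b = c) {x : S.X a.2} {y : S.X b.2}
    (hx : x ∈ F.F a.1 a.2) (hy : y ∈ F.F b.1 b.2) :
    S.mul (congrArg Prod.snd h) x y ∈ F.F c.1 c.2 := by
  subst h
  exact F.mul_mem _ hx hy

/-- The product `F a.1 × F b.1 → F (a.1 + b.1)`. -/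
def mulF {a b c : ℕ × ℕ} (h : a + b = c) :
    F.F a.1 a.2 →ₗ[k] F.F b.1 b.2 →ₗ[k] F.F c.1 c.2 :=
  LinearMap.mk₂ k (fun x y => ⟨S.mul (congrArg Prod.snd h) x.1 y.1, F.mul_mem' h x.2 y.2⟩)
    (fun _ _ _ => Subtype.ext (by simp)) (fun _ _ _ => Subtype.ext (by simp))
    (fun _ _ _ => Subtype.ext (by simp)) (fun _ _ _ => Subtype.ext (by simp))

/-- The product of the associated bigraded algebra. -/
def mulGr {a b c : ℕ × ℕ} (h : a + b = c) : F.Gr a →ₗ[k] F.Gr b →ₗ[k] F.Gr c :=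
  LinearMap.liftQ₂ _ _ ((F.mulF h).compr₂ ((F.F (c.1 + 1) c.2).comap (F.F c.1 c.2).subtype).mkQ)
    (fun x hx => by
      ext y
      refine (Submodule.Quotient.mk_eq_zero _).2 ?_
      have := F.mul_mem (congrArg Prod.snd h) (s := a.1 + 1) (t := b.1) hx y.2
      have hc : a.1 + 1 + b.1 = c.1 + 1 := by rw [← h]; simp only [Prod.fst_add]; omega
      rw [hc] at this
      exact this)
    (fun y hy => by
      ext x
      refine (Submodule.Quotient.mk_eq_zero _).2 ?_
      have := F.mul_mem (congrArg Prod.snd h) (s := a.1) (t := b.1 + 1) x.2 hy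
      have hc : a.1 + (b.1 + 1) = c.1 + 1 := by rw [← h]; simp only [Prod.fst_add]; omega
      rw [hc] at this
      exact this)

/-- The associated bigraded algebra of a filtration of a graded algebra. -/
def assocBigraded : GradedAlg.{w} k (ℕ × ℕ) where
  X := F.Gr
  mul h := F.mulGr h
  one := Submodule.Quotient.mk
    ⟨S.one, by simpa only [Prod.fst_zero, Prod.snd_zero, F.zero_eq_top] using Submodule.mem_top⟩
  one_mul h x := by
    induction x using Submodule.Quotient.induction_on with | _ x => ?_
    exact congrArg Submodule.Quotient.mk (Subtype.ext (S.one_mul _ x.1))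
  mul_one h x := by
    induction x using Submodule.Quotient.induction_on with | _ x => ?_
    exact congrArg Submodule.Quotient.mk (Subtype.ext (S.mul_one _ x.1))
  mul_assoc hij hal hjl hib x y z := by
    induction x using Submodule.Quotient.induction_on with | _ x => ?_
    induction y using Submodule.Quotient.induction_on with | _ y => ?_
    induction z using Submodule.Quotient.induction_on with | _ z => ?_
    exact congrArg Submodule.Quotient.mk
      (Subtype.ext (S.mul_assoc _ _ _ _ x.1 y.1 z.1))

end Filtration

/-! ## Standard cochains and the cohomology algebra of a group -/

section Std

variable (k : Type) [CommRing k] (G : Type u) [Group G]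

/-- Homogeneous cochains: `G`-invariant functions on `(n + 1)`-tuples, that is
`Hom_{kG}(Bₙ(G; k), k)` for the standard resolution. -/
def cochains (n : ℕ) : Submodule k ((Fin (n + 1) → G) → k) where
  carrier := {f | ∀ (g : G) (x : Fin (n + 1) → G), f (fun i => g * x i) = f x}
  add_mem' hf hf' g x := by simp [hf g x, hf' g x]
  zero_mem' g x := rfl
  smul_mem' c f hf g x := by simp [hf g x]

variable {k G}

/-- `(δ f)(x₀, …, x_{n+1}) = (-1)^{n+1} ∑ (-1)^i f(x₀, …, x̂ᵢ, …, x_{n+1})`. -/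
def stdD (n : ℕ) : cochains k G n →ₗ[k] cochains k G (n + 1) where
  toFun f := ⟨fun x => (-1) ^ (n + 1) *
      ∑ i : Fin (n + 2), (-1) ^ (i : ℕ) * f.1 (fun j => x (i.succAbove j)),
    fun g x => by
      refine congrArg ((-1) ^ (n + 1) * ·) (Finset.sum_congr rfl fun i _ => ?_)
      exact congrArg ((-1) ^ (i : ℕ) * ·) (f.2 g (fun j => x (i.succAbove j)))⟩
  map_add' f f' := by
    ext x
    simp [mul_add, Finset.sum_add_distrib]
  map_smul' c f := by
    ext x
    simp only [SetLike.val_smul, Pi.smul_apply, smul_eq_mul, RingHom.id_apply]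
    rw [mul_left_comm c, Finset.mul_sum _ _ c]
    congr 1
    exact Finset.sum_congr rfl fun i _ => by ring

/-- `(f ∪ f')(x₀, …, x_{i+j}) = (-1)^{ij} f(x₀, …, xᵢ) f'(xᵢ, …, x_{i+j})`. -/
def stdCup {i j l : ℕ} (h : i + j = l) :
    cochains k G i →ₗ[k] cochains k G j →ₗ[k] cochains k G l :=
  LinearMap.mk₂ k
    (fun f f' => ⟨fun x => (-1) ^ (i * j) *
        (f.1 (fun a => x ⟨a, by omega⟩) * f'.1 (fun b => x ⟨i + b, by omega⟩)),
      fun g x => by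
        have hf := f.2 g (fun a => x ⟨a, by omega⟩)
        have hf' := f'.2 g (fun b => x ⟨i + b, by omega⟩)
        beta_reduce
        rw [hf, hf']⟩)
    (fun _ _ _ => by ext x; simp; ring) (fun _ _ _ => by ext x; simp; ring)
    (fun _ _ _ => by ext x; simp; ring) (fun _ _ _ => by ext x; simp; ring)

/-- The constant cochain `1`. -/
def stdOne : cochains k G 0 := ⟨fun _ => 1, fun _ _ => rfl⟩

theorem stdD_stdD (n : ℕ) (f : cochains k G n) : stdD (n + 1) (stdD n f) = 0 := by
  ext x
  simp only [stdD, LinearMap.coe_mk, AddHom.coe_mk, ZeroMemClass.coe_zero, Pi.zero_apply]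
  have key : ∑ i : Fin (n + 3), ∑ j : Fin (n + 2), (-1 : k) ^ (i + j : ℕ) *
      f.1 (fun a => x (i.succAbove (j.succAbove a))) = 0 := by
    rw [← Fintype.sum_prod_type']
    refine Finset.sum_involution
      (fun q _ => (q.1.succAbove q.2, q.2.predAbove q.1)) ?_ ?_ ?_ ?_
    · rintro ⟨i, j⟩ -
      simp only [Fin.neg_one_pow_succAbove_add_predAbove,
        Fin.succAbove_succAbove_succAbove_predAbove]
      ring
    · rintro ⟨i, j⟩ - - h
      exact Fin.succAbove_ne i j (congrArg Prod.fst h)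
    · simp
    · rintro ⟨i, j⟩ -
      simp [Fin.succAbove_succAbove_predAbove, Fin.predAbove_predAbove_succAbove]
  have : ∑ i : Fin (n + 3), (-1 : k) ^ (i : ℕ) * ((-1) ^ (n + 1) *
      ∑ j : Fin (n + 2), (-1) ^ (j : ℕ) * f.1 (fun a => x (i.succAbove (j.succAbove a)))) = 0 := by
    rw [← mul_zero ((-1 : k) ^ (n + 1)), ← key, Finset.mul_sum]
    refine Finset.sum_congr rfl fun i _ => ?_
    rw [mul_left_comm, Finset.mul_sum]
    congr 1
    exact Finset.sum_congr rfl fun j _ => by rw [pow_add]; ring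
  rw [this, mul_zero]

theorem stdD_seq {n : ℕ} (f : cochains k G n) (y : ℕ → G) :
    (stdD n f).1 (fun a => y a) = (-1) ^ (n + 1) * ∑ t ∈ Finset.range (n + 2),
      (-1) ^ t * f.1 (fun a => y (if (a : ℕ) < t then (a : ℕ) else a + 1)) := by
  rw [← Fin.sum_univ_eq_sum_range
    (fun t => (-1 : k) ^ t * f.1 (fun a => y (if (a : ℕ) < t then (a : ℕ) else a + 1)))]
  simp only [stdD, LinearMap.coe_mk, AddHom.coe_mk]
  congr 1
  refine Finset.sum_congr rfl fun i _ => ?_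
  refine congrArg ((-1) ^ (i : ℕ) * ·) (congrArg f.1 (funext fun a => congrArg y ?_))
  simp only [Fin.succAbove, Fin.lt_def, Fin.val_castSucc]
  split_ifs <;> simp

theorem stdCup_apply {i j l : ℕ} (h : i + j = l) (f : cochains k G i) (f' : cochains k G j)
    (x : Fin (l + 1) → G) : (stdCup h f f').1 x = (-1) ^ (i * j) *
      (f.1 (fun a => x ⟨a, by omega⟩) * f'.1 (fun b => x ⟨i + b, by omega⟩)) := rfl

theorem stdLeibniz {i j l : ℕ} (h : i + j = l) (h₁ : i + 1 + j = l + 1)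
    (h₂ : i + (j + 1) = l + 1) (f : cochains k G i) (f' : cochains k G j) :
    stdD l (stdCup h f f') =
      stdCup h₁ (stdD i f) f' + (-1 : k) ^ i • stdCup h₂ f (stdD j f') := by
  subst h
  ext x
  obtain ⟨y, rfl⟩ : ∃ y : ℕ → G, x = fun a : Fin (i + j + 1 + 1) => y (a : ℕ) :=
    ⟨fun n => if hn : n < i + j + 1 + 1 then x ⟨n, hn⟩ else 1, by ext a; simp [a.2]⟩
  rw [stdD_seq]
  simp only [Submodule.coe_add, Pi.add_apply, SetLike.val_smul, Pi.smul_apply, smul_eq_mul,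
    stdCup_apply]
  rw [stdD_seq, stdD_seq f' (fun b => y (i + b))]
  have hsplit : i + j + 2 = (i + 1) + (j + 1) := by omega
  rw [hsplit, Finset.sum_range_add, Finset.sum_range_succ _ (i + 1),
    Finset.sum_range_succ' _ (j + 1)]
  have e1 : ∀ t ∈ Finset.range (i + 1), (-1 : k) ^ t * ((-1) ^ (i * j) *
      (f.1 (fun a => y (if (a : ℕ) < t then (a : ℕ) else a + 1)) *
        f'.1 (fun b => y (if i + (b : ℕ) < t then i + b else i + b + 1)))) =
      (-1) ^ (i * j) * f'.1 (fun b => y (i + 1 + b)) *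
        ((-1) ^ t * f.1 (fun a => y (if (a : ℕ) < t then (a : ℕ) else a + 1))) := by
    intro t ht
    have ht' := Finset.mem_range.1 ht
    have : (fun b : Fin (j + 1) => y (if i + (b : ℕ) < t then i + b else i + b + 1)) =
        fun b : Fin (j + 1) => y (i + 1 + (b : ℕ)) := by
      funext b
      rw [if_neg (by omega)]
      congr 1
      omega
    rw [this]
    ring
  have e2 : ∀ t ∈ Finset.range (j + 1), (-1 : k) ^ (i + 1 + t) * ((-1) ^ (i * j) *
      (f.1 (fun a => y (if (a : ℕ) < i + 1 + t then (a : ℕ) else a + 1)) *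
        f'.1 (fun b => y (if i + (b : ℕ) < i + 1 + t then i + b else i + b + 1)))) =
      (-1) ^ (i * j) * (-1) ^ i * f.1 (fun a => y a) *
        ((-1) ^ (t + 1) * f'.1 (fun b => y (i + (if (b : ℕ) < t + 1 then (b : ℕ) else b + 1)))) := by
    intro t _
    have h1 : (fun a : Fin (i + 1) => y (if (a : ℕ) < i + 1 + t then (a : ℕ) else a + 1)) =
        fun a : Fin (i + 1) => y (a : ℕ) := by
      funext a
      rw [if_pos (by omega)]
    have h2 : (fun b : Fin (j + 1) => y (if i + (b : ℕ) < i + 1 + t then i + b else i + b + 1)) =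
        fun b : Fin (j + 1) => y (i + (if (b : ℕ) < t + 1 then (b : ℕ) else b + 1)) := by
      funext b
      split_ifs <;> first | rfl | omega
    rw [h1, h2]
    ring
  rw [Finset.sum_congr rfl e1, Finset.sum_congr rfl e2, ← Finset.mul_sum, ← Finset.mul_sum]
  have h3 : (fun a : Fin (i + 1) => y (if (a : ℕ) < i + 1 then (a : ℕ) else a + 1)) =
      fun a : Fin (i + 1) => y (a : ℕ) := by
    funext a
    rw [if_pos (by omega)]
  have h4 : (fun b : Fin (j + 1) => y (i + (if (b : ℕ) < 0 then (b : ℕ) else b + 1))) =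
      fun b : Fin (j + 1) => y (i + 1 + (b : ℕ)) := by
    funext b
    rw [if_neg (by omega)]
    congr 1
    omega
  rw [h3, h4]
  generalize (∑ t ∈ Finset.range (i + 1), (-1 : k) ^ t *
    f.1 (fun a => y (if (a : ℕ) < t then (a : ℕ) else a + 1))) = S1
  generalize (∑ t ∈ Finset.range (j + 1), (-1 : k) ^ (t + 1) *
    f'.1 (fun b => y (i + (if (b : ℕ) < t + 1 then (b : ℕ) else b + 1)))) = S2
  generalize f.1 (fun a => y a) = u
  generalize f'.1 (fun b => y (i + 1 + b)) = w
  ring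

variable (k G)

/-- The standard cochain algebra `C^*(G; k)`. -/
def stdDGAlg : DGAlg.{u} k where
  X n := cochains k G n
  mul h := stdCup h
  one := stdOne
  one_mul h f := by
    ext x
    simp [stdCup_apply, stdOne]
  mul_one h f := by
    ext x
    simp [stdCup_apply, stdOne]
  mul_assoc hij hal hjl hib f f' f'' := by
    subst hij hal hjl
    ext x
    simp only [stdCup_apply, add_assoc, add_mul, mul_add, pow_add]
    ring
  d := stdD
  d_d := stdD_stdD
  leibniz h h₁ h₂ f f' := stdLeibniz h h₁ h₂ f f'

/-- The cohomology algebra `H^*(G; k)` with its cup product. -/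
def groupCoh : GradedAlg.{u} k ℕ := (stdDGAlg k G).cohomology

end Std

/-! ## Differential graded algebras with a group action, and zig-zags -/

/-- A differential graded algebra whose underlying cochain complex carries an action of `P`. -/
structure ActedDGAlg (k : Type) [CommRing k] (P : Type v) [Group P] extends DGAlg.{w} k where
  act : ∀ n, Representation k P (X n)
  act_d : ∀ n (g : P) (x : X n), act (n + 1) g (d n x) = d n (act n g x)

/-- A `P`-invariant map of cochain complexes.  It need not respect the products. -/
structure ActedDGAlg.Hom {k : Type} [CommRing k] {P : Type v} [Group P]
    (C D : ActedDGAlg.{v, w} k P) where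
  φ : ∀ n, C.X n →ₗ[k] D.X n
  comm_d : ∀ n x, φ (n + 1) (C.d n x) = D.d n (φ n x)
  comm_act : ∀ n g x, φ n (C.act n g x) = D.act n g (φ n x)

namespace ActedDGAlg.Hom

variable {k : Type} [CommRing k] {P : Type v} [Group P] {C D : ActedDGAlg.{v, w} k P}

theorem map_mem_Z (f : C.Hom D) {n : ℕ} {x : C.X n} (hx : x ∈ C.Z n) : f.φ n x ∈ D.Z n := by
  have hx' : C.d n x = 0 := hx
  change D.d n _ = 0
  rw [← f.comm_d, hx', map_zero]

theorem map_mem_B (f : C.Hom D) : ∀ {n : ℕ} {x : C.X n}, x ∈ C.B n → f.φ n x ∈ D.B n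
  | 0, x, hx => by
      have : x = 0 := by simpa [DGAlg.B] using hx
      simp [this]
  | n + 1, x, hx => by
      obtain ⟨y, rfl⟩ := hx
      exact ⟨f.φ n y, (f.comm_d n y).symm⟩

/-- The induced map in cohomology, `[x] ↦ [φ x]`. -/
def mapH (f : C.Hom D) (n : ℕ) : C.H n →ₗ[k] D.H n :=
  Submodule.mapQ _ _ ((f.φ n).restrict fun _ hx => f.map_mem_Z hx)
    fun _ hx => f.map_mem_B hx

end ActedDGAlg.Hom

/-- A `P`-invariant quasi-isomorphism of cochain complexes inducing a ring isomorphism in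
cohomology.  The cochain map itself need not respect the products. -/
structure ActedDGAlg.QuasiIso {k : Type} [CommRing k] {P : Type v} [Group P]
    (C D : ActedDGAlg.{v, w} k P) extends ActedDGAlg.Hom C D where
  bijective : ∀ n, Function.Bijective (toHom.mapH n)
  map_one : toHom.mapH 0 C.cohomology.one = D.cohomology.one
  map_mul : ∀ {i j l : ℕ} (h : i + j = l) (x : C.H i) (y : C.H j),
    toHom.mapH l (C.mulH h x y) = D.mulH h (toHom.mapH i x) (toHom.mapH j y)

/-- `C` and `D` are joined by a finite zig-zag `C ← U₁ → U₂ ← ⋯ → D` of `P`-invariant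
quasi-isomorphisms, each inducing a ring isomorphism in cohomology. -/
def ActedDGAlg.Zigzag {k : Type} [CommRing k] {P : Type v} [Group P]
    (C D : ActedDGAlg.{v, w} k P) : Prop :=
  Relation.EqvGen (fun X Y : ActedDGAlg.{v, w} k P => Nonempty (X.QuasiIso Y)) C D

/-- The action `(g · f)(x) = f(g⁻¹ · x)` on standard cochains of a group `N` on which `P` acts by
automorphisms. -/
def stdAct (k : Type) [CommRing k] {N : Type u} [Group N] {P : Type v} [Group P]
    (φ : P →* MulAut N) (n : ℕ) : Representation k P (cochains k N n) where
  toFun g :=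
    { toFun := fun f => ⟨fun x => f.1 (fun i => φ g⁻¹ (x i)), fun a x => by
        have h := f.2 (φ g⁻¹ a) (fun i => φ g⁻¹ (x i))
        simpa only [map_mul] using h⟩
      map_add' := fun _ _ => rfl
      map_smul' := fun _ _ => rfl }
  map_one' := by
    ext f x
    simp
  map_mul' g h := by
    ext f x
    simp

/-- The standard cochain algebra `C^*(N; k)` with its action of `P`. -/
def stdActedDGAlg (k : Type) [CommRing k] {N : Type u} [Group N] {P : Type v} [Group P]
    (φ : P →* MulAut N) : ActedDGAlg.{v, u} k P where
  toDGAlg := stdDGAlg k N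
  act := stdAct k φ
  act_d n g f := by
    apply Subtype.ext
    funext x
    rfl

/-! ## The filtration of the cohomology of a group extension -/

/-- The number of `i` with `x i ≠ x (i + 1)`, that is, the dimension of the nondegenerate simplex
of which `(x₀, …, xₙ)` is a degeneracy. -/
noncomputable def steps {Q : Type v} {n : ℕ} (x : Fin (n + 1) → Q) : ℕ :=
  open Classical in
  ∑ i : Fin n, if x i.castSucc = x i.succ then 0 else 1

theorem steps_le {Q : Type v} {n : ℕ} (x : Fin (n + 1) → Q) : steps x ≤ n := by
  classical
  unfold steps
  refine (Finset.sum_le_card_nsmul _ _ 1 fun i _ => ?_).trans (by simp)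
  split_ifs <;> simp

theorem steps_add {Q : Type v} {i j l : ℕ} (h : i + j = l) (x : Fin (l + 1) → Q) :
    steps x = steps (fun a : Fin (i + 1) => x ⟨a, by omega⟩) +
      steps (fun b : Fin (j + 1) => x ⟨i + b, by omega⟩) := by
  subst h
  unfold steps
  rw [Fin.sum_univ_add]
  rfl

/-- For a homomorphism `π : G → Q`, the cochains on `G` that vanish on all tuples whose image in the
standard resolution of `Q` lies in the `(s - 1)`-skeleton. -/
def skelCochains (k : Type) [CommRing k] {G : Type u} [Group G] {Q : Type v} [Group Q]
    (π : G →* Q) (s n : ℕ) : Submodule k (cochains k G n) where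
  carrier := {f | ∀ x : Fin (n + 1) → G, steps (fun i => π (x i)) < s → f.1 x = 0}
  add_mem' hf hf' x hx := by simp [hf x hx, hf' x hx]
  zero_mem' x _ := rfl
  smul_mem' c f hf x hx := by simp [hf x hx]

/-- The Lyndon–Hochschild–Serre filtration of `H^*(G; k)` for a homomorphism `π : G → Q`
(with kernel `N`, when `π` is onto, the one belonging to `H^*(Q; H^*(N; k)) ⇒ H^*(G; k)`):
`F s` consists of the classes of cocycles that vanish over the `(s - 1)`-skeleton of the standard
resolution of `Q`. -/
def lhsFiltration (k : Type) [CommRing k] {G : Type u} [Group G] {Q : Type v} [Group Q]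
    (π : G →* Q) : Filtration (groupCoh k G) where
  F s n := ((skelCochains k π s n).comap ((stdDGAlg k G).Z n).subtype).map
    (((stdDGAlg k G).B n).comap ((stdDGAlg k G).Z n).subtype).mkQ
  anti s n := Submodule.map_mono (Submodule.comap_mono fun f hf x hx => hf x (by omega))
  zero_eq_top n := by
    refine eq_top_iff.2 fun c _ => ?_
    induction c using Submodule.Quotient.induction_on with | _ z => ?_
    exact ⟨z, fun x hx => absurd hx (Nat.not_lt_zero _), rfl⟩
  succ_eq_bot n := by
    refine (Submodule.eq_bot_iff _).2 ?_
    rintro _ ⟨z, hz, rfl⟩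
    have h0 : z = 0 :=
      Subtype.ext (Subtype.ext (funext fun x => hz x (Nat.lt_succ_of_le (steps_le _))))
    rw [h0]
    rfl
  mul_mem := by
    rintro s t i j l h _ _ ⟨f, hf, rfl⟩ ⟨f', hf', rfl⟩
    refine ⟨(stdDGAlg k G).mulZ h f f', fun x hx => ?_, rfl⟩
    rw [steps_add h] at hx
    have hx' : steps (fun a : Fin (i + 1) => π (x ⟨a, by omega⟩)) < s ∨
        steps (fun b : Fin (j + 1) => π (x ⟨i + b, by omega⟩)) < t := by
      by_contra hcon
      rw [not_or] at hcon
      omega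
    refine (stdCup_apply h f.1 f'.1 x).trans ?_
    rcases hx' with hx' | hx'
    · have h0 := hf (fun a => x ⟨a, by omega⟩) hx'
      change f.1.1 _ = 0 at h0
      rw [h0]
      simp
    · have h0 := hf' (fun b => x ⟨i + b, by omega⟩) hx'
      change f'.1.1 _ = 0 at h0
      rw [h0]
      simp

/-! ## Twisted abelian groups -/

/-- An alternating biadditive `P`-equivariant map `λ : A × A → A` with `Im λ ⊆ Rad λ`. -/
structure TwistForm (P : Type v) (A : Type u) [Group P] [AddCommGroup A]
    [DistribMulAction P A] where
  form : A →+ A →+ A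
  alt : ∀ a, form a a = 0
  equivariant : ∀ (g : P) (a b : A), g • form a b = form (g • a) (g • b)
  im_le_rad : ∀ a b c, form (form a b) c = 0

/-- Multiplication by `1/2` on a finite abelian group of odd order. -/
noncomputable def half {A : Type u} [AddCommGroup A] (a : A) : A := ((Nat.card A + 1) / 2) • a

theorem two_nsmul_half {A : Type u} [AddCommGroup A] (hA : Odd (Nat.card A)) (a : A) :
    2 • half a = a := by
  obtain ⟨m, hm⟩ := hA
  have h : (Nat.card A + 1) / 2 = m + 1 := by omega
  have h' : 2 * (m + 1) = Nat.card A + 1 := by omega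
  rw [half, h, smul_smul, h', add_smul, one_smul, card_nsmul_eq_zero', zero_add]

section Twisted

variable {P : Type v} {A : Type u} [Group P] [AddCommGroup A] [DistribMulAction P A]

/-- The twisted group `A_λ`: the set `A` with the operation `a + b + (1/2) λ(a, b)`. -/
@[ext]
structure Twisted (L : TwistForm P A) where
  val : A

namespace TwistForm

variable (L : TwistForm P A)

theorem neg_swap (a b : A) : L.form a b = -L.form b a := by
  have h := L.alt (a + b)
  simp only [map_add, AddMonoidHom.add_apply, L.alt, zero_add, add_zero] at h
  exact eq_neg_of_add_eq_zero_right h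

theorem im_le_rad' (a b c : A) : L.form c (L.form a b) = 0 := by
  rw [L.neg_swap, L.im_le_rad, neg_zero]

end TwistForm

variable (L : TwistForm P A)

noncomputable instance : Group (Twisted L) where
  mul a b := ⟨a.val + b.val + half (L.form a.val b.val)⟩
  one := ⟨0⟩
  inv a := ⟨-a.val⟩
  mul_assoc a b c := by
    refine Twisted.ext ?_
    change a.val + b.val + half (L.form a.val b.val) + c.val +
        half (L.form (a.val + b.val + half (L.form a.val b.val)) c.val) =
      a.val + (b.val + c.val + half (L.form b.val c.val)) +
        half (L.form a.val (b.val + c.val + half (L.form b.val c.val)))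
    simp only [half, map_add, map_nsmul, AddMonoidHom.add_apply, AddMonoidHom.nsmul_apply,
      L.im_le_rad, L.im_le_rad', smul_zero, add_zero, smul_add]
    abel
  one_mul a := by
    refine Twisted.ext ?_
    change 0 + a.val + half (L.form 0 a.val) = a.val
    simp [half]
  mul_one a := by
    refine Twisted.ext ?_
    change a.val + 0 + half (L.form a.val 0) = a.val
    simp [half]
  inv_mul_cancel a := by
    refine Twisted.ext ?_
    change -a.val + a.val + half (L.form (-a.val) a.val) = 0
    simp [half, L.alt]

/-- The action of `P` on `A_λ`. -/
noncomputable def twistedAut : P →* MulAut (Twisted L) where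
  toFun g :=
    { toFun := fun a => ⟨g • a.val⟩
      invFun := fun a => ⟨g⁻¹ • a.val⟩
      left_inv := fun a => Twisted.ext (inv_smul_smul g a.val)
      right_inv := fun a => Twisted.ext (smul_inv_smul g a.val)
      map_mul' := fun a b => by
        refine Twisted.ext ?_
        change g • (a.val + b.val + half (L.form a.val b.val)) =
          g • a.val + g • b.val + half (L.form (g • a.val) (g • b.val))
        simp only [half, smul_add, smul_comm g, L.equivariant] }
  map_one' := by
    ext a
    exact one_smul P a.val
  map_mul' g h := by
    ext a
    exact mul_smul g h a.val

end Twisted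

/-- The action of `P` on the abelian group `A`, written multiplicatively. -/
def abelianAut (P : Type v) (A : Type u) [Group P] [AddCommGroup A] [DistribMulAction P A] :
    P →* MulAut (Multiplicative A) where
  toFun g := AddEquiv.toMultiplicative (DistribMulAction.toAddEquiv A g)
  map_one' := by
    ext a
    exact one_smul P (Multiplicative.toAdd a)
  map_mul' g h := by
    ext a
    exact mul_smul g h (Multiplicative.toAdd a)

/-! ## Powerful `p`-central groups, the extension property, integral liftings -/

/-- `Ω₁(G) = ⟨g ∈ G | g ^ p = 1⟩`. -/
def omegaOne (p : ℕ) (G : Type u) [Group G] : Subgroup G := Subgroup.closure {g | g ^ p = 1}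

/-- `Ω₁(G) ≤ Z(G)`. -/
def IsPCentral (p : ℕ) (G : Type u) [Group G] : Prop := omegaOne p G ≤ Subgroup.center G

/-- `[G, G] ≤ G ^ p`, where `p` is odd. -/
def IsPowerful (p : ℕ) (G : Type u) [Group G] : Prop :=
  commutator G ≤ Subgroup.closure (Set.range fun g : G => g ^ p)

/-- The `Ω`-extension property: `G ≅ H / Ω₁(H)` for some finite `p`-central group `H`. -/
def HasOmegaEP (p : ℕ) (G : Type u) [Group G] : Prop :=
  ∃ (H : Type u) (_ : Group H) (f : H →* G),
    Finite H ∧ IsPCentral p H ∧ Function.Surjective f ∧ f.ker = omegaOne p H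

/-- For some decomposition `A ≅ C_{p^{i₁}} × ⋯ × C_{p^{i_d}}`, the action of `P` on `A` lifts to a
homomorphism from `P` to the ring of integral matrices with `(n, m)` entry divisible by
`max (p ^ (iₙ - iₘ), 1)`. -/
def HasIntegralLifting (p : ℕ) (P : Type v) (A : Type u) [Group P] [AddCommGroup A]
    [DistribMulAction P A] : Prop :=
  ∃ (d : ℕ) (i : Fin d → ℕ) (e : A ≃+ ∀ l, ZMod (p ^ i l)) (α : P →* Matrix (Fin d) (Fin d) ℤ),
    (∀ l, 1 ≤ i l) ∧ (∀ g n m, (p : ℤ) ^ (i n - i m) ∣ α g n m) ∧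
    ∀ (g : P) (v : Fin d → ℤ),
      e (g • e.symm fun l => (v l : ZMod (p ^ i l))) = fun l => ((α g *ᵥ v) l : ZMod (p ^ i l))

/-- The realizability conjecture for the data `A, P, λ`: if the action of `P` has an integral lifting
and `A_λ` is powerful `p`-central with the `Ω`-extension property, then `C^*(A; 𝔽_p)` and
`C^*(A_λ; 𝔽_p)` are joined by a zig-zag of `P`-invariant quasi-isomorphisms, each inducing a ring
isomorphism in cohomology. -/
def RealizabilityConjecture (p : ℕ) {P : Type v} {A : Type u} [Group P] [AddCommGroup A]
    [DistribMulAction P A] (L : TwistForm P A) : Prop :=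
  HasIntegralLifting p P A → IsPowerful p (Twisted L) → IsPCentral p (Twisted L) →
    HasOmegaEP p (Twisted L) →
    (stdActedDGAlg (ZMod p) (abelianAut P A)).Zigzag (stdActedDGAlg (ZMod p) (twistedAut L))

end TwistedCohomology

/-!
Write `K s n` for the cohomology in degree `n` of the `s`-th filtration piece of a filtered complex.
The theorem is proved with these groups alone, without spectral sequences and without products on
cochains other than the given ones.

For a cochain algebra `D` with an action of `P`, let `tot D` be the total complex of the double
complex of normalized homogeneous cochains of `P` with values in `D`, filtered by the degree in the
direction of `P`.  It is functorial in `D` for `P`-invariant cochain maps.  A quasi-isomorphism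
`C → D` induces isomorphisms in the cohomology of the graded pieces of `tot`
(`totMap_grInjective`, `totMap_grSurjective`): normalized cochains are free, that is, an equivariant
function may be prescribed arbitrarily on the simplices with first vertex `1` (`translate`,
`spread`).  Since the filtrations are finite in each degree, it induces isomorphisms of all `K s n`
(`FiltCx.Hom.mapK_bijective`).  Hence so does a zig-zag.

If `D` is the algebra of cochains of a group `N` on which `P` acts, the dual Alexander–Whitney map
`alexWhit` sends `tot D` to the cochains of `N ⋊ P`, filtered by the skeleta of `P`.  It too induces
isomorphisms of all `K s n`.  On the graded pieces an inverse is given by the leading term `lead`,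
the restriction of a cochain along the shuffle map over a nondegenerate simplex of `P`.  The
composite in one order is the identity (`lead_alexWhit`).  In the other order it is homotopic to the
identity (`eq_faceSum_straighten_add`): the homotopy `straighten` contracts, one after the other, the
blocks of consecutive vertices with the same image in `P`.

Together this gives isomorphisms between the groups `K s n` for `A_λ ⋊ P` and those for `A ⋊ P`,
compatible with the inclusions of the filtration pieces; in particular it gives an isomorphism of
cohomology groups that matches the two Lyndon–Hochschild–Serre filtrations.  It need not be
multiplicative, but it is so on the associated bigraded groups.  Indeed, the leading term of a
cocycle of `F s`, read as a function on `s`-simplices of `P` with values in `H^*(N)`, determines the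
class modulo the image of `K (s + 1) n`: a cochain of `F s` whose leading term consists of
coboundaries is a coboundary modulo `F (s + 1)` (`tot_exists_cobd`).  Leading terms correspond under
the isomorphisms above via the isomorphism of `H^*(N)` induced by the zig-zag, which is a ring
isomorphism.  Finally, the leading term of a cup product is the product of the leading terms, up to
a sign that depends on degrees only (`lead_cup`): a shuffle over the concatenation of two simplices
of `P` contributes only if it passes through the corner at which the two factors meet.  Hence the
image of a product and the product of the images have the same leading term and agree modulo the
next filtration step.
-/

namespace TwistedCohomology

/-! ### Alternating face sums of functions on lists -/

section FaceSum

variable {α β M : Type*} [AddCommGroup M]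

/-- The alternating sum `∑ (-1)^i f(x₀, …, x̂ᵢ, …, xₙ)` over the faces of `(x₀, …, xₙ)`.  The
recursion exhibits the simplex as a cone over the face opposite to its first vertex. -/
def faceSum : (List α → M) → List α → M
  | _, [] => 0
  | f, x :: l => f l - faceSum (fun l' => f (x :: l')) l

theorem faceSum_nil (f : List α → M) : faceSum f [] = 0 := rfl

theorem faceSum_cons (f : List α → M) (x : α) (l : List α) :
    faceSum f (x :: l) = f l - faceSum (fun l' => f (x :: l')) l := rfl

theorem faceSum_congr {f g : List α → M} {l : List α}
    (h : ∀ l', l'.Sublist l → l'.length + 1 = l.length → f l' = g l') :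
    faceSum f l = faceSum g l := by
  induction l generalizing f g with
  | nil => rfl
  | cons x l ih =>
    rw [faceSum_cons, faceSum_cons, h l (List.sublist_cons_self x l) rfl,
      ih fun l' hl hn => h _ (hl.cons_cons x) (by simp [hn])]

theorem faceSum_zero (l : List α) : faceSum (fun _ => (0 : M)) l = 0 := by
  induction l with
  | nil => rfl
  | cons x l ih => rw [faceSum_cons, ih, sub_zero]

theorem faceSum_eq_zero {f : List α → M} {l : List α}
    (h : ∀ l', l'.Sublist l → l'.length + 1 = l.length → f l' = 0) : faceSum f l = 0 :=
  (faceSum_congr h).trans (faceSum_zero l)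

theorem faceSum_add (f g : List α → M) (l : List α) :
    faceSum (fun l => f l + g l) l = faceSum f l + faceSum g l := by
  induction l generalizing f g with
  | nil => simp [faceSum_nil]
  | cons x l ih => rw [faceSum_cons, faceSum_cons, faceSum_cons, ih]; abel

theorem faceSum_hom {M' : Type*} [AddCommGroup M'] (φ : M →+ M') (f : List α → M) (l : List α) :
    faceSum (fun l => φ (f l)) l = φ (faceSum f l) := by
  induction l generalizing f with
  | nil => simp [faceSum_nil]
  | cons x l ih => rw [faceSum_cons, faceSum_cons, ih, map_sub]

theorem faceSum_neg (f : List α → M) (l : List α) :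
    faceSum (fun l => -f l) l = -faceSum f l :=
  faceSum_hom (-AddMonoidHom.id M) f l

theorem faceSum_sub (f g : List α → M) (l : List α) :
    faceSum (fun l => f l - g l) l = faceSum f l - faceSum g l := by
  simp only [sub_eq_add_neg, faceSum_add, faceSum_neg]

theorem faceSum_smul {k : Type*} [CommRing k] [Module k M] (c : k) (f : List α → M)
    (l : List α) : faceSum (fun l => c • f l) l = c • faceSum f l :=
  faceSum_hom (DistribSMul.toAddMonoidHom M c) f l

theorem faceSum_map (m : α → β) (f : List β → M) (l : List α) :
    faceSum f (l.map m) = faceSum (fun l' => f (l'.map m)) l := by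
  induction l generalizing f with
  | nil => rfl
  | cons x l ih => rw [List.map_cons, faceSum_cons, faceSum_cons, ih]; rfl

theorem faceSum_faceSum (f : List α → M) (l : List α) : faceSum (faceSum f) l = 0 := by
  induction l generalizing f with
  | nil => rfl
  | cons x l ih => simp only [faceSum_cons, faceSum_sub]; rw [ih]; abel

theorem faceSum_append {k : Type*} [CommRing k] (f : List α → k) (l l' : List α) :
    faceSum f (l ++ l') = faceSum (fun a => f (a ++ l')) l +
      (-1) ^ l.length * faceSum (fun b => f (l ++ b)) l' := by
  induction l generalizing f with
  | nil => simp [faceSum_nil]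
  | cons x l ih =>
    rw [List.cons_append, faceSum_cons, faceSum_cons, ih]
    simp only [List.cons_append, List.length_cons, pow_succ]
    ring

/-- Normalized functions, those that vanish on degenerate simplices, are preserved: the two faces
of a degenerate simplex that may be nondegenerate cancel. -/
theorem faceSum_degenerate {f : List α → M} (h : ∀ l : List α, ¬ l.IsChain (· ≠ ·) → f l = 0)
    {l : List α} (hl : ¬ l.IsChain (· ≠ ·)) : faceSum f l = 0 := by
  induction l generalizing f with
  | nil => rfl
  | cons x l ih =>
    rw [faceSum_cons]
    by_cases hl' : l.IsChain (· ≠ ·)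
    · cases l with
      | nil => exact absurd (List.isChain_singleton x) hl
      | cons y l =>
        have hxy : x = y := by
          by_contra hne
          exact hl (List.isChain_cons_cons.2 ⟨hne, hl'⟩)
        subst hxy
        rw [faceSum_cons, faceSum_eq_zero fun l' _ _ => h _ fun hc =>
          (List.isChain_cons_cons.1 hc).1 rfl]
        abel
    · rw [h l hl', ih (fun l' hc => h _ fun hc' => hc (List.isChain_cons.1 hc').2) hl', sub_zero]

theorem faceSum_ofFn {m : ℕ} (f : List α → M) (x : Fin (m + 1) → α) :
    faceSum f (List.ofFn x) = ∑ i : Fin (m + 1), (-1 : ℤ) ^ (i : ℕ) •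
      f (List.ofFn fun j => x (i.succAbove j)) := by
  induction m generalizing f with
  | zero => simp [faceSum_nil, faceSum_cons]
  | succ m ih =>
    rw [List.ofFn_succ, faceSum_cons, ih, Fin.sum_univ_succ (n := m + 1)]
    simp only [Fin.val_zero, pow_zero, one_smul, Fin.zero_succAbove, Fin.val_succ, pow_succ,
      mul_neg, mul_one, neg_smul, Finset.sum_neg_distrib, sub_eq_add_neg]
    refine congrArg (_ + -·) (Finset.sum_congr rfl fun i _ => ?_)
    rw [List.ofFn_succ (f := fun j => x (i.succ.succAbove j))]
    simp

end FaceSum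

/-! ### Counting steps -/

section Steps

variable {Q : Type*}

open Classical in
/-- The number of places at which consecutive entries of a list differ. -/
noncomputable def stepCount : List Q → ℕ
  | [] => 0
  | [_] => 0
  | a :: b :: l => (if a = b then 0 else 1) + stepCount (b :: l)

theorem stepCount_cons_self (a : Q) (l : List Q) : stepCount (a :: a :: l) = stepCount (a :: l) := by
  simp [stepCount]

theorem stepCount_cons_of_ne {a b : Q} (h : a ≠ b) (l : List Q) :
    stepCount (a :: b :: l) = stepCount (b :: l) + 1 := by
  simp [stepCount, h, add_comm]

theorem stepCount_le_cons (a : Q) (l : List Q) : stepCount l ≤ stepCount (a :: l) := by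
  cases l with
  | nil => simp [stepCount]
  | cons b l => simp [stepCount]

theorem stepCount_cons_le (a : Q) (l : List Q) : stepCount (a :: l) ≤ stepCount l + 1 := by
  cases l with
  | nil => simp [stepCount]
  | cons b l => simp only [stepCount]; split_ifs <;> omega

theorem stepCount_cons_le_cons_cons (a b : Q) (l : List Q) :
    stepCount (a :: l) ≤ stepCount (a :: b :: l) := by
  by_cases h : a = b
  · subst h; rw [stepCount_cons_self]
  · rw [stepCount_cons_of_ne h]
    have := stepCount_cons_le a l
    have := stepCount_le_cons b l
    omega

theorem stepCount_cons_sublist {l l' : List Q} (h : l.Sublist l') :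
    ∀ a, stepCount (a :: l) ≤ stepCount (a :: l') := by
  induction h with
  | slnil => exact fun a => le_rfl
  | cons b h ih => exact fun a => (ih a).trans (stepCount_cons_le_cons_cons a b _)
  | cons_cons b h ih =>
    intro a
    by_cases hab : a = b
    · subst hab; simpa only [stepCount_cons_self] using ih a
    · simpa only [stepCount_cons_of_ne hab, Nat.add_le_add_iff_right] using ih b

theorem stepCount_sublist {l l' : List Q} (h : l.Sublist l') : stepCount l ≤ stepCount l' := by
  induction h with
  | slnil => exact le_rfl
  | cons a h ih => exact ih.trans (stepCount_le_cons a _)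
  | cons_cons a h _ => exact stepCount_cons_sublist h a

theorem stepCount_of_isChain {a : Q} {l : List Q} (h : (a :: l).IsChain (· ≠ ·)) :
    stepCount (a :: l) = l.length := by
  induction l generalizing a with
  | nil => rfl
  | cons b l ih =>
    rw [List.isChain_cons_cons] at h
    rw [stepCount_cons_of_ne h.1, ih h.2, List.length_cons]

theorem stepCount_replicate (a : Q) (n : ℕ) : stepCount (List.replicate n a) = 0 := by
  induction n with
  | zero => rfl
  | succ n ih =>
    cases n with
    | zero => rfl
    | succ n => simpa only [List.replicate_succ, stepCount_cons_self] using ih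

theorem eq_of_stepCount_eq_zero {a : Q} {l : List Q} (h : stepCount (a :: l) = 0) :
    ∀ b ∈ l, b = a := by
  induction l generalizing a with
  | nil => simp
  | cons b l ih =>
    by_cases hab : a = b
    · subst hab
      rw [stepCount_cons_self] at h
      simpa using ih h
    · rw [stepCount_cons_of_ne hab] at h
      omega

theorem stepCount_ofFn {n : ℕ} (x : Fin (n + 1) → Q) : stepCount (List.ofFn x) = steps x := by
  induction n with
  | zero => simp [stepCount, steps]
  | succ n ih =>
    have h := ih (fun i => x i.succ)
    rw [List.ofFn_succ] at h ⊢
    rw [List.ofFn_succ, stepCount, h, steps, steps, Fin.sum_univ_succ]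
    rfl

end Steps

/-! ### The Alexander–Whitney map -/

section AlexanderWhitney

variable {P N k : Type*} [CommRing k]

/-- The dual Alexander–Whitney map: a function `c` of a simplex of `P` and a simplex of `N` is
sent to `(p₀, n₀), …, (pₘ, nₘ) ↦ ∑ᵢ c (p₀, …, pᵢ) (nᵢ, …, nₘ)`. -/
def alexWhit : (List P → List N → k) → List (P × N) → k
  | _, [] => 0
  | c, x :: l => c [x.1] (x.2 :: l.map Prod.snd) + alexWhit (fun ps => c (x.1 :: ps)) l

theorem alexWhit_cons (c : List P → List N → k) (x : P × N) (l : List (P × N)) :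
    alexWhit c (x :: l) =
      c [x.1] (x.2 :: l.map Prod.snd) + alexWhit (fun ps => c (x.1 :: ps)) l := rfl

theorem alexWhit_add (c c' : List P → List N → k) (l : List (P × N)) :
    alexWhit (fun ps ns => c ps ns + c' ps ns) l = alexWhit c l + alexWhit c' l := by
  induction l generalizing c c' with
  | nil => simp [alexWhit]
  | cons x l ih => simp only [alexWhit_cons, ih]; ring

theorem alexWhit_mul (a : k) (c : List P → List N → k) (l : List (P × N)) :
    alexWhit (fun ps ns => a * c ps ns) l = a * alexWhit c l := by
  induction l generalizing c with
  | nil => simp [alexWhit]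
  | cons x l ih => simp only [alexWhit_cons, ih]; ring

theorem alexWhit_sub (c c' : List P → List N → k) (l : List (P × N)) :
    alexWhit (fun ps ns => c ps ns - c' ps ns) l = alexWhit c l - alexWhit c' l := by
  induction l generalizing c c' with
  | nil => simp [alexWhit]
  | cons x l ih => simp only [alexWhit_cons, ih]; ring

/-- Only the values of `c` on front faces `ps` and complementary back faces `ns` matter. -/
theorem alexWhit_congr {c c' : List P → List N → k} {l : List (P × N)}
    (h : ∀ ps ns, ps.Sublist (l.map Prod.fst) → ns.Sublist (l.map Prod.snd) → ps ≠ [] →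
      ns ≠ [] → ps.length + ns.length = l.length + 1 → c ps ns = c' ps ns) :
    alexWhit c l = alexWhit c' l := by
  induction l generalizing c c' with
  | nil => rfl
  | cons x l ih =>
    rw [alexWhit_cons, alexWhit_cons, h [x.1] (x.2 :: l.map Prod.snd) (by simp) (by simp)
      (by simp) (by simp) (by simp; omega)]
    congr 1
    refine ih fun ps ns hps hns _ hns' hlen => h _ _ (hps.cons_cons x.1)
      (hns.trans (List.sublist_cons_self _ _)) (by simp) hns' ?_
    simp only [List.length_cons]
    omega

theorem alexWhit_eq_zero {c : List P → List N → k} {l : List (P × N)}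
    (h : ∀ ps ns, ps.Sublist (l.map Prod.fst) → ns.Sublist (l.map Prod.snd) → ps ≠ [] →
      ns ≠ [] → ps.length + ns.length = l.length + 1 → c ps ns = 0) : alexWhit c l = 0 := by
  have := alexWhit_mul 0 c l
  rw [zero_mul] at this
  rw [← this]
  exact alexWhit_congr fun ps ns h1 h2 h3 h4 h5 => by rw [h ps ns h1 h2 h3 h4 h5, mul_zero]

theorem alexWhit_map {P' N' : Type*} (σ : P → P') (τ : N → N') (c : List P' → List N' → k)
    (l : List (P × N)) : alexWhit c (l.map (Prod.map σ τ)) =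
      alexWhit (fun ps ns => c (ps.map σ) (ns.map τ)) l := by
  induction l generalizing c with
  | nil => rfl
  | cons x l ih =>
    rw [List.map_cons, alexWhit_cons, alexWhit_cons, ih]
    simp [Function.comp_def]

/-- The Alexander–Whitney map is a chain map, up to terms on which `c` is evaluated at an empty
list. -/
theorem alexWhit_faceSum (c : List P → List N → k) {l : List (P × N)} (hl : l ≠ []) :
    alexWhit (fun ps ns => faceSum (fun a => c a ns) ps +
      (-1) ^ (ps.length + 1) * faceSum (c ps) ns) l =
    faceSum (alexWhit c) l + c [] (l.map Prod.snd) +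
      (-1) ^ (l.length + 1) * c (l.map Prod.fst) [] := by
  induction l generalizing c with
  | nil => exact absurd rfl hl
  | cons x l ih =>
    have key : alexWhit (fun ps ns => faceSum (fun a => c a ns) (x.1 :: ps) +
        (-1) ^ ((x.1 :: ps).length + 1) * faceSum (c (x.1 :: ps)) ns) l =
        alexWhit c l - alexWhit (fun ps ns => faceSum (fun a => c (x.1 :: a) ns) ps +
          (-1) ^ (ps.length + 1) * faceSum (c (x.1 :: ps)) ns) l := by
      rw [← alexWhit_sub]
      refine alexWhit_congr fun ps ns _ _ _ _ _ => ?_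
      rw [faceSum_cons, List.length_cons, pow_succ]
      ring
    rw [alexWhit_cons, key, faceSum_cons]
    change _ = alexWhit c l - faceSum (fun l' => c [x.1] (x.2 :: l'.map Prod.snd) +
      alexWhit (fun ps => c (x.1 :: ps)) l') l + _ + _
    rw [faceSum_add, faceSum_cons, faceSum_nil, faceSum_map]
    by_cases hl' : l = []
    · subst hl'
      simp [alexWhit, faceSum_nil]
    · rw [ih _ hl']
      simp only [List.length_cons, List.length_nil, List.map_cons]
      ring

end AlexanderWhitney

/-! ### Leading terms -/

theorem stepCount_cons_append {Q : Type*} {a : Q} {l : List Q} (h : ∀ b ∈ l, b = a) (l' : List Q) :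
    stepCount (a :: (l ++ l')) = stepCount (a :: l') := by
  induction l with
  | nil => rfl
  | cons b l ih =>
    obtain rfl : b = a := h b (by simp)
    rw [List.cons_append, stepCount_cons_self, ih fun c hc => h c (by simp [hc])]

section Leading

variable {P N k : Type*} [CommRing k]

/-- `f` vanishes on the simplices whose projection to `P` has fewer than `s` steps. -/
def VanishBelow (s : ℕ) (f : List (P × N) → k) : Prop :=
  ∀ l, stepCount (l.map Prod.fst) < s → f l = 0

theorem vanishBelow_faceSum {s : ℕ} {f : List (P × N) → k} (h : VanishBelow s f) :
    VanishBelow s (faceSum f) := fun _ hl =>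
  faceSum_eq_zero fun _ hl' _ => h _ ((stepCount_sublist (hl'.map _)).trans_lt hl)

/-- For `r = (q₀, b₀), …, (qₘ, bₘ)`, the sum
`∑ⱼ (-1)^{j (|B| + 1)} f ((p, b₀), …, (p, bⱼ), B, (qⱼ, bⱼ), …, (qₘ, bₘ))`.
If all first coordinates of `B` are `p`, this is a contraction of the first block of simplices of
the form `B ++ r`; for empty `B` it is the coproduct of the simplex `b`, spread over `p` and
`q`. -/
def joinSum (p : P) : (List (P × N) → k) → List (P × N) → List (P × N) → k
  | _, _, [] => 0
  | f, B, r :: R => f ((p, r.2) :: (B ++ r :: R)) +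
      (-1) ^ (B.length + 1) * joinSum p (fun l => f ((p, r.2) :: l)) B R

theorem joinSum_cons (p : P) (f : List (P × N) → k) (B : List (P × N)) (r : P × N)
    (R : List (P × N)) : joinSum p f B (r :: R) = f ((p, r.2) :: (B ++ r :: R)) +
      (-1) ^ (B.length + 1) * joinSum p (fun l => f ((p, r.2) :: l)) B R := rfl

theorem joinSum_add (p : P) (f g : List (P × N) → k) (B R : List (P × N)) :
    joinSum p (fun l => f l + g l) B R = joinSum p f B R + joinSum p g B R := by
  induction R generalizing f g with
  | nil => simp [joinSum]
  | cons r R ih => simp only [joinSum_cons, ih]; ring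

theorem joinSum_mul (p : P) (a : k) (f : List (P × N) → k) (B R : List (P × N)) :
    joinSum p (fun l => a * f l) B R = a * joinSum p f B R := by
  induction R generalizing f with
  | nil => simp [joinSum]
  | cons r R ih => simp only [joinSum_cons, ih]; ring

theorem joinSum_sub (p : P) (f g : List (P × N) → k) (B R : List (P × N)) :
    joinSum p (fun l => f l - g l) B R = joinSum p f B R - joinSum p g B R := by
  induction R generalizing f g with
  | nil => simp [joinSum]
  | cons r R ih => simp only [joinSum_cons, ih]; ring

theorem joinSum_map {P' N' : Type*} (σ : P → P') (τ : N → N') (p : P)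
    (f : List (P' × N') → k) (B R : List (P × N)) :
    joinSum (σ p) f (B.map (Prod.map σ τ)) (R.map (Prod.map σ τ)) =
      joinSum p (fun l => f (l.map (Prod.map σ τ))) B R := by
  induction R generalizing f with
  | nil => rfl
  | cons r R ih =>
    rw [List.map_cons, joinSum_cons, joinSum_cons]
    simp only [Prod.map_snd, List.length_map, ih, List.map_cons, List.map_append, Prod.map_apply]

theorem joinSum_congr {p : P} {s : ℕ} {f g : List (P × N) → k} {B R : List (P × N)}
    (hB : ∀ b ∈ B, b.1 = p) (hR : stepCount (p :: R.map Prod.fst) < s)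
    (h : ∀ l, stepCount (p :: l.map Prod.fst) < s → f l = g l) :
    joinSum p f B R = joinSum p g B R := by
  induction R generalizing f g with
  | nil => rfl
  | cons r R ih =>
    rw [joinSum_cons, joinSum_cons, ih ((stepCount_cons_le_cons_cons _ _ _).trans_lt hR)
      (fun l hl => h _ (by simpa only [List.map_cons, stepCount_cons_self] using hl)), h]
    rw [List.map_cons, stepCount_cons_self, List.map_append, stepCount_cons_append]
    · exact hR
    · simpa using hB

theorem joinSum_zero (p : P) (B R : List (P × N)) :
    joinSum p (fun _ => (0 : k)) B R = 0 := by
  simpa using joinSum_mul p (0 : k) (fun _ => 0) B R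

theorem joinSum_eq_zero {p : P} {s : ℕ} {f : List (P × N) → k} {B R : List (P × N)}
    (hB : ∀ b ∈ B, b.1 = p) (hR : stepCount (p :: R.map Prod.fst) < s) (h : VanishBelow s f) :
    joinSum p f B R = 0 :=
  (joinSum_congr hB hR fun l hl => h l ((stepCount_le_cons _ _).trans_lt hl)).trans
    (joinSum_zero p B R)

theorem vanishBelow_joinSum {s : ℕ} {f : List (P × N) → k} (h : VanishBelow (s + 1) f) (p : P) :
    VanishBelow s (joinSum p f []) := fun l hl =>
  joinSum_eq_zero (by simp) ((stepCount_cons_le p _).trans_lt (Nat.succ_lt_succ hl)) h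

/-- All terms of the sum defining `joinSum` start with a vertex over `p`. -/
theorem joinSum_eq_zero_of_head {p : P} {f : List (P × N) → k} (h : ∀ n l, f ((p, n) :: l) = 0)
    (B R : List (P × N)) : joinSum p f B R = 0 := by
  cases R with
  | nil => rfl
  | cons r R =>
    rw [joinSum_cons, h, funext (h r.2), joinSum_zero, mul_zero, add_zero]

/-- `joinSum` is a chain homotopy between `f (B ++ R)` and the term in which all of `B` is
deleted; the latter is `joinSum p f [] R`, which occurs in the second summand. -/
theorem joinSum_faceSum {p : P} {f : List (P × N) → k} (B R : List (P × N))
    (hB : ∀ b ∈ B, b.1 = p) (hf : ∀ l : List (P × N), (∀ b ∈ l, b.1 = p) → f l = 0) :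
    joinSum p (faceSum f) B R + faceSum (fun B' => joinSum p f B' R) B +
      (-1) ^ B.length * faceSum (joinSum p f B) R = f (B ++ R) := by
  induction R generalizing f with
  | nil =>
    rw [List.append_nil, hf B hB]
    simp [joinSum, faceSum_nil, faceSum_zero]
  | cons r R ih =>
    have ih' := ih (f := fun l => f ((p, r.2) :: l)) fun l hl => hf _ (by simpa using hl)
    have e1 : joinSum p (fun l => faceSum f ((p, r.2) :: l)) B R = joinSum p f B R -
        joinSum p (faceSum fun l => f ((p, r.2) :: l)) B R := by
      rw [← joinSum_sub]; rfl
    have e2 : faceSum (fun B' : List (P × N) => (-1 : k) ^ (B'.length + 1) *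
        joinSum p (fun l => f ((p, r.2) :: l)) B' R) B =
        (-1) ^ B.length * faceSum (fun B' => joinSum p (fun l => f ((p, r.2) :: l)) B' R) B := by
      rw [← smul_eq_mul ((-1 : k) ^ B.length), ← faceSum_smul]
      exact faceSum_congr fun l' _ hl' => by rw [hl', smul_eq_mul]
    have e3 : faceSum (fun R' => joinSum p f B (r :: R')) R =
        faceSum (fun R' => f ((p, r.2) :: (B ++ r :: R'))) R + (-1) ^ (B.length + 1) *
          faceSum (joinSum p (fun l => f ((p, r.2) :: l)) B) R := by
      rw [← smul_eq_mul ((-1 : k) ^ (B.length + 1)), ← faceSum_smul, ← faceSum_add]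
      rfl
    rw [joinSum_cons, e1, faceSum_cons f, faceSum_cons (joinSum p f B), e3]
    simp only [joinSum_cons]
    rw [faceSum_add, e2, faceSum_append, faceSum_cons]
    rw [pow_succ]
    linear_combination (-1) ^ B.length * ih'

/-- The leading term of `f` over the simplex `ps` of `P`: the function on simplices of `N` obtained
by pulling `f` back along the shuffle map `ps × N → P × N`. -/
def lead : List P → (List (P × N) → k) → List N → k
  | [], _, _ => 0
  | [p], f, ns => f (ns.map (Prod.mk p))
  | p :: q :: ps, f, ns => lead (q :: ps) (joinSum p f []) ns

theorem lead_cons_cons (p q : P) (ps : List P) (f : List (P × N) → k) (ns : List N) :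
    lead (p :: q :: ps) f ns = lead (q :: ps) (joinSum p f []) ns := rfl

theorem lead_add (ps : List P) (f g : List (P × N) → k) (ns : List N) :
    lead ps (fun l => f l + g l) ns = lead ps f ns + lead ps g ns := by
  induction ps generalizing f g with
  | nil => simp [lead]
  | cons p ps ih =>
    cases ps with
    | nil => rfl
    | cons q ps => rw [lead_cons_cons, funext (joinSum_add p f g []), ih]; rfl

theorem lead_mul (ps : List P) (a : k) (f : List (P × N) → k) (ns : List N) :
    lead ps (fun l => a * f l) ns = a * lead ps f ns := by
  induction ps generalizing f with
  | nil => simp [lead]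
  | cons p ps ih =>
    cases ps with
    | nil => rfl
    | cons q ps => rw [lead_cons_cons, funext (joinSum_mul p a f []), ih]; rfl

theorem lead_zero (ps : List P) (ns : List N) : lead ps (fun _ => (0 : k)) ns = 0 := by
  simpa using lead_mul ps (0 : k) (fun _ => 0) ns

theorem lead_map {P' N' : Type*} (σ : P → P') (τ : N → N') (ps : List P)
    (f : List (P' × N') → k) (ns : List N) : lead (ps.map σ) f (ns.map τ) =
      lead ps (fun l => f (l.map (Prod.map σ τ))) ns := by
  induction ps generalizing f with
  | nil => rfl
  | cons p ps ih =>
    cases ps with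
    | nil => simp [lead, Function.comp_def]
    | cons q ps =>
      rw [lead_cons_cons, ← funext (joinSum_map σ τ p f []), ← ih]
      rfl

theorem lead_congr {s : ℕ} {f g : List (P × N) → k} (ps : List P) (ns : List N)
    (hps : ps.length ≤ s) (h : ∀ l, stepCount (l.map Prod.fst) < s → f l = g l) :
    lead ps f ns = lead ps g ns := by
  induction ps generalizing f g s with
  | nil => rfl
  | cons p ps ih =>
    obtain ⟨s, rfl⟩ : ∃ s', s = s' + 1 := ⟨s - 1, by simp at hps; omega⟩
    cases ps with
    | nil =>
      refine h _ ?_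
      rw [List.map_map, Function.comp_def, List.map_const', stepCount_replicate]
      omega
    | cons q ps =>
      refine ih (s := s) (by simpa using hps) fun l hl => ?_
      exact joinSum_congr (by simp)
        ((stepCount_cons_le p _).trans_lt (Nat.succ_lt_succ hl)) fun l' hl' =>
          h _ ((stepCount_le_cons _ _).trans_lt hl')

theorem lead_eq_zero {s : ℕ} {f : List (P × N) → k} {ps : List P} (ns : List N)
    (hps : ps.length ≤ s) (h : VanishBelow s f) : lead ps f ns = 0 :=
  (lead_congr ps ns hps h).trans (lead_zero ps ns)

theorem VanishBelow.eq_zero {s : ℕ} {f : List (P × N) → k} (h : VanishBelow (s + 1) f) {p : P}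
    (l : List (P × N)) (hl : ∀ b ∈ l, b.1 = p) : f l = 0 := by
  refine h l ?_
  have e : l.map Prod.fst = List.replicate l.length p :=
    List.eq_replicate_iff.2 ⟨by simp, by simpa using fun a b hab => hl (a, b) hab⟩
  rw [e, stepCount_replicate]
  exact s.succ_pos

theorem joinSum_nil_faceSum {s : ℕ} {f : List (P × N) → k} (h : VanishBelow (s + 1) f)
    (p : P) (R : List (P × N)) :
    joinSum p (faceSum f) [] R = f R - faceSum (joinSum p f []) R := by
  have := joinSum_faceSum (p := p) [] R (by simp) h.eq_zero
  simp only [List.length_nil, pow_zero, one_mul, faceSum_nil, add_zero, List.nil_append] at this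
  exact eq_sub_of_add_eq this

/-- On functions that vanish below `s` steps, leading terms over `s`-simplices commute with the
differential up to sign: the faces in the direction of `P` meet fewer steps and contribute zero. -/
theorem lead_faceSum {s : ℕ} {f : List (P × N) → k} (h : VanishBelow s f) {ps : List P}
    (hps : ps.length = s + 1) (ns : List N) :
    lead ps (faceSum f) ns = (-1) ^ s * faceSum (lead ps f) ns := by
  induction ps generalizing f s with
  | nil => simp at hps
  | cons p ps ih =>
    cases ps with
    | nil =>
      obtain rfl : s = 0 := by simpa using hps.symm
      rw [pow_zero, one_mul]
      exact faceSum_map _ _ _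
    | cons q ps =>
      obtain ⟨s, rfl⟩ : ∃ s', s = s' + 1 := ⟨s - 1, by simp at hps; omega⟩
      have hlen : (q :: ps).length = s + 1 := by simpa using hps
      have e : joinSum p (faceSum f) [] =
          fun R => f R + (-1) * faceSum (joinSum p f []) R := by
        funext R
        rw [joinSum_nil_faceSum h]
        ring
      rw [lead_cons_cons, e, lead_add, lead_mul, ih (vanishBelow_joinSum h p) hlen,
        lead_eq_zero ns hlen.le h]
      rw [funext (lead_cons_cons p q ps f), pow_succ]
      ring

/-- Leading terms recover the component of lowest degree in the direction of `P` from its image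
under the Alexander–Whitney map. -/
theorem lead_alexWhit {s : ℕ} {c : List P → List N → k}
    (hc : ∀ ps ns, ¬ ps.IsChain (· ≠ ·) → c ps ns = 0)
    (hs : ∀ ps ns, ps.length ≤ s → c ps ns = 0) {ps : List P}
    (hps : ps.length = s + 1) {ns : List N} (hns : ns ≠ []) :
    lead ps (alexWhit c) ns = c ps ns := by
  have h0 : ∀ p, alexWhit (fun ps => c (p :: p :: ps)) = fun _ => 0 := fun p => funext fun l =>
    alexWhit_eq_zero fun ps ns _ _ _ _ _ => hc _ _ fun h => (List.isChain_cons_cons.1 h).1 rfl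
  have h1 : ∀ p n ns, c [p, p] (n :: ns) = 0 := fun p n ns =>
    hc _ _ fun h => (List.isChain_cons_cons.1 h).1 rfl
  induction ps generalizing c s with
  | nil => simp at hps
  | cons p ps ih =>
    cases ps with
    | nil =>
      match ns, hns with
      | [n], _ => simp [lead, alexWhit]
      | n :: n' :: ns, _ =>
        simp only [lead, List.map_cons, alexWhit_cons, h0, h1, List.map_map, Function.comp_def,
          List.map_id', add_zero]
    | cons q ps =>
      obtain ⟨s, rfl⟩ : ∃ s', s = s' + 1 := ⟨s - 1, by simp at hps; omega⟩
      have e : joinSum p (alexWhit c) [] = alexWhit fun ps => c (p :: ps) := by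
        funext R
        cases R with
        | nil => rfl
        | cons r R =>
          rw [joinSum_cons, joinSum_eq_zero_of_head, mul_zero, add_zero, alexWhit_cons, hs _ _
            (by simp), zero_add]
          · rfl
          · intro n l
            rw [alexWhit_cons, hs _ _ (by simp), zero_add]
            simp only [alexWhit_cons, h0, h1, add_zero]
      rw [lead_cons_cons, e]
      refine ih (s := s) (fun ps ns h => hc _ _ fun h' => h (List.isChain_cons.1 h').2)
        (fun ps ns h => hs _ _ (by simpa using h)) (by simpa using hps) ?_ ?_
      · exact fun p' => funext fun l => alexWhit_eq_zero fun ps ns _ _ _ _ _ => hc _ _ fun h =>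
          (List.isChain_cons_cons.1 (List.isChain_cons.1 h).2).1 rfl
      · exact fun p' n ns => hc _ _ fun h =>
          (List.isChain_cons_cons.1 (List.isChain_cons.1 h).2).1 rfl

/-! ### Multiplicativity of leading terms -/

/-- The cup product without its sign: a front face times a back face. -/
def cup {α : Type*} (i : ℕ) (f g : List α → k) (l : List α) : k := f (l.take (i + 1)) * g (l.drop i)

/-- If `f` vanishes over `p`, only those terms survive in which the repeated vertex belongs to the
front face. -/
theorem joinSum_cup_left {p : P} (i : ℕ) {f : List (P × N) → k} (g : List (P × N) → k)
    (hf : ∀ l : List (P × N), (∀ b ∈ l, b.1 = p) → f l = 0) (R : List (P × N)) :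
    joinSum p (cup (i + 1) f g) [] R = cup i (joinSum p f []) g R := by
  induction R generalizing f i with
  | nil => simp [joinSum, cup]
  | cons r R ih =>
    have e : (fun l => cup (i + 1) f g ((p, r.2) :: l)) =
        cup i (fun l => f ((p, r.2) :: l)) g := rfl
    rw [joinSum_cons, e]
    cases i with
    | zero =>
      rw [joinSum_eq_zero_of_head]
      · simp [cup, joinSum]
      · intro n l
        simp only [cup]
        rw [hf _ (by simp), zero_mul]
    | succ i =>
      rw [ih i fun l hl => hf _ (by simpa using hl)]
      simp only [cup, List.take_succ_cons, List.drop_succ_cons, joinSum_cons, List.nil_append]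
      ring

/-- If `R` has too few steps for `g`, only those terms survive in which the repeated vertex belongs
to the back face. -/
theorem joinSum_cup_right {p : P} {s : ℕ} (i : ℕ) (f : List (P × N) → k)
    {g : List (P × N) → k} (hg : VanishBelow s g) (R : List (P × N))
    (hR : stepCount (R.map Prod.fst) < s) :
    joinSum p (cup i f g) [] R = (-1) ^ i *
      cup i (fun l => f (l.map fun x => (p, x.2))) (joinSum p g []) R := by
  induction R generalizing f i with
  | nil => simp [joinSum, cup]
  | cons r R ih =>
    rw [joinSum_cons]
    cases i with
    | zero =>
      have e : (fun l => cup 0 f g ((p, r.2) :: l)) =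
          fun l => f [(p, r.2)] * (fun l => g ((p, r.2) :: l)) l := rfl
      rw [e, joinSum_mul]
      simp only [cup, joinSum_cons, List.take_succ_cons, List.take_zero, List.drop_zero,
        List.map_cons, List.map_nil]
      ring
    | succ i =>
      have e : (fun l => cup (i + 1) f g ((p, r.2) :: l)) =
          cup i (fun l => f ((p, r.2) :: l)) g := rfl
      rw [e, ih _ _ ((stepCount_le_cons _ _).trans_lt hR)]
      have h0 : g ((r :: R).drop i) = 0 :=
        hg _ ((stepCount_sublist ((List.drop_sublist _ _).map _)).trans_lt hR)
      simp only [cup, List.take_succ_cons, List.drop_succ_cons, List.nil_append, h0, mul_zero,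
        List.map_cons, List.length_nil]
      ring

theorem lead_cup_right {s : ℕ} (t : ℕ) (f : List (P × N) → k) {g : List (P × N) → k}
    (hg : VanishBelow s g) {p : P} {ps : List P} (hps : ps.length = s) (ns : List N) :
    lead (p :: ps) (cup t f g) ns = (-1) ^ (t * s) *
      (f ((ns.take (t + 1)).map (Prod.mk p)) * lead (p :: ps) g (ns.drop t)) := by
  induction ps generalizing f g s p with
  | nil =>
    obtain rfl : s = 0 := hps.symm
    simp [lead, cup, List.map_take, List.map_drop]
  | cons q ps ih =>
    obtain ⟨s, rfl⟩ : ∃ s', s = s' + 1 := ⟨ps.length, by simpa using hps.symm⟩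
    rw [lead_cons_cons, lead_congr (s := s + 1) _ _ (by simpa using hps.le)
      (joinSum_cup_right t f hg), lead_mul, ih _ (vanishBelow_joinSum hg p) (by simpa using hps),
      lead_cons_cons]
    simp only [List.map_map, Function.comp_def, mul_add, mul_one, pow_add]
    ring

/-- Leading terms multiply.  A shuffle contributes to the leading term of a product only if it
passes through the corner at which the two factors meet. -/
theorem lead_cup {s s' : ℕ} (t : ℕ) {f g : List (P × N) → k} (hf : VanishBelow s f)
    (hg : VanishBelow s' g) {ps : List P} {p : P} {qs : List P} (hps : ps.length = s)
    (hqs : qs.length = s') (ns : List N) :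
    lead (ps ++ p :: qs) (cup (s + t) f g) ns = (-1) ^ (t * s') *
      (lead (ps ++ [p]) f (ns.take (t + 1)) * lead (p :: qs) g (ns.drop t)) := by
  induction ps generalizing f s with
  | nil =>
    obtain rfl : s = 0 := hps.symm
    rw [zero_add]
    exact lead_cup_right t f hg hqs ns
  | cons a ps ih =>
    obtain ⟨s, rfl⟩ : ∃ s', s = s' + 1 := ⟨ps.length, by simpa using hps.symm⟩
    have ih' := ih (vanishBelow_joinSum hf a) (by simpa using hps)
    have e : joinSum a (cup (s + 1 + t) f g) [] = cup (s + t) (joinSum a f []) g := by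
      rw [show s + 1 + t = s + t + 1 by omega]
      exact funext (joinSum_cup_left _ _ hf.eq_zero)
    cases ps with
    | nil => simpa only [List.nil_append, List.cons_append, lead_cons_cons, e] using ih'
    | cons b ps => simpa only [List.cons_append, lead_cons_cons, e] using ih'

end Leading

/-! ### Contracting blocks -/

section Straighten

variable {P N k : Type*} [CommRing k]

/-- The summand of `alexWhit c` at which the front face has `s + 1` vertices. -/
def alexWhitTerm : ℕ → (List P → List N → k) → List (P × N) → k
  | _, _, [] => 0
  | 0, c, x :: l => c [x.1] (x.2 :: l.map Prod.snd)
  | s + 1, c, x :: l => alexWhitTerm s (fun ps => c (x.1 :: ps)) l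

theorem alexWhitTerm_congr (s : ℕ) {c c' : List P → List N → k} {x : P × N} {l : List (P × N)}
    (h : ∀ ps ns, c (x.1 :: ps) ns = c' (x.1 :: ps) ns) :
    alexWhitTerm s c (x :: l) = alexWhitTerm s c' (x :: l) := by
  cases s with
  | zero => exact h _ _
  | succ s => exact congrArg (alexWhitTerm s · l) (funext fun ps => funext (h ps))

theorem alexWhitTerm_congr_of_length {s : ℕ} {c c' : List P → List N → k} {l : List (P × N)}
    (h : ∀ ps ns, ps.length = s + 1 → s + ns.length = l.length → c ps ns = c' ps ns) :
    alexWhitTerm s c l = alexWhitTerm s c' l := by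
  induction s generalizing c c' l with
  | zero =>
    cases l with
    | nil => rfl
    | cons x l => exact h _ _ rfl (by simp)
  | succ s ih =>
    cases l with
    | nil => rfl
    | cons x l =>
      exact ih fun ps ns h₁ h₂ => h _ _ (by simpa using h₁) (by simp only [List.length_cons]; omega)

theorem alexWhitTerm_zero (s : ℕ) (l : List (P × N)) :
    alexWhitTerm s (fun _ _ => (0 : k)) l = 0 := by
  induction s generalizing l with
  | zero => cases l <;> rfl
  | succ s ih =>
    cases l with
    | nil => rfl
    | cons x l => exact ih l

theorem alexWhit_eq_alexWhitTerm {s : ℕ} {c : List P → List N → k}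
    (hc : ∀ ps ns, ps.length ≠ s + 1 → c ps ns = 0) (l : List (P × N)) :
    alexWhit c l = alexWhitTerm s c l := by
  induction s generalizing c l with
  | zero =>
    cases l with
    | nil => rfl
    | cons x l =>
      have e : alexWhit (fun ps => c (x.1 :: ps)) l = 0 :=
        alexWhit_eq_zero fun ps ns _ _ h _ _ => hc _ _ (by simpa using h)
      rw [alexWhit_cons, e, add_zero]
      rfl
  | succ s ih =>
    cases l with
    | nil => rfl
    | cons x l =>
      rw [alexWhit_cons, hc _ _ (by simp), zero_add]
      exact ih (fun ps ns h => hc _ _ (by simpa using h)) l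

open Classical in
/-- `joinSum` with `B` the block of vertices over the first vertex of `P`. -/
noncomputable def blockJoin (f : List (P × N) → k) : List (P × N) → k
  | [] => 0
  | x :: l => joinSum x.1 f (x :: l.takeWhile (·.1 = x.1)) (l.dropWhile (·.1 = x.1))

open Classical in
/-- Apply `w p` to the tail of a simplex whose first vertex over `P` is `p`, provided that the
first block consists of one vertex only. -/
noncomputable def onTail (w : P → List (P × N) → k) : List (P × N) → k
  | [] => 0
  | x :: l => if (l.map Prod.fst).head? = some x.1 then 0 else w x.1 l

/-- The cochain whose coboundary moves a cocycle of the `s`-th graded piece into the image of the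
Alexander–Whitney map: the first block is contracted, and the construction continues with the
remaining blocks. -/
noncomputable def straighten : ℕ → (List (P × N) → k) → List (P × N) → k
  | 0, _, _ => 0
  | s + 1, f, l => blockJoin f l - onTail (fun p => straighten s (joinSum p f [])) l

theorem blockJoin_append {f : List (P × N) → k} {p : P} {B C : List (P × N)} (hB : B ≠ [])
    (hBp : ∀ b ∈ B, b.1 = p) (hC : (C.map Prod.fst).head? ≠ some p) :
    blockJoin f (B ++ C) = joinSum p f B C := by
  classical
  match B, hB with
  | x :: B, _ =>
    obtain rfl : x.1 = p := hBp x (by simp)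
    have hd : C.takeWhile (fun y => decide (y.1 = x.1)) = [] ∧
        C.dropWhile (fun y => decide (y.1 = x.1)) = C := by
      cases C with
      | nil => simp
      | cons c C =>
        have : ¬ c.1 = x.1 := by simpa using hC
        simp [this]
    rw [List.cons_append, blockJoin]
    have hB' : ∀ b ∈ B, decide (b.1 = x.1) = true := fun b hb => by
      simpa using hBp b (by simp [hb])
    rw [List.takeWhile_append_of_pos hB', List.dropWhile_append_of_pos hB', hd.1, hd.2,
      List.append_nil]

theorem vanishBelow_blockJoin {s : ℕ} {f : List (P × N) → k} (h : VanishBelow s f) :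
    VanishBelow s (blockJoin f) := fun l hl => by
  cases l with
  | nil => rfl
  | cons x l =>
    refine joinSum_eq_zero ?_ (lt_of_le_of_lt (stepCount_cons_sublist ?_ _) hl) h
    · intro b hb
      rcases List.mem_cons.1 hb with rfl | hb
      · rfl
      · simpa using List.mem_takeWhile_imp hb
    · exact (List.dropWhile_sublist _).map _

theorem vanishBelow_onTail {s : ℕ} {w : P → List (P × N) → k} (h : ∀ p, VanishBelow s (w p))
    (h0 : ∀ p, w p [] = 0) : VanishBelow (s + 1) (onTail w) := fun l hl => by
  cases l with
  | nil => rfl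
  | cons x l =>
    rw [onTail]
    split_ifs with hx
    · rfl
    · cases l with
      | nil => exact h0 _
      | cons y l =>
        refine h _ _ ?_
        rw [List.map_cons, List.map_cons, stepCount_cons_of_ne] at hl
        · exact Nat.lt_of_succ_lt_succ hl
        · rintro hxy
          simp [hxy] at hx

theorem straighten_nil (s : ℕ) (f : List (P × N) → k) : straighten s f [] = 0 := by
  cases s <;> simp [straighten, blockJoin, onTail]

theorem vanishBelow_straighten {s : ℕ} {f : List (P × N) → k} (h : VanishBelow s f) :
    VanishBelow s (straighten s f) := by
  induction s generalizing f with
  | zero => exact fun l hl => absurd hl (Nat.not_lt_zero _)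
  | succ s ih =>
    intro l hl
    rw [straighten, vanishBelow_blockJoin h l hl, vanishBelow_onTail
      (fun p => ih (vanishBelow_joinSum h p)) (fun p => straighten_nil _ _) l hl, sub_zero]

/-- Dropping vertices after a block so that the block grows loses at least one step. -/
theorem stepCount_lt_of_head {Q : Type*} {p : Q} {l l' : List Q} (h : l'.Sublist l)
    (hl : l.head? ≠ some p) (hl' : l'.head? = some p) : stepCount l' < stepCount l := by
  match l', hl' with
  | _ :: l', rfl =>
    cases l with
    | nil => simp at h
    | cons q l =>
      have hqp : q ≠ p := by simpa using hl
      have hsub : (p :: l').Sublist l := by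
        cases h with
        | cons _ h => exact h
        | cons_cons _ h => exact absurd rfl hqp
      have := stepCount_cons_sublist hsub q
      rw [stepCount_cons_of_ne hqp] at this
      omega

theorem faceSum_onTail {s : ℕ} {w : P → List (P × N) → k} (h : ∀ p, VanishBelow s (w p))
    (h0 : ∀ p, w p [] = 0) (x : P × N) (l : List (P × N))
    (hl : stepCount ((x :: l).map Prod.fst) ≤ s + 1) :
    faceSum (onTail w) (x :: l) = -onTail (fun p => faceSum (w p)) (x :: l) := by
  rw [faceSum_cons, onTail]
  split_ifs with hx
  · cases l with
    | nil => simp at hx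
    | cons y l =>
      have hxy : y.1 = x.1 := by simpa using hx
      rw [faceSum_cons, faceSum_eq_zero (f := fun l' => onTail w (x :: y :: l'))
        fun l' _ _ => by simp [onTail, hxy]]
      have e : onTail w (y :: l) = onTail w (x :: l) := by
        simp only [onTail]
        rw [hxy]
      rw [e, sub_zero, sub_self, neg_zero]
  · have e : faceSum (fun l' => onTail w (x :: l')) l = faceSum (w x.1) l := by
      refine faceSum_congr fun l' hl' _ => ?_
      rw [onTail]
      split_ifs with hx'
      · refine (h _ _ ?_).symm
        have h1 := stepCount_lt_of_head (hl'.map Prod.fst) hx hx'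
        have h2 : stepCount ((x :: l).map Prod.fst) = stepCount (l.map Prod.fst) + 1 := by
          cases l with
          | nil => simp [stepCount] at h1
          | cons y l =>
            refine stepCount_cons_of_ne (fun hxy => hx ?_) _
            simp [hxy]
        omega
      · rfl
    have e' : onTail w l = 0 := by
      cases l with
      | nil => rfl
      | cons y l =>
        refine vanishBelow_onTail h h0 _ ?_
        have h2 : stepCount ((x :: y :: l).map Prod.fst) =
            stepCount ((y :: l).map Prod.fst) + 1 :=
          stepCount_cons_of_ne (fun hxy => hx (by simp [hxy])) _
        omega
    rw [e, e', zero_sub]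

/-- Modulo functions that vanish below `s + 2` steps, contracting the first block is a homotopy from
`f` to a function supported on the simplices whose first block is a single vertex. -/
theorem faceSum_blockJoin {s : ℕ} {f : List (P × N) → k} (h : VanishBelow (s + 1) f)
    (h' : VanishBelow (s + 2) (faceSum f)) (x : P × N) (l : List (P × N))
    (hl : stepCount ((x :: l).map Prod.fst) ≤ s + 1) :
    faceSum (blockJoin f) (x :: l) = f (x :: l) - onTail (fun p => joinSum p f []) (x :: l) := by
  classical
  obtain ⟨B, C, rfl, hB, hC⟩ : ∃ B C, l = B ++ C ∧ (∀ b ∈ B, b.1 = x.1) ∧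
      (C.map Prod.fst).head? ≠ some x.1 := by
    refine ⟨l.takeWhile (·.1 = x.1), l.dropWhile (·.1 = x.1),
      List.takeWhile_append_dropWhile.symm, fun b hb => ?_, fun hC => ?_⟩
    · simpa using List.mem_takeWhile_imp hb
    · rw [List.head?_map, Option.map_eq_some_iff] at hC
      obtain ⟨y, hy, hyx⟩ := hC
      have := List.head?_dropWhile_not (fun y : P × N => decide (y.1 = x.1)) l
      rw [hy] at this
      simp [hyx] at this
  have hxB : ∀ b ∈ x :: B, b.1 = x.1 := by simpa using hB
  have hsteps : stepCount (x.1 :: C.map Prod.fst) ≤ s + 1 := by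
    rwa [List.map_cons, List.map_append, stepCount_cons_append (by simpa using hB)] at hl
  have key := joinSum_faceSum (x :: B) C hxB h.eq_zero
  rw [joinSum_eq_zero hxB (Nat.lt_succ_of_le hsteps) h', zero_add, faceSum_cons] at key
  -- A face of `C` that begins over `x.1` loses a step, so that both sides vanish there.
  have e1 : faceSum (fun C' => blockJoin f (x :: B ++ C')) C =
      faceSum (joinSum x.1 f (x :: B)) C := by
    refine faceSum_congr fun C' hC' _ => ?_
    by_cases hd : (C'.map Prod.fst).head? = some x.1
    · have h1 := stepCount_lt_of_head (hC'.map Prod.fst) hC hd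
      have h2 : stepCount (x.1 :: C'.map Prod.fst) < s + 1 := by
        match C', hd with
        | c :: C', hd =>
          have hc : c.1 = x.1 := by simpa using hd
          have := stepCount_le_cons x.1 (C.map Prod.fst)
          rw [List.map_cons, hc] at h1 ⊢
          rw [stepCount_cons_self]
          omega
      rw [joinSum_eq_zero hxB h2 h]
      refine vanishBelow_blockJoin h _ ?_
      rwa [List.cons_append, List.map_cons, List.map_append,
        stepCount_cons_append (by simpa using hB)]
    · exact blockJoin_append (by simp) hxB hd
  have e2 : faceSum (fun B' => blockJoin f (x :: (B' ++ C))) B =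
      faceSum (fun B' => joinSum x.1 f (x :: B') C) B := by
    refine faceSum_congr fun B' hB' _ => ?_
    exact blockJoin_append (B := x :: B') (by simp)
      (fun b hb => hxB b ((hB'.cons_cons x).subset hb)) hC
  have e3 : blockJoin f (B ++ C) =
      joinSum x.1 f B C - onTail (fun p => joinSum p f []) (x :: (B ++ C)) := by
    cases B with
    | nil =>
      rw [List.nil_append, onTail, if_neg hC, sub_self]
      cases C with
      | nil => rfl
      | cons c C =>
        refine vanishBelow_blockJoin h _ ?_
        rw [List.map_cons, stepCount_cons_of_ne] at hsteps
        · exact hsteps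
        · rintro hxy
          simp [hxy] at hC
    | cons b B =>
      rw [blockJoin_append (by simp) hB hC, onTail, if_pos, sub_zero]
      simpa using hB b (by simp)
  rw [← List.cons_append, faceSum_append, faceSum_cons]
  simp only [List.cons_append] at e1 e2 e3 key ⊢
  rw [e1, e2, e3]
  linear_combination key

open Classical in
/-- Every cocycle of the `s`-th graded piece is cohomologous to the image of its leading term under
the Alexander–Whitney map. -/
theorem eq_faceSum_straighten_add {s : ℕ} {f : List (P × N) → k} (h : VanishBelow s f)
    (h' : VanishBelow (s + 1) (faceSum f)) {l : List (P × N)} (hl : l ≠ [])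
    (hls : stepCount (l.map Prod.fst) ≤ s) :
    f l = faceSum (straighten s f) l +
      alexWhitTerm s (fun ps ns => if ps.IsChain (· ≠ ·) then lead ps f ns else 0) l := by
  induction s generalizing f l with
  | zero =>
    match l, hl with
    | x :: l, _ =>
      have hx : ∀ b ∈ l, b.1 = x.1 := by
        simpa using eq_of_stepCount_eq_zero (Nat.le_zero.1 hls)
      have e : faceSum (straighten 0 f) (x :: l) = 0 := faceSum_zero _
      have e' : (l.map Prod.snd).map (Prod.mk x.1) = l := by
        rw [List.map_map]
        refine (List.map_congr_left fun b hb => ?_).trans (List.map_id l)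
        rw [Function.comp_apply, ← hx b hb, id]
      rw [e, zero_add, alexWhitTerm, if_pos (List.isChain_singleton _), lead, List.map_cons, e']
  | succ s ih =>
    match l, hl with
    | x :: l, _ =>
      have e : faceSum (straighten (s + 1) f) (x :: l) = faceSum (blockJoin f) (x :: l) -
          faceSum (onTail fun p => straighten s (joinSum p f [])) (x :: l) := faceSum_sub _ _ _
      have hz : ∀ p, VanishBelow s (straighten s (joinSum p f [])) := fun p =>
        vanishBelow_straighten (vanishBelow_joinSum h p)
      rw [e, faceSum_blockJoin h h' x l hls, faceSum_onTail hz (fun p => straighten_nil _ _) x l hls,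
        onTail, onTail, alexWhitTerm]
      by_cases hx : (l.map Prod.fst).head? = some x.1
      · match l, hx with
        | y :: l, hx =>
          have hxy : y.1 = x.1 := by simpa using hx
          rw [if_pos hx, if_pos hx, alexWhitTerm_congr (c' := fun _ _ => 0), alexWhitTerm_zero]
          · ring
          · intro ps ns
            rw [if_neg]
            rw [hxy]
            exact fun hc => (List.isChain_cons_cons.1 hc).1 rfl
      · rw [if_neg hx, if_neg hx]
        cases l with
        | nil =>
          rw [faceSum_nil, h.eq_zero (p := x.1) [x] (by simp)]
          simp [joinSum, alexWhitTerm]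
        | cons y l =>
          have hxy : x.1 ≠ y.1 := fun hxy => hx (by simp [hxy])
          rw [List.map_cons, List.map_cons, stepCount_cons_of_ne hxy] at hls
          have hf' : VanishBelow (s + 1) (faceSum (joinSum x.1 f [])) := fun R hR => by
            have e := joinSum_nil_faceSum h x.1 R
            rw [h R hR, zero_sub, joinSum_eq_zero (by simp)
              ((stepCount_cons_le _ _).trans_lt (Nat.succ_lt_succ hR)) h'] at e
            exact neg_eq_zero.1 e.symm
          have ih' := ih (vanishBelow_joinSum h x.1) hf' (l := y :: l) (by simp)
            (Nat.le_of_succ_le_succ hls)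
          rw [alexWhitTerm_congr (c' := fun ps ns =>
            if ps.IsChain (· ≠ ·) then lead ps (joinSum x.1 f []) ns else 0)]
          · linear_combination ih'
          · intro ps ns
            simp only [List.isChain_cons_cons, lead_cons_cons]
            simp [hxy]

theorem blockJoin_map {P' N' : Type*} {σ : P → P'} (hσ : Function.Injective σ) (τ : N → N')
    (f : List (P' × N') → k) (l : List (P × N)) :
    blockJoin f (l.map (Prod.map σ τ)) = blockJoin (fun l => f (l.map (Prod.map σ τ))) l := by
  cases l with
  | nil => rfl
  | cons x l =>
    classical
    have e : ∀ y : P × N, decide (σ y.1 = σ x.1) = decide (y.1 = x.1) := fun y => by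
      simp [hσ.eq_iff]
    rw [List.map_cons, blockJoin, blockJoin, ← joinSum_map]
    simp [List.takeWhile_map, List.dropWhile_map, Function.comp_def, e]

theorem straighten_map {P' N' : Type*} {σ : P → P'} (hσ : Function.Injective σ) (τ : N → N')
    (s : ℕ) (f : List (P' × N') → k) (l : List (P × N)) :
    straighten s f (l.map (Prod.map σ τ)) =
      straighten s (fun l => f (l.map (Prod.map σ τ))) l := by
  classical
  induction s generalizing f l with
  | zero => rfl
  | succ s ih =>
    rw [straighten, straighten, blockJoin_map hσ]
    congr 1
    cases l with
    | nil => rfl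
    | cons x l =>
      have e : joinSum x.1 (fun l => f (l.map (Prod.map σ τ))) [] =
          fun R => joinSum (σ x.1) f [] (R.map (Prod.map σ τ)) :=
        funext fun R => (joinSum_map σ τ x.1 f [] R).symm
      rw [List.map_cons, onTail, onTail, e, ← ih]
      refine if_congr ?_ rfl rfl
      cases l <;> simp [hσ.eq_iff]

end Straighten

/-! ### Filtered complexes -/

universe w₁ w₂ w₃ w₄

/-- A cochain complex in degrees `0, 1, 2, …` with a decreasing filtration by subcomplexes such that
`F (n + 1)` vanishes in degree `n`. -/
structure FiltCx (k : Type) [CommRing k] where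
  X : ℕ → Type w
  [instAddCommGroup : ∀ n, AddCommGroup (X n)]
  [instModule : ∀ n, Module k (X n)]
  d : ∀ n, X n →ₗ[k] X (n + 1)
  d_d : ∀ n (x : X n), d (n + 1) (d n x) = 0
  F : ℕ → ∀ n, Submodule k (X n)
  anti : ∀ s n, F (s + 1) n ≤ F s n
  succ_eq_bot : ∀ n, F (n + 1) n = ⊥
  d_mem : ∀ {s n : ℕ} {x : X n}, x ∈ F s n → d n x ∈ F s (n + 1)

attribute [instance] FiltCx.instAddCommGroup FiltCx.instModule

namespace FiltCx

variable {k : Type} [CommRing k] (X : FiltCx.{w} k)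

/-- Cocycles of the subcomplex `F s`. -/
def cocyc (s n : ℕ) : Submodule k (X.X n) := X.F s n ⊓ LinearMap.ker (X.d n)

/-- Coboundaries of the subcomplex `F s`. -/
def cobd (s : ℕ) : ∀ n : ℕ, Submodule k (X.X n)
  | 0 => ⊥
  | n + 1 => (X.F s n).map (X.d n)

/-- The cohomology of the subcomplex `F s`. -/
abbrev K (s n : ℕ) : Type w := X.cocyc s n ⧸ (X.cobd s n).comap (X.cocyc s n).subtype

variable {X}

theorem F_antitone {s s' : ℕ} (h : s ≤ s') (n : ℕ) : X.F s' n ≤ X.F s n :=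
  antitone_nat_of_succ_le (f := fun s => X.F s n) (fun s => X.anti s n) h

theorem eq_zero_of_mem_F {s n : ℕ} (h : n < s) {x : X.X n} (hx : x ∈ X.F s n) : x = 0 := by
  have := F_antitone h n hx
  rwa [X.succ_eq_bot, Submodule.mem_bot] at this

theorem cocyc_antitone {s s' : ℕ} (h : s ≤ s') (n : ℕ) : X.cocyc s' n ≤ X.cocyc s n :=
  inf_le_inf_right _ (F_antitone h n)

theorem cobd_antitone {s s' : ℕ} (h : s ≤ s') (n : ℕ) : X.cobd s' n ≤ X.cobd s n := by
  cases n with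
  | zero => exact le_rfl
  | succ n => exact Submodule.map_mono (F_antitone h n)

theorem cobd_le_cocyc (s n : ℕ) : X.cobd s n ≤ X.cocyc s n := by
  cases n with
  | zero => exact bot_le
  | succ n =>
    rintro _ ⟨y, hy, rfl⟩
    exact ⟨X.d_mem hy, X.d_d n y⟩

variable (X)

/-- The map induced in cohomology by the inclusion `F s' ⊆ F s`. -/
def incl {s s' : ℕ} (h : s ≤ s') (n : ℕ) : X.K s' n →ₗ[k] X.K s n :=
  Submodule.mapQ _ _ (Submodule.inclusion (cocyc_antitone h n)) fun _ hx => cobd_antitone h n hx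

/-- A filtration preserving map of cochain complexes. -/
structure Hom (X : FiltCx.{w₁} k) (Y : FiltCx.{w₂} k) where
  φ : ∀ n, X.X n →ₗ[k] Y.X n
  comm_d : ∀ n x, φ (n + 1) (X.d n x) = Y.d n (φ n x)
  map_F : ∀ {s n : ℕ} {x : X.X n}, x ∈ X.F s n → φ n x ∈ Y.F s n

namespace Hom

variable {X : FiltCx.{w₁} k} {Y : FiltCx.{w₂} k} (α : X.Hom Y)

theorem map_cocyc {s n : ℕ} {x : X.X n} (hx : x ∈ X.cocyc s n) : α.φ n x ∈ Y.cocyc s n := by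
  refine ⟨α.map_F hx.1, ?_⟩
  have h : X.d n x = 0 := hx.2
  change Y.d n _ = 0
  rw [← α.comm_d, h, map_zero]

theorem map_cobd {s : ℕ} : ∀ {n : ℕ} {x : X.X n}, x ∈ X.cobd s n → α.φ n x ∈ Y.cobd s n
  | 0, x, hx => by
      have : x = 0 := by simpa [cobd] using hx
      simp [this]
  | n + 1, x, hx => by
      obtain ⟨y, hy, rfl⟩ := hx
      exact ⟨α.φ n y, α.map_F hy, (α.comm_d n y).symm⟩

/-- The map induced in the cohomology of `F s`. -/
def mapK (s n : ℕ) : X.K s n →ₗ[k] Y.K s n :=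
  Submodule.mapQ _ _ ((α.φ n).restrict fun _ hx => α.map_cocyc hx) fun _ hx => α.map_cobd hx

/-- Injectivity in the cohomology of the graded pieces. -/
def GrInjective : Prop :=
  ∀ (s n : ℕ) (x : X.X n), x ∈ X.F s n → X.d n x ∈ X.F (s + 1) (n + 1) →
    (∃ b ∈ Y.cobd s n, α.φ n x - b ∈ Y.F (s + 1) n) → ∃ b ∈ X.cobd s n, x - b ∈ X.F (s + 1) n

/-- Surjectivity in the cohomology of the graded pieces. -/
def GrSurjective : Prop :=
  ∀ (s n : ℕ) (y : Y.X n), y ∈ Y.F s n → Y.d n y ∈ Y.F (s + 1) (n + 1) →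
    ∃ x ∈ X.F s n, X.d n x ∈ X.F (s + 1) (n + 1) ∧
      ∃ b ∈ Y.cobd s n, y - α.φ n x - b ∈ Y.F (s + 1) n

variable {α}

/-- The relative cohomology of a filtered map that is a quasi-isomorphism on graded pieces vanishes:
every relative cocycle `(x, y)` of `F s` is a relative coboundary. -/
theorem exists_of_gr (hi : α.GrInjective) (hs : α.GrSurjective) (m : ℕ) :
    ∀ {s n : ℕ}, s + m = n + 2 → ∀ {x : X.X (n + 1)} {y : Y.X n}, x ∈ X.F s (n + 1) →
      X.d (n + 1) x = 0 → y ∈ Y.F s n → α.φ (n + 1) x = Y.d n y →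
      ∃ x' ∈ X.F s n, X.d n x' = x ∧ y - α.φ n x' ∈ Y.cobd s n := by
  induction m with
  | zero =>
    intro s n hsn x y hx _ hy _
    refine ⟨0, zero_mem _, ?_, ?_⟩
    · rw [eq_zero_of_mem_F (by omega) hx, map_zero]
    · rw [eq_zero_of_mem_F (by omega) hy, map_zero, sub_zero]
      exact zero_mem _
  | succ m ih =>
    intro s n hsn x y hx hdx hy hxy
    obtain ⟨_, ⟨x₁, hx₁, rfl⟩, h₁⟩ := hi s (n + 1) x hx (by rw [hdx]; exact zero_mem _)
      ⟨Y.d n y, ⟨y, hy, rfl⟩, by rw [hxy, sub_self]; exact zero_mem _⟩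
    obtain ⟨x₂, hx₂, hdx₂, b, hb, h₂⟩ := hs s n (y - α.φ n x₁) (sub_mem hy (α.map_F hx₁)) (by
      rw [map_sub, ← hxy, ← α.comm_d, ← map_sub]
      exact α.map_F h₁)
    have hdb : Y.d n b = 0 := (cobd_le_cocyc s n hb).2
    obtain ⟨x₃, hx₃, hdx₃, h₃⟩ := ih (by omega) (sub_mem h₁ hdx₂)
      (by rw [map_sub, map_sub, hdx, X.d_d, X.d_d]; simp) h₂
      (by simp only [map_sub, hdb, hxy, α.comm_d, sub_zero])
    refine ⟨x₁ + x₂ + x₃, add_mem (add_mem hx₁ hx₂) (X.anti s n hx₃), ?_, ?_⟩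
    · rw [map_add, map_add, hdx₃]
      abel
    · have := add_mem hb (cobd_antitone s.le_succ n h₃)
      convert this using 1
      simp only [map_add]
      abel

/-- A filtered map that is a quasi-isomorphism on graded pieces is one on every filtration piece, as
the filtration is finite in each degree. -/
theorem mapK_bijective (hi : α.GrInjective) (hs : α.GrSurjective) (s n : ℕ) :
    Function.Bijective (α.mapK s n) := by
  refine ⟨(injective_iff_map_eq_zero _).2 fun x hx => ?_, fun y => ?_⟩
  · induction x using Submodule.Quotient.induction_on with | _ x => ?_
    have hx' : (⟨α.φ n x.1, α.map_cocyc x.2⟩ : Y.cocyc s n) ∈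
      (Y.cobd s n).comap (Y.cocyc s n).subtype := (Submodule.Quotient.mk_eq_zero _).1 hx
    change α.φ n x.1 ∈ Y.cobd s n at hx'
    have hdx : X.d n x.1 = 0 := x.2.2
    refine (Submodule.Quotient.mk_eq_zero _).2 ?_
    change x.1 ∈ X.cobd s n
    cases n with
    | zero =>
      have h0 : x.1 ∈ X.F (s + 1) 0 := by
        obtain ⟨b, hb, hxb⟩ := hi s 0 x.1 x.2.1 (by rw [hdx]; exact zero_mem _)
          ⟨_, hx', by rw [sub_self]; exact zero_mem _⟩
        have : b = 0 := by simpa [cobd] using hb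
        rwa [this, sub_zero] at hxb
      rw [eq_zero_of_mem_F s.succ_pos h0]
      exact zero_mem _
    | succ n =>
      obtain ⟨y, hy, hxy⟩ := hx'
      by_cases hsn : s ≤ n + 2
      · obtain ⟨x', hx', hdx', -⟩ := exists_of_gr hi hs (n + 2 - s) (by omega) x.2.1 hdx hy hxy.symm
        exact ⟨x', hx', hdx'⟩
      · rw [eq_zero_of_mem_F (by omega) x.2.1]
        exact zero_mem _
  · induction y using Submodule.Quotient.induction_on with | _ y => ?_
    have hdy : Y.d n y.1 = 0 := y.2.2
    obtain ⟨x, hx, hdx, hxy⟩ : ∃ x ∈ X.F s n, X.d n x = 0 ∧ y.1 - α.φ n x ∈ Y.cobd s n := by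
      by_cases hsn : s ≤ n + 2
      · exact exists_of_gr hi hs (n + 2 - s) (by omega) (zero_mem _) (map_zero _) y.2.1
          (by rw [hdy, map_zero])
      · refine ⟨0, zero_mem _, map_zero _, ?_⟩
        rw [eq_zero_of_mem_F (by omega) y.2.1, map_zero, sub_zero]
        exact zero_mem _
    refine ⟨Submodule.Quotient.mk ⟨x, hx, hdx⟩, ((Submodule.Quotient.eq _).2 ?_).symm⟩
    exact hxy

end Hom

end FiltCx

/-! ### Filtered complexes with leading terms -/

set_option linter.checkUnivs false in
/-- A filtered complex with a leading term map from the cohomology of `F s` to functions on a set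
`Λ` with values in graded modules `H`; the leading term of a class vanishes only if the class comes
from `F (s + 1)`. -/
structure LeadCx (k : Type) [CommRing k] (Λ : Type v) extends FiltCx.{w₁} k where
  H : ℕ → Type w₂
  [instAddCommGroupH : ∀ n, AddCommGroup (H n)]
  [instModuleH : ∀ n, Module k (H n)]
  lead : ∀ {s t n : ℕ}, s + t = n → toFiltCx.K s n →ₗ[k] (Λ → H t)
  exists_of_lead_eq_zero : ∀ {s t n : ℕ} (h : s + t = n) (x : toFiltCx.K s n), lead h x = 0 →
    ∃ y, toFiltCx.incl s.le_succ n y = x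

attribute [instance] LeadCx.instAddCommGroupH LeadCx.instModuleH

/-- An isomorphism between the cohomology groups of the filtration pieces of two filtered complexes,
compatible with the inclusions and with leading terms. -/
structure LeadIso {k : Type} [CommRing k] {Λ : Type v} (X : LeadCx.{v, w₁, w₂} k Λ)
    (Y : LeadCx.{v, w₃, w₄} k Λ) where
  θ : ∀ t, X.H t ≃ₗ[k] Y.H t
  Φ : ∀ s n, X.K s n ≃ₗ[k] Y.K s n
  comm_incl : ∀ {s s' : ℕ} (h : s ≤ s') (n : ℕ) (x : X.K s' n),
    Φ s n (X.incl h n x) = Y.incl h n (Φ s' n x)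
  comm_lead : ∀ {s t n : ℕ} (h : s + t = n) (x : X.K s n) (l : Λ),
    Y.lead h (Φ s n x) l = θ t (X.lead h x l)

namespace LeadIso

universe w₅ w₆

variable {k : Type} [CommRing k] {Λ : Type v} {X : LeadCx.{v, w₁, w₂} k Λ}
  {Y : LeadCx.{v, w₃, w₄} k Λ} {Z : LeadCx.{v, w₅, w₆} k Λ}

/-- The identity. -/
def refl (X : LeadCx.{v, w₁, w₂} k Λ) : LeadIso X X where
  θ _ := LinearEquiv.refl _ _
  Φ _ _ := LinearEquiv.refl _ _
  comm_incl _ _ _ := rfl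
  comm_lead _ _ _ := rfl

/-- The inverse. -/
def symm (I : LeadIso X Y) : LeadIso Y X where
  θ t := (I.θ t).symm
  Φ s n := (I.Φ s n).symm
  comm_incl h n x := by
    rw [LinearEquiv.symm_apply_eq, I.comm_incl, LinearEquiv.apply_symm_apply]
  comm_lead h x l := by
    rw [LinearEquiv.eq_symm_apply, ← I.comm_lead, LinearEquiv.apply_symm_apply]

/-- The composite. -/
def trans (I : LeadIso X Y) (J : LeadIso Y Z) : LeadIso X Z where
  θ t := (I.θ t).trans (J.θ t)
  Φ s n := (I.Φ s n).trans (J.Φ s n)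
  comm_incl h n x := by simp only [LinearEquiv.trans_apply, I.comm_incl, J.comm_incl]
  comm_lead h x l := by simp only [LinearEquiv.trans_apply, I.comm_lead, J.comm_lead]

/-- A filtered map that is a quasi-isomorphism on graded pieces and is compatible with leading
terms. -/
noncomputable def ofHom (θ : ∀ t, X.H t ≃ₗ[k] Y.H t) (α : X.toFiltCx.Hom Y.toFiltCx)
    (hi : α.GrInjective) (hs : α.GrSurjective)
    (h : ∀ {s t n : ℕ} (h : s + t = n) (x : X.K s n) (l : Λ),
      Y.lead h (α.mapK s n x) l = θ t (X.lead h x l)) : LeadIso X Y where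
  θ := θ
  Φ s n := LinearEquiv.ofBijective (α.mapK s n) (α.mapK_bijective hi hs s n)
  comm_incl h n x := by
    induction x using Submodule.Quotient.induction_on with | _ x => ?_
    rfl
  comm_lead := h

end LeadIso

/-! ### The total complex of a differential graded algebra with a group action -/

section Tot

variable {k : Type} [CommRing k] {P : Type v} [Group P]

/-- The differential of `D` on families of elements, indexed by the degree of its values. -/
def DGAlg.dPrev (D : DGAlg.{w} k) (c : ∀ t, D.X t) : ∀ t, D.X t
  | 0 => 0
  | t + 1 => D.d t (c t)

theorem ActedDGAlg.act_mem_B (D : ActedDGAlg.{v, w} k P) (g : P) :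
    ∀ {t : ℕ} {x : D.X t}, x ∈ D.B t → D.act t g x ∈ D.B t
  | 0, x, hx => by
      have : x = 0 := by simpa [DGAlg.B] using hx
      simp [this]
  | t + 1, x, hx => by
      obtain ⟨y, rfl⟩ := hx
      exact ⟨D.act t g y, (D.act_d t g y).symm⟩

/-- Cochains of total degree `n` of the double complex of normalized homogeneous cochains of `P`
with values in `D`: equivariant functions `c` from lists in `P` to families of elements of `D`, such
that `c l t` is nonzero only for nonempty `l` without repetition of consecutive entries and with
`l.length - 1 + t = n`. -/
def totCochains (D : ActedDGAlg.{v, w} k P) (n : ℕ) : Submodule k (List P → ∀ t, D.X t) where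
  carrier := {c | (∀ l t, l.length + t ≠ n + 1 → c l t = 0) ∧ (∀ t, c [] t = 0) ∧
    (∀ l t, ¬ l.IsChain (· ≠ ·) → c l t = 0) ∧
    ∀ (g : P) l t, c (l.map (g * ·)) t = D.act t g (c l t)}
  add_mem' {c c'} hc hc' := by
    refine ⟨fun l t h => ?_, fun t => ?_, fun l t h => ?_, fun g l t => ?_⟩
    · simp [hc.1 l t h, hc'.1 l t h]
    · simp [hc.2.1 t, hc'.2.1 t]
    · simp [hc.2.2.1 l t h, hc'.2.2.1 l t h]
    · simp [hc.2.2.2 g l t, hc'.2.2.2 g l t]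
  zero_mem' := by simp
  smul_mem' a c hc := by
    refine ⟨fun l t h => ?_, fun t => ?_, fun l t h => ?_, fun g l t => ?_⟩
    · simp [hc.1 l t h]
    · simp [hc.2.1 t]
    · simp [hc.2.2.1 l t h]
    · simp [hc.2.2.2 g l t]

variable {D : ActedDGAlg.{v, w} k P}

theorem isChain_map_mul (g : P) (l : List P) :
    (l.map (g * ·)).IsChain (· ≠ ·) ↔ l.IsChain (· ≠ ·) := by
  rw [List.isChain_map]
  simp

theorem totD_mem {n : ℕ} {c : List P → ∀ t, D.X t} (hc : c ∈ totCochains D n) :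
    (fun l t => D.dPrev (c l) t + (-1 : k) ^ (n + 1) • faceSum (fun l => c l t) l) ∈
      totCochains D (n + 1) := by
  obtain ⟨h₁, h₂, h₃, h₄⟩ := hc
  refine ⟨fun l t h => ?_, fun t => ?_, fun l t h => ?_, fun g l t => ?_⟩ <;> beta_reduce
  · have e : faceSum (fun l => c l t) l = 0 := faceSum_eq_zero fun l' _ hl' => h₁ _ _ (by omega)
    rw [e, smul_zero, add_zero]
    cases t with
    | zero => rfl
    | succ t => rw [DGAlg.dPrev, h₁ l t (by omega), map_zero]
  · rw [faceSum_nil, smul_zero, add_zero]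
    cases t with
    | zero => rfl
    | succ t => rw [DGAlg.dPrev, h₂, map_zero]
  · rw [faceSum_degenerate (fun l' hl' => h₃ l' t hl') h, smul_zero, add_zero]
    cases t with
    | zero => rfl
    | succ t => rw [DGAlg.dPrev, h₃ l t h, map_zero]
  · have e : faceSum (fun l => c l t) (l.map (g * ·)) =
        D.act t g (faceSum (fun l => c l t) l) := by
      rw [faceSum_map, funext fun l => h₄ g l t]
      exact faceSum_hom (D.act t g).toAddMonoidHom _ l
    rw [e, map_add, map_smul]
    congr 1
    cases t with
    | zero => exact (map_zero _).symm
    | succ t => rw [DGAlg.dPrev, DGAlg.dPrev, h₄, D.act_d]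

variable (D)

theorem DGAlg.dPrev_add (D : DGAlg.{w} k) (c c' : ∀ t, D.X t) (t : ℕ) :
    D.dPrev (c + c') t = D.dPrev c t + D.dPrev c' t := by
  cases t with
  | zero => exact (add_zero 0).symm
  | succ t => exact map_add _ _ _

theorem DGAlg.dPrev_smul (D : DGAlg.{w} k) (a : k) (c : ∀ t, D.X t) (t : ℕ) :
    D.dPrev (a • c) t = a • D.dPrev c t := by
  cases t with
  | zero => exact (smul_zero a).symm
  | succ t => exact map_smul _ _ _

/-- The differential of the total complex. -/
def totD (n : ℕ) : totCochains D n →ₗ[k] totCochains D (n + 1) where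
  toFun c := ⟨_, totD_mem c.2⟩
  map_add' c c' := by
    ext l t
    simp only [Submodule.coe_add, Pi.add_apply, DGAlg.dPrev_add, faceSum_add, smul_add]
    abel
  map_smul' a c := by
    ext l t
    simp only [Submodule.coe_smul, Pi.smul_apply, DGAlg.dPrev_smul, faceSum_smul, smul_add,
      RingHom.id_apply]
    rw [smul_comm a]

theorem totD_apply {n : ℕ} (c : totCochains D n) (l : List P) (t : ℕ) : (totD D n c).1 l t =
    D.dPrev (c.1 l) t + (-1 : k) ^ (n + 1) • faceSum (fun l => c.1 l t) l := rfl

theorem totD_totD (n : ℕ) (c : totCochains D n) : totD D (n + 1) (totD D n c) = 0 := by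
  ext l t
  have e : faceSum (fun l => (totD D n c).1 l t) l = faceSum (fun l => D.dPrev (c.1 l) t) l := by
    simp only [totD_apply]
    rw [faceSum_add, faceSum_smul, faceSum_faceSum, smul_zero, add_zero]
  rw [totD_apply, e]
  cases t with
  | zero =>
    rw [faceSum_eq_zero (f := fun l => D.dPrev (c.1 l) 0) fun _ _ _ => rfl, smul_zero]
    exact add_zero _
  | succ t =>
    have e' : faceSum (fun l => D.dPrev (c.1 l) (t + 1)) l =
        D.d t (faceSum (fun l => c.1 l t) l) := faceSum_hom (D.d t).toAddMonoidHom _ l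
    have e'' : D.d t (D.dPrev (c.1 l) t) = 0 := by
      cases t with
      | zero => exact map_zero _
      | succ t => exact D.d_d t _
    rw [e', DGAlg.dPrev, totD_apply, map_add, e'', map_smul, pow_succ _ (n + 1)]
    simp

/-- The total complex, filtered by the degree in the direction of `P`. -/
abbrev tot : FiltCx.{max v w} k where
  X n := totCochains D n
  d := totD D
  d_d := totD_totD D
  F s n :=
    { carrier := {c | ∀ l t, l.length ≤ s → c.1 l t = 0}
      add_mem' := fun hc hc' l t h => by simp [hc l t h, hc' l t h]
      zero_mem' := fun _ _ _ => rfl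
      smul_mem' := fun a c hc l t h => by simp [hc l t h] }
  anti s n c hc l t h := hc l t (h.trans s.le_succ)
  succ_eq_bot n := by
    refine (Submodule.eq_bot_iff _).2 fun c hc => ?_
    ext l t
    by_cases h : l.length ≤ n + 1
    · exact hc l t h
    · exact c.2.1 l t (by omega)
  d_mem {s n c} hc l t h := by
    rw [totD_apply, faceSum_eq_zero fun l' _ hl' => hc l' t (by omega), smul_zero, add_zero]
    cases t with
    | zero => rfl
    | succ t => rw [DGAlg.dPrev, hc l t h, map_zero]

variable {D}

theorem tot_d_apply {s n : ℕ} {c : (tot D).X n} (hc : c ∈ (tot D).F s n) {l : List P}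
    (hl : l.length ≤ s + 1) (t : ℕ) : ((tot D).d n c).1 l t = D.dPrev (c.1 l) t := by
  refine (totD_apply D c l t).trans ?_
  rw [faceSum_eq_zero fun l' _ hl' => hc l' t (by omega), smul_zero, add_zero]

theorem tot_mem_F_succ {s t n : ℕ} (h : s + t = n) {c : (tot D).X n} (hc : c ∈ (tot D).F s n)
    (h0 : ∀ l : List P, l.length = s + 1 → l.IsChain (· ≠ ·) → c.1 l t = 0) :
    c ∈ (tot D).F (s + 1) n := fun l t' hl => by
  by_cases hl' : l.length = s + 1
  · by_cases ht : t' = t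
    · subst ht
      by_cases hc' : l.IsChain (· ≠ ·)
      · exact h0 l hl' hc'
      · exact c.2.2.2.1 l t' hc'
    · exact c.2.1 l t' (by omega)
  · exact hc l t' (by omega)

/-- The equivariant function that agrees with `a` on simplices with first vertex `1`. -/
def translate (D : ActedDGAlg.{v, w} k P) {t : ℕ} (a : List P → D.X t) (l : List P) : D.X t :=
  D.act t (l.headD 1) (a (l.map ((l.headD 1)⁻¹ * ·)))

theorem translate_map {t : ℕ} (a : List P → D.X t) (g : P) {l : List P} (hl : l ≠ []) :
    translate D a (l.map (g * ·)) = D.act t g (translate D a l) := by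
  match l, hl with
  | x :: l, _ =>
    simp only [translate, List.map_cons, List.headD_cons, map_mul, Module.End.mul_apply,
      mul_inv_rev, List.map_map, Function.comp_def, mul_assoc, inv_mul_cancel_left]

open Classical in
/-- The total cochain concentrated in bidegree `(s, t)` with values `translate D a`. -/
noncomputable def spread (D : ActedDGAlg.{v, w} k P) {s t n : ℕ} (h : s + t = n)
    (a : List P → D.X t) : (tot D).X n :=
  ⟨fun l => if l.length = s + 1 ∧ l.IsChain (· ≠ ·) then Pi.single t (translate D a l) else 0, by
    refine ⟨fun l t' hl => ?_, fun t' => ?_, fun l t' hl => ?_, fun g l t' => ?_⟩ <;> beta_reduce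
    · split_ifs with h'
      · exact Pi.single_eq_of_ne (by omega) _
      · rfl
    · simp
    · simp [hl]
    · simp only [List.length_map, isChain_map_mul]
      split_ifs with h'
      · rw [translate_map _ _ (by rintro rfl; simp at h')]
        by_cases ht : t' = t
        · subst ht; simp
        · simp [Pi.single_eq_of_ne ht]
      · simp⟩

theorem spread_apply {s t n : ℕ} (h : s + t = n) (a : List P → D.X t) {l : List P}
    (hl : l.length = s + 1) (hl' : l.IsChain (· ≠ ·)) :
    (spread D h a).1 l t = translate D a l := by
  simp [spread, hl, hl']

theorem spread_mem_F {s t n : ℕ} (h : s + t = n) (a : List P → D.X t) :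
    spread D h a ∈ (tot D).F s n := fun l t' hl => by
  have : ¬ (l.length = s + 1 ∧ l.IsChain (· ≠ ·)) := fun h' => by omega
  simp [spread, this]

/-- An equivariant property that holds for all pairs `l, a l` holds for all pairs
`l, translate D a l`. -/
theorem translate_spec {t : ℕ} {a : List P → D.X t} {q : List P → D.X t → Prop}
    (hq : ∀ (g : P) l x, q l x → q (l.map (g * ·)) (D.act t g x)) {l : List P}
    (h : q (l.map ((l.headD 1)⁻¹ * ·)) (a (l.map ((l.headD 1)⁻¹ * ·)))) :
    q l (translate D a l) := by
  have := hq (l.headD 1) _ _ h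
  simpa only [translate, List.map_map, Function.comp_def, mul_inv_cancel_left, List.map_id']
    using this

theorem tot_cobd_apply_mem_B {s t n : ℕ} (h : s + t = n) {b : (tot D).X n}
    (hb : b ∈ (tot D).cobd s n) {l : List P} (hl : l.length = s + 1) : b.1 l t ∈ D.B t := by
  cases n with
  | zero =>
    have : b = 0 := by simpa [FiltCx.cobd] using hb
    rw [this]
    exact zero_mem _
  | succ n =>
    obtain ⟨y, hy, rfl⟩ := hb
    rw [tot_d_apply hy hl.le]
    cases t with
    | zero => exact zero_mem _
    | succ t => exact ⟨_, rfl⟩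

/-- A cochain of `F s` whose leading term consists of coboundaries is, modulo `F (s + 1)`, a
coboundary of `F s`. -/
theorem tot_exists_cobd {s t n : ℕ} (h : s + t = n) {c : (tot D).X n} (hc : c ∈ (tot D).F s n)
    (hB : ∀ l : List P, l.length = s + 1 → l.IsChain (· ≠ ·) → c.1 l t ∈ D.B t) :
    ∃ b ∈ (tot D).cobd s n, c - b ∈ (tot D).F (s + 1) n := by
  cases t with
  | zero =>
    refine ⟨0, zero_mem _, ?_⟩
    rw [sub_zero]
    exact tot_mem_F_succ h hc fun l hl hl' => by simpa [DGAlg.B] using hB l hl hl'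
  | succ t =>
    obtain ⟨n, rfl⟩ : ∃ m, n = m + 1 := ⟨s + t, by omega⟩
    have hex : ∀ l : List P, ∃ a : D.X t,
        l.length = s + 1 → l.IsChain (· ≠ ·) → D.d t a = c.1 l (t + 1) := fun l => by
      by_cases hl : l.length = s + 1 ∧ l.IsChain (· ≠ ·)
      · obtain ⟨a, ha⟩ := hB l hl.1 hl.2
        exact ⟨a, fun _ _ => ha⟩
      · exact ⟨0, fun h₁ h₂ => absurd ⟨h₁, h₂⟩ hl⟩
    choose a ha using hex
    have h' : s + t = n := by omega
    have hmem := spread_mem_F h' a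
    refine ⟨(tot D).d n (spread D h' a), ⟨_, hmem, rfl⟩,
      tot_mem_F_succ h (sub_mem hc ((tot D).d_mem hmem)) fun l hl hl' => ?_⟩
    have e : ((tot D).d n (spread D h' a)).1 l (t + 1) = c.1 l (t + 1) := by
      rw [tot_d_apply hmem hl.le, DGAlg.dPrev, spread_apply h' a hl hl']
      refine translate_spec (q := fun l x => D.d t x = c.1 l (t + 1)) (fun g l x hx => ?_)
        (ha _ (by simpa using hl) ((isChain_map_mul _ _).2 hl'))
      rw [← D.act_d, hx, c.2.2.2.2]
    exact sub_eq_zero.2 e.symm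

theorem tot_apply_mem_Z {s t n : ℕ} {c : (tot D).X n} (hc : c ∈ (tot D).F s n)
    {l : List P} (hl : l.length = s + 1) (h0 : ((tot D).d n c).1 l (t + 1) = 0) :
    c.1 l t ∈ D.Z t := by
  rwa [tot_d_apply hc hl.le] at h0

theorem tot_cocyc_apply_mem_Z {s t n : ℕ} (h : s + t = n) {c : (tot D).X n}
    (hc : c ∈ (tot D).cocyc s n) (l : List P) : c.1 l t ∈ D.Z t := by
  by_cases hl : l.length = s + 1
  · refine tot_apply_mem_Z hc.1 hl ?_
    have : (tot D).d n c = 0 := hc.2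
    rw [this]
    rfl
  · rw [c.2.1 l t (by omega)]
    exact zero_mem _

variable (D)

/-- The value of a cocycle of `F s` on a simplex, in bidegree `(s, t)`. -/
def totEval {s t n : ℕ} (h : s + t = n) (l : List P) : (tot D).cocyc s n →ₗ[k] D.Z t where
  toFun c := ⟨c.1.1 l t, tot_cocyc_apply_mem_Z h c.2 l⟩
  map_add' _ _ := rfl
  map_smul' _ _ := rfl

/-- The total complex with its leading terms, the classes in `H^t(D)` of the components of
bidegree `(s, t)`. -/
abbrev totLead : LeadCx.{v, max v w, w} k (List P) where
  toFiltCx := tot D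
  H := D.H
  lead {s t n} h := Submodule.liftQ _
    (LinearMap.pi fun l => ((D.B t).comap (D.Z t).subtype).mkQ ∘ₗ totEval D h l) fun c hc => by
      funext l
      refine (Submodule.Quotient.mk_eq_zero _).2 ?_
      change c.1.1 l t ∈ D.B t
      by_cases hl : l.length = s + 1
      · exact tot_cobd_apply_mem_B h hc hl
      · rw [c.1.2.1 l t (by omega)]
        exact zero_mem _
  exists_of_lead_eq_zero {s t n} h x hx := by
    induction x using Submodule.Quotient.induction_on with | _ c => ?_
    obtain ⟨b, hb, hcb⟩ := tot_exists_cobd h c.2.1 fun l _ _ =>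
      ((Submodule.Quotient.mk_eq_zero ((D.B t).comap (D.Z t).subtype)).1 (congrFun hx l) :
        totEval D h l c ∈ _)
    refine ⟨Submodule.Quotient.mk ⟨c.1 - b, hcb,
      sub_mem c.2.2 (FiltCx.cobd_le_cocyc s n hb).2⟩, (Submodule.Quotient.eq _).2 ?_⟩
    change c.1 - b - c.1 ∈ (tot D).cobd s n
    rw [sub_sub_cancel_left]
    exact neg_mem hb

variable {D} {C : ActedDGAlg.{v, w} k P}

/-- The map of total complexes induced by a `P`-invariant map. -/
def totMap (f : C.Hom D) : (tot C).Hom (tot D) where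
  φ n :=
    { toFun := fun c => ⟨fun l t => f.φ t (c.1 l t), by
        obtain ⟨h₁, h₂, h₃, h₄⟩ := c.2
        refine ⟨fun l t h => ?_, fun t => ?_, fun l t h => ?_, fun g l t => ?_⟩ <;> beta_reduce
        · rw [h₁ l t h, map_zero]
        · rw [h₂, map_zero]
        · rw [h₃ l t h, map_zero]
        · rw [h₄, f.comm_act]⟩
      map_add' := fun c c' => by ext l t; exact map_add _ _ _
      map_smul' := fun a c => by ext l t; exact map_smul _ _ _ }
  comm_d n c := by
    ext l t
    change f.φ t (C.dPrev (c.1 l) t + _) = D.dPrev (fun t => f.φ t (c.1 l t)) t + _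
    have e : faceSum (fun l => f.φ t (c.1 l t)) l = f.φ t (faceSum (fun l => c.1 l t) l) :=
      faceSum_hom (f.φ t).toAddMonoidHom _ l
    rw [map_add, map_smul]
    refine congrArg₂ (· + ·) ?_ (congrArg _ e.symm)
    cases t with
    | zero => exact map_zero _
    | succ t => exact f.comm_d t _
  map_F {s n c} hc l t h := by
    change f.φ t (c.1 l t) = 0
    rw [hc l t h, map_zero]

theorem ActedDGAlg.Hom.mem_B_of_map {f : C.Hom D} {t : ℕ} (hf : Function.Injective (f.mapH t))
    {x : C.X t} (hx : x ∈ C.Z t) (hfx : f.φ t x ∈ D.B t) : x ∈ C.B t := by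
  have h0 : f.mapH t (Submodule.Quotient.mk ⟨x, hx⟩) = 0 := by
    refine (Submodule.Quotient.mk_eq_zero _).2 ?_
    exact hfx
  rw [map_eq_zero_iff _ hf] at h0
  exact (Submodule.Quotient.mk_eq_zero ((C.B t).comap (C.Z t).subtype) (x := ⟨x, hx⟩)).1 h0

theorem ActedDGAlg.Hom.exists_sub_mem_B {f : C.Hom D} {t : ℕ}
    (hf : Function.Surjective (f.mapH t)) {y : D.X t} (hy : y ∈ D.Z t) :
    ∃ x ∈ C.Z t, y - f.φ t x ∈ D.B t := by
  obtain ⟨x, hx⟩ := hf (Submodule.Quotient.mk ⟨y, hy⟩)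
  induction x using Submodule.Quotient.induction_on with | _ x => ?_
  exact ⟨x.1, x.2, (Submodule.Quotient.eq ((D.B t).comap (D.Z t).subtype) (x := ⟨y, hy⟩)
    (y := ⟨f.φ t x.1, f.map_mem_Z x.2⟩)).1 hx.symm⟩

/-- A cocycle of the graded piece is a function with values in cocycles of `C`, and it is a
coboundary if and only if its values are; both can be tested in `D`. -/
theorem totMap_grInjective {f : C.Hom D} (hf : ∀ n, Function.Bijective (f.mapH n)) :
    (totMap f).GrInjective := by
  rintro s n x hx hdx ⟨b, hb, hxb⟩
  by_cases hn : n < s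
  · rw [FiltCx.eq_zero_of_mem_F hn hx]
    exact ⟨0, zero_mem _, by rw [sub_zero]; exact zero_mem _⟩
  obtain ⟨t, rfl⟩ : ∃ t, n = s + t := ⟨n - s, by omega⟩
  refine tot_exists_cobd rfl hx fun l hl hl' => ?_
  refine ActedDGAlg.Hom.mem_B_of_map (hf t).1 (tot_apply_mem_Z hx hl (hdx l _ hl.le)) ?_
  have h0 : f.φ t (x.1 l t) - b.1 l t = 0 := hxb l t hl.le
  rw [sub_eq_zero.1 h0]
  exact tot_cobd_apply_mem_B rfl hb hl

theorem totMap_grSurjective {f : C.Hom D} (hf : ∀ n, Function.Bijective (f.mapH n)) :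
    (totMap f).GrSurjective := by
  intro s n y hy hdy
  by_cases hn : n < s
  · rw [FiltCx.eq_zero_of_mem_F hn hy]
    exact ⟨0, zero_mem _, by rw [map_zero]; exact zero_mem _, 0, zero_mem _,
      by rw [map_zero, sub_zero, sub_zero]; exact zero_mem _⟩
  obtain ⟨t, rfl⟩ : ∃ t, n = s + t := ⟨n - s, by omega⟩
  have hex : ∀ l : List P, ∃ a ∈ C.Z t,
      l.length = s + 1 → y.1 l t - f.φ t a ∈ D.B t := fun l => by
    by_cases hl : l.length = s + 1
    · obtain ⟨a, ha, ha'⟩ := ActedDGAlg.Hom.exists_sub_mem_B (hf t).2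
        (tot_apply_mem_Z hy hl (hdy l _ hl.le))
      exact ⟨a, ha, fun _ => ha'⟩
    · exact ⟨0, zero_mem _, fun h => absurd h hl⟩
  choose a ha ha' using hex
  have hmem := spread_mem_F (rfl : s + t = s + t) a
  have hZ : ∀ l, translate C a l ∈ C.Z t := fun l =>
    translate_spec (q := fun _ x => x ∈ C.Z t) (fun g _ x hx => by
      have hx' : C.d t x = 0 := hx
      change C.d t _ = 0
      rw [← C.act_d, hx', map_zero]) (ha _)
  refine ⟨spread C rfl a, hmem,
    tot_mem_F_succ (t := t + 1) rfl ((tot C).d_mem hmem) fun l hl hl' => ?_,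
    tot_exists_cobd rfl (sub_mem hy ((totMap f).map_F hmem)) fun l hl hl' => ?_⟩
  · rw [tot_d_apply hmem hl.le, DGAlg.dPrev, spread_apply rfl a hl hl']
    exact hZ l
  · change y.1 l t - f.φ t ((spread C rfl a).1 l t) ∈ D.B t
    rw [spread_apply rfl a hl hl']
    refine translate_spec (q := fun l x => y.1 l t - f.φ t x ∈ D.B t) (fun g l x hx => ?_)
      (ha' _ (by simpa using hl))
    have := D.act_mem_B g hx
    rwa [map_sub, ← y.2.2.2.2, ← f.comm_act] at this

/-- A quasi-isomorphism induces an isomorphism on the cohomology of the filtration pieces of total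
complexes. -/
noncomputable def totLeadIso (f : C.Hom D) (hf : ∀ n, Function.Bijective (f.mapH n)) :
    LeadIso (totLead C) (totLead D) :=
  LeadIso.ofHom (fun t => LinearEquiv.ofBijective (f.mapH t) (hf t)) (totMap f)
    (totMap_grInjective hf) (totMap_grSurjective hf) fun h x l => by
      induction x using Submodule.Quotient.induction_on with | _ x => ?_
      rfl

/-- A zig-zag of quasi-isomorphisms that induce ring isomorphisms yields an isomorphism on the
cohomology of the filtration pieces of the total complexes, such that leading terms correspond
under an isomorphism of rings. -/
theorem ActedDGAlg.Zigzag.exists_leadIso (h : C.Zigzag D) :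
    ∃ I : LeadIso (totLead C) (totLead D), I.θ 0 C.cohomology.one = D.cohomology.one ∧
      ∀ {i j l : ℕ} (h : i + j = l) (x : C.H i) (y : C.H j),
        I.θ l (C.mulH h x y) = D.mulH h (I.θ i x) (I.θ j y) := by
  induction h with
  | rel X Y h =>
    obtain ⟨f⟩ := h
    exact ⟨totLeadIso f.toHom f.bijective, f.map_one, f.map_mul⟩
  | refl X => exact ⟨LeadIso.refl _, rfl, fun _ _ _ => rfl⟩
  | symm X Y _ ih =>
    obtain ⟨I, h₁, h₂⟩ := ih
    refine ⟨I.symm, (LinearEquiv.symm_apply_eq _).2 h₁.symm, fun {i j l} h x y =>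
      (LinearEquiv.symm_apply_eq (I.θ l)).2 ?_⟩
    refine Eq.trans ?_ (h₂ h _ _).symm
    change _ = Y.mulH h (I.θ i ((I.θ i).symm x)) (I.θ j ((I.θ j).symm y))
    rw [LinearEquiv.apply_symm_apply, LinearEquiv.apply_symm_apply]
  | trans X Y Z _ _ ih ih' =>
    obtain ⟨I, h₁, h₂⟩ := ih
    obtain ⟨J, h₃, h₄⟩ := ih'
    exact ⟨I.trans J, (congrArg (J.θ 0) h₁).trans h₃, fun {i j l} h x y =>
      (congrArg (J.θ l) (h₂ h x y)).trans (h₄ h _ _)⟩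

end Tot

/-! ### Cochains as functions on lists -/

section OnList

variable {k : Type} [CommRing k] {α : Type*}

/-- A function of `(n + 1)`-tuples, extended by zero to a function of lists.  The entry `e` is never
used, it only serves as a default value. -/
def onList (e : α) {n : ℕ} (f : (Fin (n + 1) → α) → k) (l : List α) : k :=
  if l.length = n + 1 then f fun i => l.getD i e else 0

theorem onList_of_length_ne {e : α} {n : ℕ} {f : (Fin (n + 1) → α) → k} {l : List α}
    (h : l.length ≠ n + 1) : onList e f l = 0 := if_neg h

theorem onList_of_length_eq {e : α} {n : ℕ} {f : (Fin (n + 1) → α) → k} {l : List α}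
    (h : l.length = n + 1) : onList e f l = f fun i => l.getD i e := if_pos h

theorem onList_ofFn (e : α) {n : ℕ} (f : (Fin (n + 1) → α) → k) (x : Fin (n + 1) → α) :
    onList e f (List.ofFn x) = f x := by
  rw [onList_of_length_eq (by simp)]
  congr 1
  funext i
  simp [List.getD_eq_getElem?_getD, -List.ofFn_succ, Nat.le_of_lt_succ i.2]

theorem exists_eq_ofFn {n : ℕ} {l : List α} (h : l.length = n) :
    ∃ x : Fin n → α, l = List.ofFn x := by
  subst h
  exact ⟨l.get, (List.ofFn_get l).symm⟩

theorem onList_map {β : Type*} (e : α) (e' : β) {n : ℕ} (f : (Fin (n + 1) → β) → k) (τ : α → β)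
    (l : List α) : onList e' f (l.map τ) = onList e (fun x => f fun i => τ (x i)) l := by
  by_cases h : l.length = n + 1
  · obtain ⟨x, rfl⟩ := exists_eq_ofFn h
    rw [List.map_ofFn, onList_ofFn, onList_ofFn]
    rfl
  · rw [onList_of_length_ne h, onList_of_length_ne (by simpa using h)]

theorem onList_eq_faceSum (e : α) {n : ℕ} (f : (Fin (n + 1) → α) → k)
    {g : (Fin (n + 2) → α) → k} (h : ∀ x, g x = (-1) ^ (n + 1) *
      ∑ i : Fin (n + 2), (-1) ^ (i : ℕ) * f (fun j => x (i.succAbove j))) (l : List α) :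
    onList e g l = (-1) ^ (n + 1) * faceSum (onList e f) l := by
  by_cases hl : l.length = n + 2
  · obtain ⟨x, rfl⟩ := exists_eq_ofFn hl
    rw [onList_ofFn, faceSum_ofFn, h]
    simp only [onList_ofFn, zsmul_eq_mul, Int.cast_pow, Int.cast_neg, Int.cast_one]
  · rw [onList_of_length_ne hl, faceSum_eq_zero, mul_zero]
    exact fun l' _ hl' => onList_of_length_ne (by omega)

theorem onList_eq_cup (e : α) {i j n : ℕ} (hn : i + j = n) (f : (Fin (i + 1) → α) → k)
    (f' : (Fin (j + 1) → α) → k) {g : (Fin (n + 1) → α) → k}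
    (h : ∀ x, g x = (-1) ^ (i * j) * (f (fun a => x ⟨a, by omega⟩) *
      f' (fun b => x ⟨i + b, by omega⟩))) (l : List α) :
    onList e g l = (-1) ^ (i * j) * cup i (onList e f) (onList e f') l := by
  by_cases hl : l.length = n + 1
  · obtain ⟨x, rfl⟩ := exists_eq_ofFn hl
    rw [onList_ofFn, h, cup, onList_of_length_eq (by simp; omega),
      onList_of_length_eq (by simp; omega)]
    congr 3
    · funext a
      have : (a : ℕ) < i + 1 := a.2
      have h' : (a : ℕ) < n + 1 := by omega
      simp [List.getD_eq_getElem?_getD, h', this, -List.ofFn_succ]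
    · funext b
      have h' : i + (b : ℕ) < n + 1 := by omega
      simp [List.getD_eq_getElem?_getD, List.getElem?_drop, h', -List.ofFn_succ]
  · rw [onList_of_length_ne hl, cup]
    by_cases hl' : l.length < i + 1
    · rw [onList_of_length_ne (by simp; omega), zero_mul, mul_zero]
    · rw [onList_of_length_ne (l := l.drop i) (by simp; omega), mul_zero, mul_zero]

end OnList

/-! ### The filtered cochain complex of a semidirect product -/

section Semidirect

variable {k : Type} [CommRing k] {N : Type u} [Group N] {P : Type v} [Group P]
  {φ : P →* MulAut N}

/-- A cochain of `N ⋊ P` as a function on lists of pairs. -/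
def pairFun {n : ℕ} (f : cochains k (N ⋊[φ] P) n) : List (P × N) → k :=
  onList (1, 1) fun x : Fin (n + 1) → P × N => f.1 fun i => ⟨(x i).2, (x i).1⟩

/-- The pairs of components of a tuple of elements of `N ⋊ P`. -/
def toPairs {n : ℕ} (x : Fin n → N ⋊[φ] P) : List (P × N) :=
  List.ofFn fun i => ((x i).right, (x i).left)

theorem length_toPairs {n : ℕ} (x : Fin n → N ⋊[φ] P) : (toPairs x).length = n := by
  simp [toPairs]

theorem exists_eq_toPairs {n : ℕ} {l : List (P × N)} (h : l.length = n) :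
    ∃ x : Fin n → N ⋊[φ] P, l = toPairs x := by
  obtain ⟨y, rfl⟩ := exists_eq_ofFn h
  exact ⟨fun i => ⟨(y i).2, (y i).1⟩, rfl⟩

theorem pairFun_toPairs {n : ℕ} (f : cochains k (N ⋊[φ] P) n) (x : Fin (n + 1) → N ⋊[φ] P) :
    pairFun f (toPairs x) = f.1 x := onList_ofFn _ _ _

theorem pairFun_of_length_ne {n : ℕ} (f : cochains k (N ⋊[φ] P) n) {l : List (P × N)}
    (h : l.length ≠ n + 1) : pairFun f l = 0 := onList_of_length_ne h

theorem pairFun_add {n : ℕ} (f f' : cochains k (N ⋊[φ] P) n) :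
    pairFun (f + f') = fun l => pairFun f l + pairFun f' l := by
  funext l
  simp only [pairFun, onList]
  split_ifs <;> simp

theorem pairFun_smul {n : ℕ} (a : k) (f : cochains k (N ⋊[φ] P) n) :
    pairFun (a • f) = fun l => a * pairFun f l := by
  funext l
  simp only [pairFun, onList]
  split_ifs <;> simp

theorem pairFun_stdD {n : ℕ} (f : cochains k (N ⋊[φ] P) n) :
    pairFun (stdD n f) = fun l => (-1) ^ (n + 1) * faceSum (pairFun f) l :=
  funext fun l => onList_eq_faceSum (1, 1)
    (fun x : Fin (n + 1) → P × N => f.1 fun i => ⟨(x i).2, (x i).1⟩)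
    (g := fun x => (stdD n f).1 fun i => ⟨(x i).2, (x i).1⟩) (fun _ => rfl) l

theorem pairFun_stdCup {i j n : ℕ} (h : i + j = n) (f : cochains k (N ⋊[φ] P) i)
    (f' : cochains k (N ⋊[φ] P) j) :
    pairFun (stdCup h f f') = fun l => (-1) ^ (i * j) * cup i (pairFun f) (pairFun f') l :=
  funext fun l => onList_eq_cup (1, 1) h
    (fun x : Fin (i + 1) → P × N => f.1 fun i => ⟨(x i).2, (x i).1⟩)
    (fun x : Fin (j + 1) → P × N => f'.1 fun i => ⟨(x i).2, (x i).1⟩)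
    (g := fun x => (stdCup h f f').1 fun i => ⟨(x i).2, (x i).1⟩) (fun _ => rfl) l

/-- The action of `g` on the second coordinates of pairs. -/
def leftMap (g : N ⋊[φ] P) (n : N) : N := g.left * φ g.right n

theorem toPairs_mul {n : ℕ} (g : N ⋊[φ] P) (x : Fin n → N ⋊[φ] P) :
    toPairs (fun i => g * x i) = (toPairs x).map (Prod.map (g.right * ·) (leftMap g)) := by
  rw [toPairs, toPairs, List.map_ofFn]
  rfl

theorem pairFun_map {n : ℕ} (f : cochains k (N ⋊[φ] P) n) (g : N ⋊[φ] P) (l : List (P × N)) :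
    pairFun f (l.map (Prod.map (g.right * ·) (leftMap g))) = pairFun f l := by
  by_cases h : l.length = n + 1
  · obtain ⟨x, rfl⟩ := exists_eq_toPairs (φ := φ) h
    rw [← toPairs_mul, pairFun_toPairs, pairFun_toPairs, f.2]
  · rw [pairFun_of_length_ne _ h, pairFun_of_length_ne _ (by simpa using h)]

theorem mem_skelCochains_iff {s n : ℕ} {f : cochains k (N ⋊[φ] P) n} :
    f ∈ skelCochains k SemidirectProduct.rightHom s n ↔ VanishBelow s (pairFun f) := by
  have key : ∀ x : Fin (n + 1) → N ⋊[φ] P, stepCount ((toPairs x).map Prod.fst) =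
      steps fun i => SemidirectProduct.rightHom (x i) := fun x => by
    rw [toPairs, List.map_ofFn, stepCount_ofFn]
    rfl
  constructor
  · intro hf l hl
    by_cases h : l.length = n + 1
    · obtain ⟨x, rfl⟩ := exists_eq_toPairs (φ := φ) h
      rw [pairFun_toPairs]
      exact hf x (by rwa [← key])
    · exact pairFun_of_length_ne f h
  · intro hf x hx
    rw [← pairFun_toPairs]
    exact hf _ (by rwa [key])

variable (k φ)

/-- The cochains of `N ⋊ P`, filtered by skeleta of `P`. -/
abbrev groupCx : FiltCx.{max u v} k where
  X n := cochains k (N ⋊[φ] P) n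
  d := stdD
  d_d := stdD_stdD
  F s n := skelCochains k SemidirectProduct.rightHom s n
  anti s n f hf x hx := hf x (by omega)
  succ_eq_bot n := by
    refine (Submodule.eq_bot_iff _).2 fun f hf => Subtype.ext (funext fun x => ?_)
    exact hf x (Nat.lt_succ_of_le (steps_le _))
  d_mem {s n f} hf := by
    rw [mem_skelCochains_iff] at hf ⊢
    rw [pairFun_stdD]
    exact fun l hl => mul_eq_zero_of_right _ (vanishBelow_faceSum hf l hl)

variable {k φ}

/-! ### The Alexander–Whitney map into the cochains of a semidirect product -/

/-- A total cochain as a function of two lists. -/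
def biFun {n : ℕ} (c : (tot (stdActedDGAlg k φ)).X n) (ps : List P) (ns : List N) : k :=
  onList 1 (c.1 ps (ns.length - 1)).1 ns

theorem biFun_of_length {n t : ℕ} (c : (tot (stdActedDGAlg k φ)).X n) (ps : List P) {ns : List N}
    (h : ns.length = t + 1) : biFun c ps ns = onList 1 (c.1 ps t).1 ns := by
  obtain rfl : t = ns.length - 1 := by omega
  rfl

theorem biFun_nil_right {n : ℕ} (c : (tot (stdActedDGAlg k φ)).X n) (ps : List P) :
    biFun c ps [] = 0 := onList_of_length_ne (by simp)

theorem onList_zero {n : ℕ} (ns : List N) : onList 1 (0 : cochains k N n).1 ns = 0 := by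
  simp [onList]

theorem biFun_eq_zero {n : ℕ} {c : (tot (stdActedDGAlg k φ)).X n} {ps : List P}
    (h : ∀ t, c.1 ps t = 0) (ns : List N) : biFun c ps ns = 0 := by
  rw [biFun, h]
  exact onList_zero ns

theorem biFun_of_length_ne {n : ℕ} (c : (tot (stdActedDGAlg k φ)).X n) {ps : List P} {ns : List N}
    (h : ps.length + ns.length ≠ n + 2) : biFun c ps ns = 0 := by
  cases ns with
  | nil => exact biFun_nil_right c ps
  | cons a ns =>
    have e : c.1 ps ((a :: ns).length - 1) = 0 := c.2.1 _ _ (by simp at h ⊢; omega)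
    rw [biFun, e]
    exact onList_zero _

theorem biFun_map {n : ℕ} (c : (tot (stdActedDGAlg k φ)).X n) (g : N ⋊[φ] P) (ps : List P)
    (ns : List N) : biFun c (ps.map (g.right * ·)) (ns.map (leftMap g)) = biFun c ps ns := by
  rw [biFun, biFun, List.length_map, c.2.2.2.2, onList_map 1]
  congr 1
  funext x
  refine Eq.trans ?_ ((c.1 ps (ns.length - 1)).2 (φ g.right⁻¹ g.left) x)
  refine congrArg (c.1 ps (ns.length - 1)).1 (funext fun i => ?_)
  simp [leftMap]

theorem biFun_totD {n : ℕ} (c : (tot (stdActedDGAlg k φ)).X n) {ps : List P} {ns : List N}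
    (hns : ns ≠ []) (h : ps.length + ns.length = n + 3) :
    biFun ((tot (stdActedDGAlg k φ)).d n c) ps ns = (-1) ^ (n + 1) *
      (faceSum (fun a => biFun c a ns) ps + (-1) ^ (ps.length + 1) * faceSum (biFun c ps) ns) := by
  obtain ⟨t, ht⟩ : ∃ t, ns.length = t + 1 :=
    ⟨ns.length - 1, by have := List.length_pos_iff.2 hns; omega⟩
  have hadd : ∀ f f' : cochains k N t,
      onList 1 (f + f').1 ns = onList 1 f.1 ns + onList 1 f'.1 ns := fun f f' => by
    simp only [onList]
    split_ifs
    simp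
  have hsmul : ∀ (a : k) (f : cochains k N t), onList 1 (a • f).1 ns = a * onList 1 f.1 ns :=
    fun a f => by
      simp only [onList]
      split_ifs
      simp
  have e1 : onList 1 (faceSum (fun l => c.1 l t) ps : cochains k N t).1 ns =
      faceSum (fun a => biFun c a ns) ps := by
    rw [funext fun a => biFun_of_length c a ht]
    exact (faceSum_hom (AddMonoidHom.mk' (fun f : cochains k N t => onList 1 f.1 ns) hadd)
      (fun l => c.1 l t) ps).symm
  have hsign : (-1 : k) ^ (n + 1) * (-1) ^ (ps.length + 1) = (-1) ^ t := by
    rw [← pow_add, show n + 1 + (ps.length + 1) = t + 2 * ps.length by omega, pow_add, pow_mul]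
    simp
  have e2 : onList 1 ((stdActedDGAlg k φ).dPrev (c.1 ps) t : cochains k N t).1 ns =
      (-1) ^ t * faceSum (biFun c ps) ns := by
    cases t with
    | zero =>
      obtain ⟨a, rfl⟩ := List.length_eq_one_iff.1 ht
      rw [faceSum_cons, faceSum_nil, biFun_nil_right, sub_zero, mul_zero]
      exact onList_zero _
    | succ t =>
      refine (onList_eq_faceSum 1 (c.1 ps t).1 (fun _ => rfl) ns).trans ?_
      congr 1
      exact faceSum_congr fun l' _ hl' => (biFun_of_length c ps (by omega)).symm
  rw [biFun_of_length _ _ ht, mul_add, ← mul_assoc, hsign, ← e1, ← e2, ← hsmul]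
  exact Eq.trans rfl ((hadd _ _).trans (add_comm _ _))

/-- The image of a total cochain under the Alexander–Whitney map. -/
def awCochain {n : ℕ} (c : (tot (stdActedDGAlg k φ)).X n) : cochains k (N ⋊[φ] P) n :=
  ⟨fun x => alexWhit (biFun c) (toPairs x), fun g x => by
    beta_reduce
    rw [toPairs_mul, alexWhit_map]
    simp only [biFun_map]⟩

theorem pairFun_awCochain {n : ℕ} (c : (tot (stdActedDGAlg k φ)).X n) :
    pairFun (awCochain c) = alexWhit (biFun c) := by
  funext l
  by_cases h : l.length = n + 1
  · obtain ⟨x, rfl⟩ := exists_eq_toPairs (φ := φ) h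
    exact pairFun_toPairs _ x
  · rw [pairFun_of_length_ne _ h]
    exact (alexWhit_eq_zero fun ps ns _ _ _ _ hl => biFun_of_length_ne c (by omega)).symm

theorem cochains_ext {n : ℕ} {f f' : cochains k (N ⋊[φ] P) n}
    (h : ∀ l : List (P × N), l.length = n + 1 → pairFun f l = pairFun f' l) : f = f' :=
  Subtype.ext (funext fun x => by
    rw [← pairFun_toPairs, ← pairFun_toPairs, h _ (length_toPairs x)])

theorem biFun_add {n : ℕ} (c c' : (tot (stdActedDGAlg k φ)).X n) :
    biFun (c + c') = fun ps ns => biFun c ps ns + biFun c' ps ns := by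
  funext ps ns
  simp only [biFun, onList]
  split_ifs
  · rfl
  · simp

theorem biFun_smul {n : ℕ} (a : k) (c : (tot (stdActedDGAlg k φ)).X n) :
    biFun (a • c) = fun ps ns => a * biFun c ps ns := by
  funext ps ns
  simp only [biFun, onList]
  split_ifs
  · rfl
  · simp

variable (k φ) in
/-- The Alexander–Whitney map from the total complex of the cochains of `N` to the cochains of
`N ⋊ P`. -/
def awHom : (tot (stdActedDGAlg k φ)).Hom (groupCx k φ) where
  φ n :=
    { toFun := awCochain
      map_add' := fun c c' => cochains_ext fun l _ => by
        rw [pairFun_awCochain, biFun_add, pairFun_add, pairFun_awCochain, pairFun_awCochain,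
          alexWhit_add]
      map_smul' := fun a c => cochains_ext fun l _ => by
        rw [pairFun_awCochain, biFun_smul, RingHom.id_apply, pairFun_smul, pairFun_awCochain,
          alexWhit_mul] }
  comm_d n c := cochains_ext fun l hl => by
    change pairFun (awCochain _) l = pairFun (stdD n (awCochain c)) l
    have hl' : l ≠ [] := by rintro rfl; simp at hl
    rw [pairFun_stdD, pairFun_awCochain, pairFun_awCochain]
    have key := alexWhit_faceSum (biFun c) hl'
    rw [biFun_eq_zero c.2.2.1, biFun_nil_right, mul_zero, add_zero, add_zero] at key
    beta_reduce
    rw [← key, ← alexWhit_mul]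
    exact alexWhit_congr fun ps ns _ _ _ hns hlen => biFun_totD c hns (by omega)
  map_F {s n c} hc := by
    refine mem_skelCochains_iff.2 ?_
    change VanishBelow s (pairFun (awCochain c))
    rw [pairFun_awCochain]
    refine fun l hl => alexWhit_eq_zero fun ps ns hps _ hps' _ _ => biFun_eq_zero (fun t => ?_) ns
    by_cases hch : ps.IsChain (· ≠ ·)
    · refine hc ps t ?_
      have h1 := stepCount_sublist hps
      match ps, hps' with
      | p :: ps, _ =>
        rw [stepCount_of_isChain hch] at h1
        simp only [List.length_cons]
        omega
    · exact c.2.2.2.1 ps t hch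

/-! ### Leading terms of cochains of a semidirect product -/

/-- The leading term of a cochain of `N ⋊ P` over a simplex of `P`, as a cochain of `N`. -/
def leadCochain {n : ℕ} (f : cochains k (N ⋊[φ] P) n) (l : List P) (t : ℕ) : cochains k N t :=
  ⟨fun x => lead l (pairFun f) (List.ofFn x), fun a x => by
    have h1 : List.ofFn (fun i => a * x i) =
        (List.ofFn x).map (leftMap (SemidirectProduct.inl a : N ⋊[φ] P)) := by
      rw [List.map_ofFn]
      congr 1
      funext i
      simp [leftMap]
    have h2 : l.map ((SemidirectProduct.inl a : N ⋊[φ] P).right * ·) = l := by simp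
    beta_reduce
    rw [h1]
    nth_rewrite 1 [← h2]
    rw [lead_map]
    simp only [pairFun_map]⟩

theorem leadCochain_apply {n : ℕ} (f : cochains k (N ⋊[φ] P) n) (l : List P) (t : ℕ)
    (x : Fin (t + 1) → N) : (leadCochain f l t).1 x = lead l (pairFun f) (List.ofFn x) := rfl

theorem onList_leadCochain {n : ℕ} (f : cochains k (N ⋊[φ] P) n) (l : List P) {t : ℕ}
    {ns : List N} (h : ns.length = t + 1) :
    onList 1 (leadCochain f l t).1 ns = lead l (pairFun f) ns := by
  obtain ⟨x, rfl⟩ := exists_eq_ofFn h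
  rw [onList_ofFn, leadCochain_apply]

theorem leadCochain_congr {s n : ℕ} {f f' : cochains k (N ⋊[φ] P) n}
    (h : f - f' ∈ (groupCx k φ).F s n) {l : List P} (hl : l.length ≤ s) (t : ℕ) :
    leadCochain f l t = leadCochain f' l t :=
  Subtype.ext (funext fun x => lead_congr l _ hl fun l' hl' => by
    have e := mem_skelCochains_iff.1 h l' hl'
    have e' : pairFun f = fun l => pairFun (f - f') l + pairFun f' l := by
      rw [← pairFun_add, sub_add_cancel]
    rw [e']
    beta_reduce
    rw [e, zero_add])

theorem leadCochain_eq_zero {s n : ℕ} {f : cochains k (N ⋊[φ] P) n}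
    (h : f ∈ (groupCx k φ).F s n) {l : List P} (hl : l.length ≤ s) (t : ℕ) :
    leadCochain f l t = 0 :=
  Subtype.ext (funext fun _ => lead_eq_zero _ hl (mem_skelCochains_iff.1 h))

/-- Leading terms are equivariant, so that they form a cochain of `P` with values in the cochains
of `N`. -/
theorem leadCochain_map {n : ℕ} (f : cochains k (N ⋊[φ] P) n) (g : P) (l : List P) (t : ℕ) :
    leadCochain f (l.map (g * ·)) t = stdAct k φ t g (leadCochain f l t) := by
  refine Subtype.ext (funext fun x => ?_)
  change lead _ _ _ = lead _ _ (List.ofFn fun i => φ g⁻¹ (x i))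
  have h1 : List.ofFn x = (List.ofFn fun i => φ g⁻¹ (x i)).map
      (leftMap (SemidirectProduct.inr g : N ⋊[φ] P)) := by
    rw [List.map_ofFn]
    congr 1
    funext i
    simp [leftMap]
  have h2 : l.map (g * ·) = l.map ((SemidirectProduct.inr g : N ⋊[φ] P).right * ·) := by simp
  rw [h1, h2, lead_map]
  simp only [pairFun_map]

theorem leadCochain_stdD {s t n : ℕ} (h : s + t = n) {f : cochains k (N ⋊[φ] P) n}
    (hf : f ∈ (groupCx k φ).F s n) {l : List P} (hl : l.length = s + 1) :
    leadCochain (stdD n f) l (t + 1) = stdD t (leadCochain f l t) := by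
  refine Subtype.ext (funext fun x => ?_)
  rw [← onList_ofFn 1 (stdD t (leadCochain f l t)).1 x, onList_eq_faceSum 1
    (leadCochain f l t).1 (g := (stdD t (leadCochain f l t)).1) (fun _ => rfl),
    leadCochain_apply, pairFun_stdD, lead_mul, lead_faceSum (mem_skelCochains_iff.1 hf) hl,
    ← mul_assoc]
  congr 1
  · rw [← pow_add, ← h, show s + t + 1 + s = t + 1 + 2 * s by omega, pow_add, pow_mul]
    simp
  · exact faceSum_congr fun l' _ hl' =>
      (onList_leadCochain f l (by simpa using hl')).symm

theorem leadCochain_awCochain {s n : ℕ} (t : ℕ) {c : (tot (stdActedDGAlg k φ)).X n}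
    (hc : c ∈ (tot (stdActedDGAlg k φ)).F s n) {l : List P} (hl : l.length = s + 1) :
    leadCochain (awCochain c) l t = c.1 l t := by
  refine Subtype.ext (funext fun x => ?_)
  rw [leadCochain_apply, pairFun_awCochain, lead_alexWhit (s := s)
    (fun ps ns hps => biFun_eq_zero (fun t => c.2.2.2.1 ps t hps) ns)
    (fun ps ns hps => biFun_eq_zero (fun t => hc ps t hps) ns) hl (by simp),
    biFun_of_length (t := t) c l (by simp), onList_ofFn]

/-- The leading term of the image of a cochain is the cochain itself, and leading terms of
coboundaries are coboundaries. -/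
theorem awHom_grInjective : (awHom k φ).GrInjective := by
  rintro s n x hx - ⟨b, hb, hxb⟩
  by_cases hn : n < s
  · rw [FiltCx.eq_zero_of_mem_F hn hx]
    exact ⟨0, zero_mem _, by rw [sub_zero]; exact zero_mem _⟩
  obtain ⟨t, rfl⟩ : ∃ t, n = s + t := ⟨n - s, by omega⟩
  refine tot_exists_cobd rfl hx fun l hl _ => ?_
  have e : leadCochain b l t = x.1 l t := by
    rw [← leadCochain_awCochain t hx hl]
    exact (leadCochain_congr hxb hl.le t).symm
  rw [← e]
  cases t with
  | zero =>
    have hb0 : b = 0 := by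
      cases s with
      | zero => simpa [FiltCx.cobd] using hb
      | succ s =>
        obtain ⟨w, hw, rfl⟩ := hb
        rw [FiltCx.eq_zero_of_mem_F (Nat.lt_succ_self _) hw, map_zero]
    rw [hb0, leadCochain_eq_zero (s := s + 1) (zero_mem _) hl.le]
    exact zero_mem _
  | succ t =>
    obtain ⟨w, hw, rfl⟩ := hb
    exact ⟨leadCochain w l t, (leadCochain_stdD rfl hw hl).symm⟩

/-- The straightening cochain, as a cochain of `N ⋊ P`. -/
noncomputable def straightenCochain (s m : ℕ) {n : ℕ} (f : cochains k (N ⋊[φ] P) n) :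
    cochains k (N ⋊[φ] P) m :=
  ⟨fun x => straighten s (pairFun f) (toPairs x), fun g x => by
    beta_reduce
    rw [toPairs_mul, straighten_map (mul_right_injective g.right)]
    simp only [pairFun_map]⟩

theorem pairFun_straightenCochain (s m : ℕ) {n : ℕ} (f : cochains k (N ⋊[φ] P) n)
    {l : List (P × N)} (h : l.length = m + 1) :
    pairFun (straightenCochain s m f) l = straighten s (pairFun f) l := by
  obtain ⟨x, rfl⟩ := exists_eq_toPairs (φ := φ) h
  exact pairFun_toPairs _ x

theorem straightenCochain_mem {s m n : ℕ} {f : cochains k (N ⋊[φ] P) n}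
    (hf : f ∈ (groupCx k φ).F s n) : straightenCochain s m f ∈ (groupCx k φ).F s m := by
  refine mem_skelCochains_iff.2 fun l hl => ?_
  by_cases h : l.length = m + 1
  · rw [pairFun_straightenCochain s m f h]
    exact vanishBelow_straighten (mem_skelCochains_iff.1 hf) l hl
  · exact pairFun_of_length_ne _ h

/-- In degree zero there is no cochain to take the coboundary of, but there the straightening has
zero face sum. -/
theorem exists_cobd_straighten {s n : ℕ} {f : cochains k (N ⋊[φ] P) n}
    (hf : f ∈ (groupCx k φ).F s n) (hn : s ≤ n) : ∃ b ∈ (groupCx k φ).cobd s n,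
      ∀ l : List (P × N), l.length = n + 1 → pairFun b l = faceSum (straighten s (pairFun f)) l := by
  cases n with
  | zero =>
    obtain rfl : s = 0 := by omega
    refine ⟨0, zero_mem _, fun l hl => ?_⟩
    obtain ⟨x, rfl⟩ := exists_eq_toPairs (φ := φ) hl
    rw [pairFun_toPairs]
    exact (faceSum_zero _).symm
  | succ n =>
    refine ⟨_, ⟨(-1 : k) ^ (n + 1) • straightenCochain s n f,
      Submodule.smul_mem _ _ (straightenCochain_mem hf), rfl⟩, fun l hl => ?_⟩
    change pairFun (stdD n _) l = _
    rw [map_smul, pairFun_smul, pairFun_stdD]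
    beta_reduce
    rw [← mul_assoc, ← mul_pow, neg_one_mul, neg_neg, one_pow, one_mul]
    exact faceSum_congr fun l' _ hl' => pairFun_straightenCochain s n f (by omega)

/-- A cocycle of the graded piece differs by the coboundary of its straightening from the image of
its leading term. -/
theorem awHom_grSurjective : (awHom k φ).GrSurjective := by
  intro s n y hy hdy
  by_cases hn : n < s
  · rw [FiltCx.eq_zero_of_mem_F hn hy]
    exact ⟨0, zero_mem _, by rw [map_zero]; exact zero_mem _, 0, zero_mem _,
      by rw [map_zero, sub_zero, sub_zero]; exact zero_mem _⟩
  obtain ⟨t, rfl⟩ : ∃ t, n = s + t := ⟨n - s, by omega⟩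
  set D := stdActedDGAlg k φ with hD
  let a : List P → D.X t := fun l => leadCochain y l t
  have hmem := spread_mem_F (D := D) (rfl : s + t = s + t) a
  have ha : ∀ l : List P, l.length = s + 1 → l.IsChain (· ≠ ·) →
      (spread D (rfl : s + t = s + t) a).1 l t = leadCochain y l t := fun l hl hl' => by
    rw [spread_apply rfl a hl hl']
    refine translate_spec (a := a) (q := fun l x => x = leadCochain y l t) (fun g l x hx => ?_) rfl
    rw [leadCochain_map, hx]
    rfl
  obtain ⟨b, hb, hb'⟩ := exists_cobd_straighten hy (by omega)
  refine ⟨spread D (rfl : s + t = s + t) a, hmem,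
    tot_mem_F_succ (t := t + 1) rfl ((tot D).d_mem hmem) fun l hl hl' => ?_, b, hb, ?_⟩
  · rw [tot_d_apply hmem hl.le, DGAlg.dPrev, ha l hl hl']
    exact (leadCochain_stdD rfl hy hl).symm.trans (leadCochain_eq_zero hdy hl.le _)
  · refine mem_skelCochains_iff.2 fun l hl => ?_
    by_cases hlen : l.length = s + t + 1
    · have hl0 : l ≠ [] := by rintro rfl; simp at hlen
      have hdy' : VanishBelow (s + 1) (faceSum (pairFun y)) := fun l hl => by
        have := mem_skelCochains_iff.1 hdy l hl
        rw [pairFun_stdD] at this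
        have h1 := congrArg ((-1 : k) ^ (s + t + 1) * ·) this
        simpa only [← mul_assoc, ← mul_pow, neg_one_mul, neg_neg, one_pow, one_mul,
          mul_zero] using h1
      have key := eq_faceSum_straighten_add (mem_skelCochains_iff.1 hy) hdy' hl0
        (Nat.le_of_lt_succ hl)
      have e : alexWhit (biFun (spread D (rfl : s + t = s + t) a)) l = alexWhitTerm s
          (fun ps ns => open Classical in
            if ps.IsChain (· ≠ ·) then lead ps (pairFun y) ns else 0) l := by
        rw [alexWhit_eq_alexWhitTerm (s := s)]
        · refine alexWhitTerm_congr_of_length fun ps ns hps hns => ?_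
          split_ifs with hch
          · rw [biFun_of_length (t := t) _ _ (by omega), ha ps hps hch,
              onList_leadCochain _ _ (by omega)]
          · exact biFun_eq_zero (fun t' => (spread D (rfl : s + t = s + t) a).2.2.2.1 ps t' hch) ns
        · intro ps ns hps
          refine biFun_eq_zero (fun t' => ?_) ns
          have : ¬ (ps.length = s + 1 ∧ ps.IsChain (· ≠ ·)) := fun h => hps h.1
          simp [spread, this]
      have e2 : pairFun (y - awCochain (spread D (rfl : s + t = s + t) a) - b) l =
          pairFun y l - pairFun (awCochain (spread D (rfl : s + t = s + t) a)) l - pairFun b l := by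
        obtain ⟨x, rfl⟩ := exists_eq_toPairs (φ := φ) hlen
        simp only [pairFun_toPairs]
        rfl
      refine e2.trans ?_
      rw [pairFun_awCochain, e, hb' l hlen, key]
      ring
    · exact pairFun_of_length_ne _ hlen

end Semidirect

/-! ### Cohomology classes and their leading terms -/

section GroupLead

variable {k : Type} [CommRing k] {N : Type u} [Group N] {P : Type v} [Group P]
  {φ : P →* MulAut N}

theorem leadCochain_mem_Z {s t n : ℕ} (h : s + t = n) {f : cochains k (N ⋊[φ] P) n}
    (hf : f ∈ (groupCx k φ).cocyc s n) {l : List P} (hl : l.length = s + 1) :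
    leadCochain f l t ∈ (stdDGAlg k N).Z t := by
  have hdf : stdD n f = 0 := hf.2
  change stdD t (leadCochain f l t) = 0
  rw [← leadCochain_stdD h hf.1 hl, hdf]
  exact leadCochain_eq_zero (zero_mem _) hl.le _

open Classical in
variable (k φ) in
/-- The leading term over a nondegenerate simplex, on cocycles of `F s`. -/
noncomputable def leadZ {s t n : ℕ} (h : s + t = n) (l : List P) :
    (groupCx k φ).cocyc s n →ₗ[k] (stdDGAlg k N).Z t :=
  if hl : l.length = s + 1 ∧ l.IsChain (· ≠ ·) then
    { toFun := fun f => ⟨leadCochain f.1 l t, leadCochain_mem_Z h f.2 hl.1⟩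
      map_add' := fun f f' => Subtype.ext (Subtype.ext (funext fun x => by
        change lead l (pairFun (f.1 + f'.1)) _ = _
        rw [pairFun_add, lead_add]
        rfl))
      map_smul' := fun a f => Subtype.ext (Subtype.ext (funext fun x => by
        change lead l (pairFun (a • f.1)) _ = _
        rw [pairFun_smul, lead_mul]
        rfl)) }
  else 0

theorem leadZ_apply {s t n : ℕ} (h : s + t = n) {l : List P} (hl : l.length = s + 1)
    (hl' : l.IsChain (· ≠ ·)) (f : (groupCx k φ).cocyc s n) :
    (leadZ k φ h l f).1 = leadCochain f.1 l t := by
  rw [leadZ, dif_pos ⟨hl, hl'⟩]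
  rfl

theorem leadZ_eq_zero {s t n : ℕ} (h : s + t = n) {l : List P}
    (hl : ¬ (l.length = s + 1 ∧ l.IsChain (· ≠ ·))) : leadZ k φ h l = 0 := by
  rw [leadZ, dif_neg hl]

theorem leadZ_mem_B {s t n : ℕ} (h : s + t = n) (l : List P) {f : (groupCx k φ).cocyc s n}
    (hf : f.1 ∈ (groupCx k φ).cobd s n) : (leadZ k φ h l f).1 ∈ (stdDGAlg k N).B t := by
  by_cases hl : l.length = s + 1 ∧ l.IsChain (· ≠ ·)
  · rw [leadZ_apply h hl.1 hl.2]
    cases n with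
    | zero =>
      have hf0 : f.1 = 0 := by simpa [FiltCx.cobd] using hf
      rw [hf0, leadCochain_eq_zero (zero_mem _) hl.1.le]
      exact zero_mem _
    | succ n =>
      obtain ⟨w, hw, hwf⟩ := hf
      cases t with
      | zero =>
        have hf0 : f.1 = 0 := by
          rw [← hwf, FiltCx.eq_zero_of_mem_F (by omega) hw, map_zero]
        rw [hf0, leadCochain_eq_zero (zero_mem _) hl.1.le]
        exact zero_mem _
      | succ t =>
        rw [← hwf]
        exact ⟨leadCochain w l t, (leadCochain_stdD (by omega) hw hl.1).symm⟩
  · rw [leadZ_eq_zero h hl]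
    exact zero_mem _

variable (k φ) in
/-- The leading terms of classes in the cohomology of the filtration pieces. -/
noncomputable def groupLeadMap {s t n : ℕ} (h : s + t = n) :
    (groupCx k φ).K s n →ₗ[k] (List P → (stdDGAlg k N).H t) :=
  Submodule.liftQ _
    (LinearMap.pi fun l => (((stdDGAlg k N).B t).comap ((stdDGAlg k N).Z t).subtype).mkQ ∘ₗ
      leadZ k φ h l) fun f hf => by
      funext l
      exact (Submodule.Quotient.mk_eq_zero _).2 (leadZ_mem_B h l hf)

theorem groupLeadMap_mk {s t n : ℕ} (h : s + t = n) (f : (groupCx k φ).cocyc s n) (l : List P) :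
    groupLeadMap k φ h (Submodule.Quotient.mk f) l = Submodule.Quotient.mk (leadZ k φ h l f) :=
  rfl

theorem groupLeadMap_mapK {s t n : ℕ} (h : s + t = n) (x : (tot (stdActedDGAlg k φ)).K s n)
    (l : List P) : groupLeadMap k φ h ((awHom k φ).mapK s n x) l =
      (totLead (stdActedDGAlg k φ)).lead h x l := by
  induction x using Submodule.Quotient.induction_on with | _ c => ?_
  refine congrArg (Submodule.Quotient.mk
    (p := ((stdDGAlg k N).B t).comap ((stdDGAlg k N).Z t).subtype)) (Subtype.ext ?_)
  by_cases hl : l.length = s + 1 ∧ l.IsChain (· ≠ ·)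
  · exact (leadZ_apply h hl.1 hl.2 _).trans (leadCochain_awCochain t c.2.1 hl.1)
  · rw [leadZ_eq_zero h hl]
    change 0 = c.1.1 l t
    by_cases hl' : l.length = s + 1
    · exact (c.1.2.2.2.1 l t fun hch => hl ⟨hl', hch⟩).symm
    · exact (c.1.2.1 l t (by omega)).symm

variable (k φ) in
/-- The filtered cochain complex of `N ⋊ P` with its leading terms. -/
noncomputable abbrev groupLead : LeadCx.{v, max u v, u} k (List P) where
  toFiltCx := groupCx k φ
  H := (stdDGAlg k N).H
  lead h := groupLeadMap k φ h
  exists_of_lead_eq_zero {s t n} h x hx := by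
    obtain ⟨c, rfl⟩ :=
      (FiltCx.Hom.mapK_bijective awHom_grInjective awHom_grSurjective s n).2 x
    obtain ⟨y, rfl⟩ := (totLead (stdActedDGAlg k φ)).exists_of_lead_eq_zero h c
      (funext fun l => (groupLeadMap_mapK h c l).symm.trans (congrFun hx l))
    induction y using Submodule.Quotient.induction_on with | _ y => ?_
    exact ⟨(awHom k φ).mapK (s + 1) n (Submodule.Quotient.mk y), rfl⟩

variable (k φ) in
/-- The Alexander–Whitney map induces an isomorphism on the cohomology of the filtration pieces. -/
noncomputable def awLeadIso : LeadIso (totLead (stdActedDGAlg k φ)) (groupLead k φ) :=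
  LeadIso.ofHom (fun _ => LinearEquiv.refl _ _) (awHom k φ) awHom_grInjective
    awHom_grSurjective groupLeadMap_mapK

variable (k φ) in
/-- The map from the cohomology of `F s` to the cohomology of `N ⋊ P`. -/
def toCoh (s n : ℕ) : (groupCx k φ).K s n →ₗ[k] (stdDGAlg k (N ⋊[φ] P)).H n :=
  Submodule.mapQ _ _ (Submodule.inclusion (inf_le_right : (groupCx k φ).cocyc s n ≤ _))
    fun x hx => by
      cases n with
      | zero => exact hx
      | succ n =>
        obtain ⟨w, -, hw⟩ := hx
        exact ⟨w, hw⟩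

theorem toCoh_incl {s s' : ℕ} (h : s ≤ s') (n : ℕ) (x : (groupCx k φ).K s' n) :
    toCoh k φ s n ((groupCx k φ).incl h n x) = toCoh k φ s' n x := by
  induction x using Submodule.Quotient.induction_on with | _ x => ?_
  rfl

theorem range_toCoh (s n : ℕ) : LinearMap.range (toCoh k φ s n) =
    (lhsFiltration k (SemidirectProduct.rightHom : N ⋊[φ] P →* P)).F s n := by
  ext c
  constructor
  · rintro ⟨x, rfl⟩
    induction x using Submodule.Quotient.induction_on with | _ x => ?_
    exact ⟨⟨x.1, x.2.2⟩, x.2.1, rfl⟩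
  · rintro ⟨z, hz, rfl⟩
    exact ⟨Submodule.Quotient.mk ⟨z.1, hz, z.2⟩, rfl⟩

theorem mem_F_zero {n : ℕ} (f : cochains k (N ⋊[φ] P) n) : f ∈ (groupCx k φ).F 0 n :=
  fun _ hx => absurd hx (Nat.not_lt_zero _)

theorem toCoh_zero_bijective (n : ℕ) : Function.Bijective (toCoh k φ 0 n) := by
  refine ⟨(injective_iff_map_eq_zero _).2 fun x hx => ?_, fun c => ?_⟩
  · induction x using Submodule.Quotient.induction_on with | _ x => ?_
    have hx' : (⟨x.1, x.2.2⟩ : (stdDGAlg k (N ⋊[φ] P)).Z n) ∈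
      ((stdDGAlg k (N ⋊[φ] P)).B n).comap ((stdDGAlg k (N ⋊[φ] P)).Z n).subtype :=
        (Submodule.Quotient.mk_eq_zero _).1 hx
    refine (Submodule.Quotient.mk_eq_zero _).2 ?_
    change x.1 ∈ (groupCx k φ).cobd 0 n
    cases n with
    | zero => exact hx'
    | succ n =>
      obtain ⟨w, hw⟩ := hx'
      exact ⟨w, mem_F_zero w, hw⟩
  · induction c using Submodule.Quotient.induction_on with | _ z => ?_
    exact ⟨Submodule.Quotient.mk ⟨z.1, mem_F_zero _, z.2⟩, rfl⟩

/-- The unit class has leading term the unit class of `N`, over every vertex of `P`. -/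
theorem exists_lead_one : ∃ x : (groupCx k φ).K 0 0,
    toCoh k φ 0 0 x = (groupCoh k (N ⋊[φ] P)).one ∧
    (∀ p, groupLeadMap k φ (rfl : 0 + 0 = 0) x [p] = (groupCoh k N).one) ∧
    ∀ l : List P, l.length ≠ 1 → groupLeadMap k φ (rfl : 0 + 0 = 0) x l = 0 := by
  refine ⟨Submodule.Quotient.mk ⟨stdOne, mem_F_zero _,
    DGAlg.one_mem_Z (D := stdDGAlg k (N ⋊[φ] P))⟩, rfl, fun p => ?_, fun l hl => ?_⟩
  · rw [groupLeadMap_mk]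
    refine congrArg (Submodule.Quotient.mk
      (p := ((stdDGAlg k N).B 0).comap ((stdDGAlg k N).Z 0).subtype)) (Subtype.ext ?_)
    rw [leadZ_apply _ rfl (List.isChain_singleton p)]
    refine Subtype.ext (funext fun x => ?_)
    rw [leadCochain_apply, lead, pairFun, onList_of_length_eq (by simp)]
    rfl
  · rw [groupLeadMap_mk, leadZ_eq_zero _ (by simp [hl])]
    rfl

/-- Leading terms of cup products, at the level of cochains.  The sign depends on degrees only. -/
theorem leadCochain_stdCup {s t s' t' i j n m : ℕ} (hi : s + t = i) (hn : i + j = n)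
    (hm : t + t' = m) {f : cochains k (N ⋊[φ] P) i} {f' : cochains k (N ⋊[φ] P) j}
    (hf : f ∈ (groupCx k φ).F s i) (hf' : f' ∈ (groupCx k φ).F s' j) {ps qs : List P} {p : P}
    (hps : ps.length = s) (hqs : qs.length = s') :
    leadCochain (stdCup hn f f') (ps ++ p :: qs) m =
      (-1 : k) ^ (i * j + t * s' + t * t') •
        stdCup hm (leadCochain f (ps ++ [p]) t) (leadCochain f' (p :: qs) t') := by
  refine Subtype.ext (funext fun x => ?_)
  have key : lead (ps ++ p :: qs) (pairFun (stdCup hn f f')) (List.ofFn x) =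
      (-1) ^ (i * j + t * s') * cup t (lead (ps ++ [p]) (pairFun f)) (lead (p :: qs) (pairFun f'))
        (List.ofFn x) := by
    rw [pairFun_stdCup, lead_mul]
    subst hi
    rw [lead_cup t (mem_skelCochains_iff.1 hf) (mem_skelCochains_iff.1 hf') hps hqs, cup, pow_add]
    ring
  have e : (stdCup hm (leadCochain f (ps ++ [p]) t) (leadCochain f' (p :: qs) t')).1 x =
      (-1) ^ (t * t') * cup t (lead (ps ++ [p]) (pairFun f)) (lead (p :: qs) (pairFun f'))
        (List.ofFn x) := by
    rw [← onList_ofFn 1 (stdCup hm _ _).1 x, onList_eq_cup 1 hm (leadCochain f (ps ++ [p]) t).1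
      (leadCochain f' (p :: qs) t').1 (g := (stdCup hm _ _).1) (fun _ => rfl), cup, cup,
      onList_leadCochain _ _ (by simp; omega), onList_leadCochain _ _ (by simp; omega)]
  rw [leadCochain_apply, key]
  change _ = (-1 : k) ^ (i * j + t * s' + t * t') * (stdCup hm _ _).1 x
  have hsq : (-1 : k) ^ (t * t') * (-1) ^ (t * t') = 1 := by rw [← mul_pow]; simp
  rw [e, pow_add _ _ (t * t'), mul_assoc, ← mul_assoc ((-1 : k) ^ (t * t')), hsq, one_mul]

/-- Leading terms of products of classes. -/
theorem exists_lead_mul {s t s' t' i j n m r : ℕ} (hi : s + t = i) (hj : s' + t' = j)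
    (hn : i + j = n) (hm : t + t' = m) (hr : s + s' = r) (hrm : r + m = n)
    (x : (groupCx k φ).K s i) (y : (groupCx k φ).K s' j) :
    ∃ z : (groupCx k φ).K r n,
      toCoh k φ r n z = (stdDGAlg k (N ⋊[φ] P)).mulH hn (toCoh k φ s i x) (toCoh k φ s' j y) ∧
      (∀ (ps : List P) (p : P) (qs : List P), ps.length = s → qs.length = s' →
        (ps ++ p :: qs).IsChain (· ≠ ·) →
        groupLeadMap k φ hrm z (ps ++ p :: qs) = (-1 : k) ^ (i * j + t * s' + t * t') •
          (stdDGAlg k N).mulH hm (groupLeadMap k φ hi x (ps ++ [p]))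
            (groupLeadMap k φ hj y (p :: qs))) ∧
      ∀ l : List P, ¬ (l.length = r + 1 ∧ l.IsChain (· ≠ ·)) → groupLeadMap k φ hrm z l = 0 := by
  induction x using Submodule.Quotient.induction_on with | _ x => ?_
  induction y using Submodule.Quotient.induction_on with | _ y => ?_
  have hF : stdCup hn x.1 y.1 ∈ (groupCx k φ).F r n := by
    intro x' hx'
    rw [steps_add hn] at hx'
    have hlt : steps (fun a : Fin (i + 1) => SemidirectProduct.rightHom (x' ⟨a, by omega⟩)) < s ∨
        steps (fun b : Fin (j + 1) => SemidirectProduct.rightHom (x' ⟨i + b, by omega⟩)) < s' := by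
      by_contra hcon
      rw [not_or] at hcon
      omega
    refine (stdCup_apply hn x.1 y.1 x').trans ?_
    rcases hlt with hlt | hlt
    · rw [show x.1.1 (fun a => x' ⟨a, _⟩) = 0 from x.2.1 _ hlt]
      simp
    · rw [show y.1.1 (fun b => x' ⟨i + b, _⟩) = 0 from y.2.1 _ hlt]
      simp
  refine ⟨Submodule.Quotient.mk ⟨stdCup hn x.1 y.1, hF,
    DGAlg.mul_mem_Z (D := stdDGAlg k (N ⋊[φ] P)) hn x.2.2 y.2.2⟩, rfl,
    fun ps p qs hps hqs hch => ?_, fun l hl => ?_⟩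
  · rw [groupLeadMap_mk, groupLeadMap_mk, groupLeadMap_mk]
    refine congrArg (Submodule.Quotient.mk
      (p := ((stdDGAlg k N).B m).comap ((stdDGAlg k N).Z m).subtype)) (Subtype.ext ?_)
    have hch' := List.isChain_split.1 hch
    rw [leadZ_apply _ (by simp; omega) hch]
    refine (leadCochain_stdCup hi hn hm x.2.1 y.2.1 hps hqs).trans ?_
    rw [← leadZ_apply hi (by simp [hps]) hch'.1, ← leadZ_apply hj (by simp [hqs]) hch'.2]
    rfl
  · rw [groupLeadMap_mk, leadZ_eq_zero _ hl]
    rfl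

end GroupLead

/-! ### Comparison of two semidirect products -/

section Compare

variable {k : Type} [CommRing k] {N N' : Type u} [Group N] [Group N'] {P : Type v} [Group P]
  {φ : P →* MulAut N} {φ' : P →* MulAut N'}

/-- The isomorphism between the cohomology groups of two semidirect products that corresponds to an
isomorphism on the cohomology of the filtration pieces. -/
noncomputable def cohEquiv (I : LeadIso (groupLead k φ) (groupLead k φ')) (n : ℕ) :
    (stdDGAlg k (N ⋊[φ] P)).H n ≃ₗ[k] (stdDGAlg k (N' ⋊[φ'] P)).H n :=
  (LinearEquiv.ofBijective _ (toCoh_zero_bijective (φ := φ) n)).symm ≪≫ₗ I.Φ 0 n ≪≫ₗ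
    LinearEquiv.ofBijective _ (toCoh_zero_bijective (φ := φ') n)

theorem cohEquiv_toCoh (I : LeadIso (groupLead k φ) (groupLead k φ')) (s n : ℕ)
    (x : (groupCx k φ).K s n) : cohEquiv I n (toCoh k φ s n x) = toCoh k φ' s n (I.Φ s n x) := by
  rw [← toCoh_incl s.zero_le, ← toCoh_incl s.zero_le, ← I.comm_incl]
  have e : (LinearEquiv.ofBijective _ (toCoh_zero_bijective (φ := φ) n)).symm
      (toCoh k φ 0 n ((groupCx k φ).incl s.zero_le n x)) = (groupCx k φ).incl s.zero_le n x :=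
    (LinearEquiv.symm_apply_eq _).2 rfl
  exact congrArg (fun y => toCoh k φ' 0 n (I.Φ 0 n y)) e

theorem map_cohEquiv (I : LeadIso (groupLead k φ) (groupLead k φ')) (s n : ℕ) :
    ((lhsFiltration k (SemidirectProduct.rightHom : N ⋊[φ] P →* P)).F s n).map
      (cohEquiv I n).toLinearMap =
    (lhsFiltration k (SemidirectProduct.rightHom : N' ⋊[φ'] P →* P)).F s n := by
  rw [← range_toCoh, ← range_toCoh]
  ext c
  constructor
  · rintro ⟨_, ⟨x, rfl⟩, rfl⟩
    exact ⟨_, (cohEquiv_toCoh I s n x).symm⟩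
  · rintro ⟨y, rfl⟩
    refine ⟨_, ⟨(I.Φ s n).symm y, rfl⟩, ?_⟩
    refine (cohEquiv_toCoh I s n _).trans ?_
    rw [LinearEquiv.apply_symm_apply]

/-- Two classes of the cohomology of `F s` with the same leading terms differ by a class of
`F (s + 1)`. -/
theorem toCoh_sub_mem {s t n : ℕ} (h : s + t = n) {x y : (groupCx k φ).K s n}
    (hxy : groupLeadMap k φ h x = groupLeadMap k φ h y) :
    toCoh k φ s n x - toCoh k φ s n y ∈
      (lhsFiltration k (SemidirectProduct.rightHom : N ⋊[φ] P →* P)).F (s + 1) n := by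
  obtain ⟨z, hz⟩ := (groupLead k φ).exists_of_lead_eq_zero h (x - y)
    (by rw [map_sub]; exact sub_eq_zero.2 hxy)
  rw [← map_sub, ← hz, toCoh_incl, ← range_toCoh]
  exact ⟨z, rfl⟩

/-- The unit corresponds to the unit modulo `F 1`. -/
theorem cohEquiv_one (I : LeadIso (groupLead k φ) (groupLead k φ'))
    (h1 : I.θ 0 (groupCoh k N).one = (groupCoh k N').one)
    {e : (stdDGAlg k (N' ⋊[φ'] P)).H 0} (he : e = (groupCoh k (N' ⋊[φ'] P)).one) :
    cohEquiv I 0 (groupCoh k (N ⋊[φ] P)).one - e ∈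
      (lhsFiltration k (SemidirectProduct.rightHom : N' ⋊[φ'] P →* P)).F 1 0 := by
  obtain ⟨x, hx, hx₁, hx₂⟩ := exists_lead_one (k := k) (φ := φ)
  obtain ⟨y, hy, hy₁, hy₂⟩ := exists_lead_one (k := k) (φ := φ')
  have hsub : cohEquiv I 0 (groupCoh k (N ⋊[φ] P)).one - e =
      toCoh k φ' 0 0 (I.Φ 0 0 x) - toCoh k φ' 0 0 y := by
    rw [← cohEquiv_toCoh]
    exact congrArg₂ (fun a b => cohEquiv I 0 a - b) hx.symm (he.trans hy.symm)
  rw [hsub]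
  refine toCoh_sub_mem (t := 0) (rfl : 0 + 0 = 0) (funext fun l => ?_)
  refine (I.comm_lead (rfl : 0 + 0 = 0) x l).trans ?_
  by_cases hl : l.length = 1
  · obtain ⟨p, rfl⟩ := List.length_eq_one_iff.1 hl
    exact (congrArg (I.θ 0) (hx₁ p)).trans (h1.trans (hy₁ p).symm)
  · rw [hy₂ l hl]
    exact (congrArg (I.θ 0) (hx₂ l hl)).trans (map_zero _)

/-- The isomorphism is multiplicative modulo the next step of the filtration, since both products
have the same leading term. -/
theorem cohEquiv_mul (I : LeadIso (groupLead k φ) (groupLead k φ'))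
    (hmul : ∀ {i j l : ℕ} (h : i + j = l) (x : (stdDGAlg k N).H i) (y : (stdDGAlg k N).H j),
      I.θ l ((stdDGAlg k N).mulH h x y) = (stdDGAlg k N').mulH h (I.θ i x) (I.θ j y))
    {s s' r i j n : ℕ} (hr : s + s' = r) (hn : i + j = n)
    {x : (stdDGAlg k (N ⋊[φ] P)).H i} {y : (stdDGAlg k (N ⋊[φ] P)).H j}
    (hx : x ∈ (lhsFiltration k (SemidirectProduct.rightHom : N ⋊[φ] P →* P)).F s i)
    (hy : y ∈ (lhsFiltration k (SemidirectProduct.rightHom : N ⋊[φ] P →* P)).F s' j) :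
    cohEquiv I n ((stdDGAlg k (N ⋊[φ] P)).mulH hn x y) -
      (stdDGAlg k (N' ⋊[φ'] P)).mulH hn (cohEquiv I i x) (cohEquiv I j y) ∈
      (lhsFiltration k (SemidirectProduct.rightHom : N' ⋊[φ'] P →* P)).F (r + 1) n := by
  rw [← range_toCoh] at hx hy
  obtain ⟨x, rfl⟩ := hx
  obtain ⟨y, rfl⟩ := hy
  by_cases hi : i < s
  · obtain rfl : x = 0 := by
      induction x using Submodule.Quotient.induction_on with | _ x => ?_
      rw [show x = 0 from Subtype.ext (FiltCx.eq_zero_of_mem_F hi x.2.1)]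
      rfl
    simp only [map_zero, LinearMap.zero_apply, sub_zero]
    exact zero_mem _
  by_cases hj : j < s'
  · obtain rfl : y = 0 := by
      induction y using Submodule.Quotient.induction_on with | _ y => ?_
      rw [show y = 0 from Subtype.ext (FiltCx.eq_zero_of_mem_F hj y.2.1)]
      rfl
    simp only [map_zero, sub_zero]
    exact zero_mem _
  obtain ⟨t, hi⟩ : ∃ t, s + t = i := ⟨i - s, by omega⟩
  obtain ⟨t', hj⟩ : ∃ t, s' + t = j := ⟨j - s', by omega⟩
  obtain ⟨z, hz, hz₁, hz₂⟩ := exists_lead_mul hi hj hn rfl hr (by omega) x y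
  obtain ⟨z', hz', hz₁', hz₂'⟩ :=
    exists_lead_mul hi hj hn rfl hr (by omega) (I.Φ s i x) (I.Φ s' j y)
  rw [cohEquiv_toCoh, cohEquiv_toCoh, ← hz, ← hz', cohEquiv_toCoh]
  refine toCoh_sub_mem (t := t + t') (by omega) (funext fun l => ?_)
  refine (I.comm_lead (by omega) z l).trans ?_
  by_cases hl : l.length = r + 1 ∧ l.IsChain (· ≠ ·)
  · obtain ⟨ps, p, qs, rfl, hps, hqs⟩ : ∃ ps p qs, l = ps ++ p :: qs ∧ ps.length = s ∧
        qs.length = s' := by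
      have hs : s < l.length := by omega
      refine ⟨l.take s, l[s], l.drop (s + 1), ?_, by simp; omega, by simp; omega⟩
      rw [← List.drop_eq_getElem_cons hs, List.take_append_drop]
    have e := (I.comm_lead hi x (ps ++ [p]))
    have e' := (I.comm_lead hj y (p :: qs))
    rw [hz₁' ps p qs hps hqs hl.2]
    refine (congrArg (I.θ (t + t')) (hz₁ ps p qs hps hqs hl.2)).trans ?_
    refine (map_smul (I.θ (t + t')) _ _).trans (congrArg (_ • ·) ?_)
    refine (hmul _ _ _).trans ?_
    exact congrArg₂ (fun a b => (stdDGAlg k N').mulH rfl a b) e.symm e'.symm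
  · rw [hz₂' l hl]
    exact (congrArg (I.θ (t + t')) (hz₂ l hl)).trans (map_zero _)

/-- The isomorphism of components of the associated bigraded algebras. -/
noncomputable def grEquiv (I : LeadIso (groupLead k φ) (groupLead k φ')) (a : ℕ × ℕ) :
    (lhsFiltration k (SemidirectProduct.rightHom : N ⋊[φ] P →* P)).Gr a ≃ₗ[k]
      (lhsFiltration k (SemidirectProduct.rightHom : N' ⋊[φ'] P →* P)).Gr a :=
  Submodule.Quotient.equiv _ _
    ((cohEquiv I a.2).ofSubmodules _ _ (map_cohEquiv I a.1 a.2)) (by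
      ext c
      constructor
      · rintro ⟨x, hx, rfl⟩
        have hx' : x.1 ∈ (lhsFiltration k _).F (a.1 + 1) a.2 := hx
        have := Submodule.mem_map_of_mem (f := (cohEquiv I a.2).toLinearMap) hx'
        rw [map_cohEquiv] at this
        exact this
      · intro hc
        have hc' : c.1 ∈ (lhsFiltration k _).F (a.1 + 1) a.2 := hc
        rw [← map_cohEquiv I] at hc'
        obtain ⟨x, hx, hxc⟩ := hc'
        exact ⟨⟨x, (lhsFiltration k _).anti _ _ hx⟩, hx, Subtype.ext hxc⟩)

/-- An isomorphism on the cohomology of the filtration pieces under which leading terms correspond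
via a ring isomorphism induces an isomorphism of associated bigraded algebras. -/
theorem nonempty_iso_assocBigraded (I : LeadIso (groupLead k φ) (groupLead k φ'))
    (h1 : I.θ 0 (groupCoh k N).one = (groupCoh k N').one)
    (hmul : ∀ {i j l : ℕ} (h : i + j = l) (x : (stdDGAlg k N).H i) (y : (stdDGAlg k N).H j),
      I.θ l ((stdDGAlg k N).mulH h x y) = (stdDGAlg k N').mulH h (I.θ i x) (I.θ j y)) :
    Nonempty ((lhsFiltration k (SemidirectProduct.rightHom : N ⋊[φ] P →* P)).assocBigraded.Iso
      (lhsFiltration k (SemidirectProduct.rightHom : N' ⋊[φ'] P →* P)).assocBigraded) := by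
  refine ⟨⟨grEquiv I, ?_, fun {a b c} h x y => ?_⟩⟩
  · exact (Submodule.Quotient.eq _).2 (cohEquiv_one I h1 rfl)
  · induction x using Submodule.Quotient.induction_on with | _ x => ?_
    induction y using Submodule.Quotient.induction_on with | _ y => ?_
    exact (Submodule.Quotient.eq _).2 (cohEquiv_mul I hmul (congrArg Prod.fst h)
      (congrArg Prod.snd h) x.2 y.2)

end Compare

end TwistedCohomology

theorem mainTheorem11 (p : ℕ) [Fact p.Prime] (hp : p ≠ 2)
    {P : Type v} {A : Type u} [Group P] [AddCommGroup A] [Finite A] [DistribMulAction P A]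
    (hP : IsPGroup p P) (hA : IsPGroup p (Multiplicative A))
    (L : TwistedCohomology.TwistForm P A)
    (hlift : TwistedCohomology.HasIntegralLifting p P A)
    (hpow : TwistedCohomology.IsPowerful p (TwistedCohomology.Twisted L))
    (hcen : TwistedCohomology.IsPCentral p (TwistedCohomology.Twisted L))
    (hext : TwistedCohomology.HasOmegaEP p (TwistedCohomology.Twisted L))
    (hconj : TwistedCohomology.RealizabilityConjecture p L) :
    ∃ (F : TwistedCohomology.Filtration (TwistedCohomology.groupCoh (ZMod p)
          (TwistedCohomology.Twisted L ⋊[TwistedCohomology.twistedAut L] P)))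
      (F' : TwistedCohomology.Filtration (TwistedCohomology.groupCoh (ZMod p)
          (Multiplicative A ⋊[TwistedCohomology.abelianAut P A] P))),
      F = TwistedCohomology.lhsFiltration (ZMod p) SemidirectProduct.rightHom ∧
      F' = TwistedCohomology.lhsFiltration (ZMod p) SemidirectProduct.rightHom ∧
      Nonempty (F.assocBigraded.Iso F'.assocBigraded) := by
  obtain ⟨I, h1, hmul⟩ := TwistedCohomology.ActedDGAlg.Zigzag.exists_leadIso
    (Relation.EqvGen.symm _ _ (hconj hlift hpow hcen hext))
  refine ⟨_, _, rfl, rfl, TwistedCohomology.nonempty_iso_assocBigraded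
    (((TwistedCohomology.awLeadIso (ZMod p) (TwistedCohomology.twistedAut L)).symm.trans I).trans
      (TwistedCohomology.awLeadIso (ZMod p) (TwistedCohomology.abelianAut P A))) h1 hmul⟩
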